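/- For a finite set $e$ of vertices and a set $S$ of vertices, $e$ is \emph{cut} by $S$ if $e\cap S\ne\varnothing$ and $e\not\subseteq S$. Let $V$ be a finite set with $n$ elements, and let $\{\bar u : u\in V\}$ be vectors in the unit ball of $\mathbb R^d$. A random set $S\subset V$ is an \emph{$\ell_2$--$\ell_2^2$ hypergraph $m$-orthogonal separator} with $\ell_2$-distortion $D_{\ell_2}:\mathbb N\to\mathbb R$, $\ell_2^2$-distortion $D_{\ell_2^2}$, probability scale $\alpha>0$ and separation threshold $\beta\in(0,1)$ if 1. $\Pr(u\in S)=\alpha\|\bar u\|^2$ for every $u\in V$; 2. $\Pr(u\in S\text{ and }v\in S)\le \alpha\,\min(\|\bar u\|^2,\|\bar v\|^2)/m$ for all $u,v\in V$ with $\|\bar u-\bar v\|^2\ge\beta\min(\|\bar u\|^2,\|\bar v\|^2)$; 3. for every nonempty $e\subset V$, $$\Pr(e\text{ is cut by }S)\le \alpha D_{\ell_2^2}\max_{u,v\in e}\|\bar u-\bar v\|^2+\alpha D_{\ell_2}(|e|)\cdot\min_{w\in e}\|\bar w\|\cdot\max_{u,v\in e}\|\bar u-\bar v\|.$$ **Theorem.**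 There are a randomized algorithm, a polynomial $T$ and a universal constant $C>0$ with the following property. Let $m\ge 2$ and $\beta\in(0,1)$ be real, and let $\{\bar u\}_{u\in V}$ be $n$ vectors in the unit ball of $\mathbb R^d$ that satisfy the $\ell_2^2$-triangle inequalities $$\|\bar u-\bar v\|^2+\|\bar v-\bar w\|^2\ge\|\bar u-\bar w\|^2,\qquad 0\le\langle\bar u,\bar v\rangle\le\|\bar u\|^2\qquad(u,v,w\in V).$$ Given these vectors, $m$ and $\beta$, the algorithm always halts after at most $T(n+d+\lceil\log_2 m\rceil)$ steps, and its output is an $\ell_2$--$\ell_2^2$ hypergraph $m$-orthogonal separator for $\{\bar u\}$ with separation threshold $\beta$, some probability scale $\alpha\ge 1/n$, and distortions $$D_{\ell_2^2}=C\,m,\qquad D_{\ell_2}(r)=C\,\beta^{-1/2}\sqrt{\log r}\;m\,\log m\,\max(1,\log\log m).$$ In particular, the distortions do not depend on $n$. Algorithms are programs for a randomized real-arithmetic random access machine: memory consists of arrays of natural numbers (with addition, truncated subtraction and comparison) and arrays of real numbers (with the four arithmetic operations, square root, exponential and comparison); only natural-number constants occur and there is no rounding of reals to integers; the program may draw independent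 samples, uniform on $[0,1]$ or standard Gaussian. Each operation is one step. One fixed program serves all $n,d,m,\beta$. -/

import Mathlib

/-! ## A randomized real-arithmetic random access machine

Programs are structured `while` programs over a memory that consists of arrays of natural numbers
(used as indices, counters and flags) and two-dimensional arrays of real numbers. Natural numbers
support only addition, truncated subtraction and comparison; real numbers support arithmetic,
square root, exponential and comparison. The only constants are natural numbers, and there is no
rounding from reals to naturals. A program may draw independent uniform samples from `[0,1]` and
independent standard Gaussian samples. Every operation costs one step. -/

namespace RealRAM

/-- Natural-number expressions. `cell a i` is the entry `i` of the natural array number `a`. -/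
inductive NExpr : Type
  | lit (k : ℕ)
  | cell (a : ℕ) (i : NExpr)
  | add (x y : NExpr)
  | sub (x y : NExpr)

/-- Real expressions. `cell a i j` is the entry `(i, j)` of the real array number `a`. -/
inductive RExpr : Type
  | ofNat (x : NExpr)
  | cell (a : ℕ) (i j : NExpr)
  | add (x y : RExpr)
  | sub (x y : RExpr)
  | mul (x y : RExpr)
  | div (x y : RExpr)
  | sqrt (x : RExpr)
  | exp (x : RExpr)

/-- Tests. -/
inductive Test : Type
  | nle (x y : NExpr)
  | rle (x y : RExpr)
  | not (b : Test)
  | and (b c : Test)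

/-- Programs. -/
inductive Prog : Type
  | skip
  /-- natural array `a`, entry `i`, receives the value of `x` -/
  | setN (a : ℕ) (i : NExpr) (x : NExpr)
  /-- real array `a`, entry `(i, j)`, receives the value of `x` -/
  | setR (a : ℕ) (i j : NExpr) (x : RExpr)
  /-- real array `a`, entry `(i, j)`, receives a fresh uniform sample from `[0,1]` -/
  | uniform (a : ℕ) (i j : NExpr)
  /-- real array `a`, entry `(i, j)`, receives a fresh standard Gaussian sample -/
  | gaussian (a : ℕ) (i j : NExpr)
  | seq (p q : Prog)
  | ite (b : Test) (p q : Prog)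
  | while (b : Test) (p : Prog)

/-- The contents of the memory, together with the numbers of uniform and of Gaussian samples that
have been drawn so far. -/
structure State where
  nat : ℕ → ℕ → ℕ
  real : ℕ → ℕ → ℕ → ℝ
  usedU : ℕ
  usedG : ℕ

/-- A source of randomness: an infinite sequence of numbers in `[0,1]` and an infinite sequence of
real numbers. -/
abbrev Tape : Type := (ℕ → unitInterval) × (ℕ → ℝ)

/-- All entries of the tape are independent; those of the first sequence are uniform on `[0,1]`,
those of the second one are standard Gaussian. -/
noncomputable def tapeLaw : MeasureTheory.Measure Tape :=
  (MeasureTheory.Measure.infinitePi fun _ : ℕ =>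
      (MeasureTheory.volume : MeasureTheory.Measure unitInterval)).prod
    (MeasureTheory.Measure.infinitePi fun _ : ℕ => ProbabilityTheory.gaussianReal 0 1)

/-- The value of a natural-number expression. -/
def NExpr.eval (s : State) : NExpr → ℕ
  | lit k => k
  | cell a i => s.nat a (i.eval s)
  | add x y => x.eval s + y.eval s
  | sub x y => x.eval s - y.eval s

/-- The number of steps needed to evaluate a natural-number expression. -/
def NExpr.cost : NExpr → ℕ
  | lit _ => 1
  | cell _ i => i.cost + 1
  | add x y => x.cost + y.cost + 1
  | sub x y => x.cost + y.cost + 1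

/-- The value of a real expression. All operations are total: division by zero and the square root
of a negative number return zero. -/
noncomputable def RExpr.eval (s : State) : RExpr → ℝ
  | ofNat x => (x.eval s : ℝ)
  | cell a i j => s.real a (i.eval s) (j.eval s)
  | add x y => x.eval s + y.eval s
  | sub x y => x.eval s - y.eval s
  | mul x y => x.eval s * y.eval s
  | div x y => x.eval s / y.eval s
  | sqrt x => Real.sqrt (x.eval s)
  | exp x => Real.exp (x.eval s)

/-- The number of steps needed to evaluate a real expression. -/
def RExpr.cost : RExpr → ℕ
  | ofNat x => x.cost + 1
  | cell _ i j => i.cost + j.cost + 1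
  | add x y => x.cost + y.cost + 1
  | sub x y => x.cost + y.cost + 1
  | mul x y => x.cost + y.cost + 1
  | div x y => x.cost + y.cost + 1
  | sqrt x => x.cost + 1
  | exp x => x.cost + 1

/-- The outcome of a test. -/
def Test.Holds (s : State) : Test → Prop
  | nle x y => x.eval s ≤ y.eval s
  | rle x y => x.eval s ≤ y.eval s
  | not b => ¬ b.Holds s
  | and b c => b.Holds s ∧ c.Holds s

/-- The number of steps needed to perform a test. -/
def Test.cost : Test → ℕ
  | nle x y => x.cost + y.cost + 1
  | rle x y => x.cost + y.cost + 1
  | not b => b.cost + 1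
  | and b c => b.cost + c.cost + 1

/-- Write `v` into entry `i` of the natural array `a`. -/
def State.writeN (s : State) (a i v : ℕ) : State :=
  { s with nat := fun a' i' => if a' = a ∧ i' = i then v else s.nat a' i' }

/-- Write `v` into entry `(i, j)` of the real array `a`. -/
noncomputable def State.writeR (s : State) (a i j : ℕ) (v : ℝ) : State :=
  { s with real := fun a' i' j' => if a' = a ∧ i' = i ∧ j' = j then v else s.real a' i' j' }

/-- `Exec ω p s t s'`: on the random tape `ω`, the program `p` started in state `s` halts in state
`s'` after exactly `t` steps. -/
inductive Exec (ω : Tape) : Prog → State → ℕ → State → Prop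
  | skip (s : State) : Exec ω .skip s 1 s
  | setN (s : State) (a : ℕ) (i x : NExpr) :
      Exec ω (.setN a i x) s (i.cost + x.cost + 1) (s.writeN a (i.eval s) (x.eval s))
  | setR (s : State) (a : ℕ) (i j : NExpr) (x : RExpr) :
      Exec ω (.setR a i j x) s (i.cost + j.cost + x.cost + 1)
        (s.writeR a (i.eval s) (j.eval s) (x.eval s))
  | uniform (s : State) (a : ℕ) (i j : NExpr) :
      Exec ω (.uniform a i j) s (i.cost + j.cost + 1)
        { s.writeR a (i.eval s) (j.eval s) (ω.1 s.usedU : ℝ) with usedU := s.usedU + 1 }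
  | gaussian (s : State) (a : ℕ) (i j : NExpr) :
      Exec ω (.gaussian a i j) s (i.cost + j.cost + 1)
        { s.writeR a (i.eval s) (j.eval s) (ω.2 s.usedG) with usedG := s.usedG + 1 }
  | seq {p q : Prog} {s s₁ s₂ : State} {t₁ t₂ : ℕ} :
      Exec ω p s t₁ s₁ → Exec ω q s₁ t₂ s₂ → Exec ω (.seq p q) s (t₁ + t₂) s₂
  | iteTrue {b : Test} {p q : Prog} {s s' : State} {t : ℕ} :
      b.Holds s → Exec ω p s t s' → Exec ω (.ite b p q) s (b.cost + t) s'
  | iteFalse {b : Test} {p q : Prog} {s s' : State} {t : ℕ} :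
      ¬ b.Holds s → Exec ω q s t s' → Exec ω (.ite b p q) s (b.cost + t) s'
  | whileFalse {b : Test} {p : Prog} {s : State} :
      ¬ b.Holds s → Exec ω (.while b p) s b.cost s
  | whileTrue {b : Test} {p : Prog} {s s₁ s₂ : State} {t₁ t₂ : ℕ} :
      b.Holds s → Exec ω p s t₁ s₁ → Exec ω (.while b p) s₁ t₂ s₂ →
        Exec ω (.while b p) s (b.cost + t₁ + t₂) s₂

/-- The initial state on input `(x, m, β)`, where `x` consists of `n` vectors in `ℝᵈ`: the entries
`0, 1` of natural array `0` hold `n, d`, the real array `0` holds the coordinates of the vectors,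
the entries `(0,0), (0,1)` of the real array `1` hold `m, β`, and everything else is zero. -/
noncomputable def input {n d : ℕ} (x : Fin n → EuclideanSpace ℝ (Fin d)) (m β : ℝ) : State where
  nat a i := if a = 0 ∧ i = 0 then n else if a = 0 ∧ i = 1 then d else 0
  real a i j :=
    if a = 0 then (if h : i < n ∧ j < d then x ⟨i, h.1⟩ ⟨j, h.2⟩ else 0)
    else if a = 1 ∧ i = 0 ∧ j = 0 then m
    else if a = 1 ∧ i = 0 ∧ j = 1 then β
    else 0
  usedU := 0
  usedG := 0

/-- The set of vertices described by a final state: `u` belongs to it if and only if entry `u` of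
the natural array `1` equals `1`. -/
def output (n : ℕ) (s : State) : Finset (Fin n) :=
  Finset.univ.filter fun u => s.nat 1 u = 1

end RealRAM

/-! ## Hypergraph orthogonal separators -/

/-- The `ℓ₂²`-triangle inequalities
`‖ū - v̄‖² + ‖v̄ - w̄‖² ≥ ‖ū - w̄‖²` and `0 ≤ ⟨ū, v̄⟩ ≤ ‖ū‖²`. -/
structure SatisfiesL22Triangle {V E : Type*} [NormedAddCommGroup E] [InnerProductSpace ℝ E]
    (x : V → E) : Prop where
  triangle : ∀ u v w : V, ‖x u - x w‖ ^ 2 ≤ ‖x u - x v‖ ^ 2 + ‖x v - x w‖ ^ 2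
  inner_nonneg : ∀ u v : V, 0 ≤ inner ℝ (x u) (x v)
  inner_le : ∀ u v : V, inner ℝ (x u) (x v) ≤ ‖x u‖ ^ 2

/-- The hyperedge `e` is cut by the set `S`: some vertices of `e` lie in `S` and some do not. -/
def IsCutBy {V : Type*} (e S : Finset V) : Prop :=
  (∃ u ∈ e, u ∈ S) ∧ ∃ v ∈ e, v ∉ S

/-- The maximum of `‖ū - v̄‖` over `u, v ∈ e`. -/
noncomputable def edgeDiam {V E : Type*} [NormedAddCommGroup E] (x : V → E) (e : Finset V)
    (he : e.Nonempty) : ℝ :=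
  (e ×ˢ e).sup' (he.product he) fun p => ‖x p.1 - x p.2‖

/-- The minimum of `‖w̄‖` over `w ∈ e`. -/
noncomputable def edgeMinNorm {V E : Type*} [NormedAddCommGroup E] (x : V → E) (e : Finset V)
    (he : e.Nonempty) : ℝ :=
  e.inf' he fun w => ‖x w‖

/-- The random set `S`, defined on the probability space `(Ω, μ)`, is an `ℓ₂`–`ℓ₂²` hypergraph
`m`-orthogonal separator for the vectors `x`, with `ℓ₂`-distortion `D₂`, `ℓ₂²`-distortion `D₂₂`,
probability scale `α` and separation threshold `β`. -/
structure IsL2L22OrthogonalSeparator {Ω V E : Type*} [MeasurableSpace Ω] [NormedAddCommGroup E]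
    (μ : MeasureTheory.Measure Ω) (x : V → E) (S : Ω → Finset V) (m : ℝ)
    (D₂ : ℕ → ℝ) (D₂₂ α β : ℝ) : Prop where
  measurableSet_mem : ∀ u, MeasurableSet {ω | u ∈ S ω}
  scale_pos : 0 < α
  threshold_pos : 0 < β
  threshold_lt_one : β < 1
  prob_mem : ∀ u, μ.real {ω | u ∈ S ω} = α * ‖x u‖ ^ 2
  prob_mem_mem : ∀ u v, β * min (‖x u‖ ^ 2) (‖x v‖ ^ 2) ≤ ‖x u - x v‖ ^ 2 →
    μ.real {ω | u ∈ S ω ∧ v ∈ S ω} ≤ α * (min (‖x u‖ ^ 2) (‖x v‖ ^ 2) / m)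
  prob_cut : ∀ (e : Finset V) (he : e.Nonempty),
    μ.real {ω | IsCutBy e (S ω)} ≤
      α * D₂₂ * edgeDiam x e he ^ 2 + α * D₂ e.card * edgeMinNorm x e he * edgeDiam x e he

/-! The random set is built from independent one-dimensional partitions. In each of `R = K *
⌈Real.logb 2 m⌉₊` rounds the normalized vectors are projected onto a Gaussian direction, and the
line is cut as by a Poisson process of rate `1 / √β`. The process is discretized: the interval
between consecutive projections, of length `δ`, stays uncut with probability `exp (-(δ / √β))`. The
common refinement of the rounds is the partition into clusters. Clusters are then selected at
random, each with marginal probability `scale n m = max (1 / n) (1 / (2m))`, and `u` is kept if its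
cluster is selected and one common uniform threshold is at most `‖x u‖ ^ 2`. When `n ≤ 2m` the
selection picks one label out of `n`, so two clusters are never both selected; otherwise the
selections are independent.

The membership probability follows from the independence of threshold, cuts and labels
(`measureReal_mem`).

For a separated pair the angle is large: the normalized vectors are at distance at least `√β / 2`
(`norm_normalized_sub_ge`). Given the projections, two vertices share a cluster with probability
equal to a product of exponentials (`measureReal_cells_eq`), so each round contributes at most the
constant `gaussDecay < 1` in the mean. A suitable `K` makes `gaussDecay ^ R ≤ 1 / (2m)`. Vertices in
different clusters are jointly selected with probability at most `scale n m / (2m)`. The two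
contributions add up to the required `1 / m`.

For a hyperedge with diameter `D` and least length `a`, a cut has one of two causes
(`measureReal_cut_le`). Either the threshold falls between the extreme squared lengths, whose
difference is at most `D ^ 2` by `sq_norm_le_add`, or some round separates the edge. Separation in a
round costs at most the spread of the projections over `√β`; the expected spread is a maximum of
Gaussians of standard deviation at most `2D / a`, hence at most `6 D √(log |e|) / a`
(`integral_max_gaussian_le`, `norm_normalized_sub_le`). The threshold contributes a factor close to
`a ^ 2`, and `1 ≤ 2 m * scale n m` converts the bound into multiples of the scale.

On the machine side, a small Hoare-style calculus (`Halts`) with step budgets and frame conditions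
proves that on every tape the program halts and computes exactly this set. -/

namespace RealRAM

/-! ### Frames and loops -/

/-- The natural arrays that occur as targets of assignments. -/
def Prog.writesN : Prog → List ℕ
  | .setN a _ _ => [a]
  | .seq p q => p.writesN ++ q.writesN
  | .ite _ p q => p.writesN ++ q.writesN
  | .while _ p => p.writesN
  | _ => []

/-- The real arrays that occur as targets of assignments. -/
def Prog.writesR : Prog → List ℕ
  | .setR a _ _ _ => [a]
  | .uniform a _ _ => [a]
  | .gaussian a _ _ => [a]
  | .seq p q => p.writesR ++ q.writesR
  | .ite _ p q => p.writesR ++ q.writesR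
  | .while _ p => p.writesR
  | _ => []

/-- The two states agree outside the listed natural and real arrays. -/
structure Frame (LN LR : List ℕ) (s s' : State) : Prop where
  nat : ∀ a, a ∉ LN → s'.nat a = s.nat a
  real : ∀ a, a ∉ LR → s'.real a = s.real a

theorem Frame.refl (LN LR : List ℕ) (s : State) : Frame LN LR s s :=
  ⟨fun _ _ => rfl, fun _ _ => rfl⟩

theorem Frame.trans {LN LR : List ℕ} {s s' s'' : State} (h : Frame LN LR s s')
    (h' : Frame LN LR s' s'') : Frame LN LR s s'' :=
  ⟨fun a ha => (h'.nat a ha).trans (h.nat a ha), fun a ha => (h'.real a ha).trans (h.real a ha)⟩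

theorem Frame.mono {LN LR LN' LR' : List ℕ} {s s' : State} (h : Frame LN LR s s')
    (hN : LN ⊆ LN') (hR : LR ⊆ LR') : Frame LN' LR' s s' :=
  ⟨fun a ha => h.nat a fun h' => ha (hN h'), fun a ha => h.real a fun h' => ha (hR h')⟩

theorem State.writeN_nat_of_ne {s : State} {a i v b : ℕ} (h : b ≠ a) :
    (s.writeN a i v).nat b = s.nat b := by
  funext j
  simp [State.writeN, h]

theorem State.writeR_real_of_ne {s : State} {a i j b : ℕ} {v : ℝ} (h : b ≠ a) :
    (s.writeR a i j v).real b = s.real b := by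
  funext i' j'
  simp [State.writeR, h]

@[simp] theorem State.writeN_nat_self (s : State) (a i v : ℕ) : (s.writeN a i v).nat a i = v := by
  simp [State.writeN]

@[simp] theorem State.writeR_real_self (s : State) (a i j : ℕ) (v : ℝ) :
    (s.writeR a i j v).real a i j = v := by
  simp [State.writeR]

@[simp] theorem State.writeN_real (s : State) (a i v : ℕ) : (s.writeN a i v).real = s.real := rfl

@[simp] theorem State.writeR_nat (s : State) (a i j : ℕ) (v : ℝ) :
    (s.writeR a i j v).nat = s.nat := rfl

/-- A program changes only the arrays that it assigns to. -/
theorem Exec.frame {ω : Tape} {p : Prog} {s s' : State} {t : ℕ} (h : Exec ω p s t s') :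
    Frame p.writesN p.writesR s s' := by
  induction h with
  | skip | whileFalse => exact Frame.refl _ _ _
  | setN s a i x =>
    exact ⟨fun b hb => State.writeN_nat_of_ne (by simpa [Prog.writesN] using hb), fun _ _ => rfl⟩
  | setR s a i j x =>
    exact ⟨fun _ _ => rfl, fun b hb => State.writeR_real_of_ne (by simpa [Prog.writesR] using hb)⟩
  | uniform s a i j =>
    exact ⟨fun _ _ => rfl, fun b hb =>
      State.writeR_real_of_ne (s := s) (by simpa [Prog.writesR] using hb)⟩
  | gaussian s a i j =>
    exact ⟨fun _ _ => rfl, fun b hb =>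
      State.writeR_real_of_ne (s := s) (by simpa [Prog.writesR] using hb)⟩
  | seq _ _ h₁ h₂ =>
    exact (h₁.mono (List.subset_append_left _ _) (List.subset_append_left _ _)).trans
      (h₂.mono (List.subset_append_right _ _) (List.subset_append_right _ _))
  | iteTrue _ _ h =>
    exact h.mono (List.subset_append_left _ _) (List.subset_append_left _ _)
  | iteFalse _ _ h =>
    exact h.mono (List.subset_append_right _ _) (List.subset_append_right _ _)
  | whileTrue _ _ _ h₁ h₂ => exact h₁.trans h₂

/-- `p` halts from `s` within `T` steps, in a state that satisfies `Q`. -/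
def Halts (ω : Tape) (p : Prog) (s : State) (T : ℕ) (Q : State → Prop) : Prop :=
  ∃ t s', Exec ω p s t s' ∧ t ≤ T ∧ Q s'

theorem Halts.mono {ω : Tape} {p : Prog} {s : State} {T T' : ℕ} {Q Q' : State → Prop}
    (h : Halts ω p s T Q) (hT : T ≤ T') (hQ : ∀ s', Q s' → Q' s') : Halts ω p s T' Q' := by
  obtain ⟨t, s', he, ht, hq⟩ := h
  exact ⟨t, s', he, ht.trans hT, hQ s' hq⟩

theorem Halts.with_frame {ω : Tape} {p : Prog} {s : State} {T : ℕ} {Q : State → Prop}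
    (h : Halts ω p s T Q) :
    Halts ω p s T fun s' => Frame p.writesN p.writesR s s' ∧ Q s' := by
  obtain ⟨t, s', he, ht, hq⟩ := h
  exact ⟨t, s', he, ht, he.frame, hq⟩

theorem Halts.seq {ω : Tape} {p q : Prog} {s : State} {T₁ T₂ : ℕ} {Q₁ Q₂ : State → Prop}
    (h : Halts ω p s T₁ Q₁) (h' : ∀ s', Frame p.writesN p.writesR s s' → Q₁ s' →
      Halts ω q s' T₂ Q₂) : Halts ω (.seq p q) s (T₁ + T₂) Q₂ := by
  obtain ⟨t, s', he, ht, hq⟩ := h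
  obtain ⟨t', s'', he', ht', hq'⟩ := h' s' he.frame hq
  exact ⟨_, s'', he.seq he', add_le_add ht ht', hq'⟩

theorem Halts.setN {ω : Tape} {s : State} {a : ℕ} {i x : NExpr} {Q : State → Prop}
    (h : Q (s.writeN a (i.eval s) (x.eval s))) :
    Halts ω (.setN a i x) s (i.cost + x.cost + 1) Q :=
  ⟨_, _, .setN s a i x, le_rfl, h⟩

theorem Halts.setR {ω : Tape} {s : State} {a : ℕ} {i j : NExpr} {x : RExpr} {Q : State → Prop}
    (h : Q (s.writeR a (i.eval s) (j.eval s) (x.eval s))) :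
    Halts ω (.setR a i j x) s (i.cost + j.cost + x.cost + 1) Q :=
  ⟨_, _, .setR s a i j x, le_rfl, h⟩

theorem Halts.ite {ω : Tape} {b : Test} {p q : Prog} {s : State} {T₁ T₂ : ℕ} {Q : State → Prop}
    (h₁ : b.Holds s → Halts ω p s T₁ Q) (h₂ : ¬ b.Holds s → Halts ω q s T₂ Q) :
    Halts ω (.ite b p q) s (b.cost + (T₁ + T₂)) Q := by
  by_cases hb : b.Holds s
  · obtain ⟨t, s', he, ht, hq⟩ := h₁ hb
    exact ⟨_, s', .iteTrue hb he, by omega, hq⟩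
  · obtain ⟨t, s', he, ht, hq⟩ := h₂ hb
    exact ⟨_, s', .iteFalse hb he, by omega, hq⟩

/-- A conditional assignment. -/
theorem Halts.ite_skip {ω : Tape} {b : Test} {p : Prog} {s : State} {T : ℕ} {Q : State → Prop}
    (h₁ : b.Holds s → Halts ω p s T Q) (h₂ : ¬ b.Holds s → Q s) :
    Halts ω (.ite b p .skip) s (b.cost + (T + 1)) Q :=
  Halts.ite h₁ fun hb => ⟨_, s, .skip s, le_rfl, h₂ hb⟩

/-- The index of the invariant counts iterations. Since a successful test forces the index below
`N`, one hypothesis gives both termination and the time bound. -/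
theorem Halts.while {ω : Tape} {b : Test} {p : Prog} {N T : ℕ} {I : ℕ → State → Prop}
    (hstep : ∀ i s, I i s → b.Holds s → i < N ∧ Halts ω p s T (I (i + 1)))
    {i : ℕ} {s : State} (hs : I i s) (hi : i ≤ N) :
    Halts ω (.while b p) s (b.cost + (N - i) * (b.cost + T))
      fun s' => ∃ i', i' ≤ N ∧ I i' s' ∧ ¬ b.Holds s' := by
  induction hk : N - i generalizing i s with
  | zero =>
    have hb : ¬ b.Holds s := fun hb => by have := (hstep i s hs hb).1; omega
    exact ⟨_, s, .whileFalse hb, by simp, i, hi, hs, hb⟩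
  | succ k ih =>
    by_cases hb : b.Holds s
    · obtain ⟨hlt, t, s', he, ht, hq⟩ := hstep i s hs hb
      obtain ⟨t', s'', he', ht', hq'⟩ := ih hq hlt (by omega)
      refine ⟨_, s'', .whileTrue hb he he', ?_, hq'⟩
      rw [Nat.succ_mul]
      omega
    · exact ⟨_, s, .whileFalse hb, by simp, i, hi, hs, hb⟩

/-- `for c := 0, …, (entry j of array b) - 1 do p`, with counter in entry `0` of array `c`. -/
def Prog.for (c b j : ℕ) (p : Prog) : Prog :=
  .seq (.setN c (.lit 0) (.lit 0))
    (.while (.not (.nle (.cell b (.lit j)) (.cell c (.lit 0))))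
      (.seq p (.setN c (.lit 0) (.add (.cell c (.lit 0)) (.lit 1)))))

/-- The condition `hI` says that the invariant ignores the counter, so that only the body has to be
checked. The budget charges each iteration 6 steps for the test and 6 for the increment; the
remaining 9 are the initialization and the last test. -/
theorem Halts.for {ω : Tape} {c b j : ℕ} {p : Prog} {N T : ℕ} {I : ℕ → State → Prop} {s : State}
    (hcb : c ≠ b) (hc : c ∉ p.writesN) (hb : b ∉ p.writesN) (hN : s.nat b j = N)
    (hI : ∀ i s v, I i s → I i (s.writeN c 0 v))
    (h0 : I 0 s)
    (hstep : ∀ i s', i < N → s'.nat c 0 = i → Frame (c :: p.writesN) p.writesR s s' →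
      I i s' → Halts ω p s' T (I (i + 1))) :
    Halts ω (Prog.for c b j p) s (N * (T + 12) + 9) (I N) := by
  have key := Halts.while (ω := ω) (N := N) (T := T + 6)
    (b := .not (.nle (.cell b (.lit j)) (.cell c (.lit 0))))
    (p := .seq p (.setN c (.lit 0) (.add (.cell c (.lit 0)) (.lit 1))))
    (I := fun i s' => s'.nat c 0 = i ∧ Frame (c :: p.writesN) p.writesR s s' ∧ I i s')
    (i := 0) (s := s.writeN c 0 0) ?_ ?_ (Nat.zero_le _)
  · refine (Halts.seq (Halts.setN (Q := fun s' => s' = s.writeN c 0 0) ?_)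
      (T₂ := N * (T + 12) + 6) (Q₂ := I N) ?_).mono ?_ fun _ h => h
    · simp [NExpr.eval]
    · rintro _ - rfl
      refine key.mono ?_ ?_
      · simp only [Test.cost, NExpr.cost, Nat.sub_zero]
        ring_nf
        omega
      · rintro s' ⟨i, hi, ⟨h1, h2, h3⟩, h4⟩
        have h5 : s'.nat b j = N := by
          rw [h2.nat b (by simp [hcb.symm, hb]), hN]
        simp only [Test.Holds, NExpr.eval, h5, h1, not_not] at h4
        rwa [le_antisymm h4 hi]
    · simp only [NExpr.cost]
      ring_nf
      omega
  · rintro i s' ⟨h1, h2, h3⟩ h4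
    have h5 : s'.nat b j = N := by
      rw [h2.nat b (by simp [hcb.symm, hb]), hN]
    simp only [Test.Holds, NExpr.eval, h5, h1, not_le] at h4
    refine ⟨h4, ?_⟩
    refine (Halts.seq (hstep i s' h4 h1 h2 h3) (T₂ := 6) ?_)
    intro s'' hf hq
    have h6 : s''.nat c 0 = i := by rw [hf.nat c hc, h1]
    refine (Halts.setN ?_ : Halts ω _ s'' _ _)
    simp only [NExpr.eval, h6]
    refine ⟨by simp, (h2.trans (hf.mono (by simp) (by simp))).trans
      ⟨fun a ha => State.writeN_nat_of_ne (by rintro rfl; simp at ha), fun _ _ => rfl⟩,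
      hI _ _ _ hq⟩
  · exact ⟨by simp, ⟨fun a ha => State.writeN_nat_of_ne (by rintro rfl; simp at ha),
      fun _ _ => rfl⟩, hI _ _ _ h0⟩

end RealRAM

namespace RealRAM

open Finset

/-! ### Expressions and tests -/

/-- Disjunction of tests. -/
def Test.or (b c : Test) : Test := .not (.and (.not b) (.not c))

theorem Test.holds_or {s : State} {b c : Test} : (b.or c).Holds s ↔ b.Holds s ∨ c.Holds s := by
  simp only [Test.or, Test.Holds]
  tauto

/-- The variable stored in entry `0` of natural array `a`. -/
abbrev NExpr.var (a : ℕ) : NExpr := .cell a (.lit 0)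

/-! ### The combinatorial description of the random set -/

/-- The inner products of the vectors with a Gaussian vector, divided by the lengths. -/
noncomputable def proj (d : ℕ) (X : ℕ → ℕ → ℝ) (g : ℕ → ℝ) (u : ℕ) : ℝ :=
  (∑ j ∈ range d, g j * X u j) / √(∑ j ∈ range d, X u j * X u j)

/-- The points `q w` in increasing order, ties being broken by the index. -/
def LexLt (q : ℕ → ℝ) (w v : ℕ) : Prop := ¬ q v ≤ q w ∨ q w ≤ q v ∧ w < v

/-- The interval between `q w` and the next point is cut. -/
def Flagged (n : ℕ) (β : ℝ) (q y : ℕ → ℝ) (w : ℕ) : Prop :=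
  ∀ v < n, LexLt q w v → Real.exp ((q w - q v) / √β) ≤ y w

open Classical in
/-- The number of cuts below `q u`. -/
noncomputable def cell (n : ℕ) (β : ℝ) (q y : ℕ → ℝ) (u : ℕ) : ℕ :=
  #{w ∈ range n | LexLt q w u ∧ Flagged n β q y w}

/-- In each of `R` rounds, `u` and `v` lie in the same cell. -/
def Same (n R : ℕ) (β : ℝ) (q y : ℕ → ℕ → ℝ) (u v : ℕ) : Prop :=
  ∀ k < R, cell n β (q k) (y k) u = cell n β (q k) (y k) v

/-- `c` is the last vertex in the cluster of `u`. -/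
def IsRep (n R : ℕ) (β : ℝ) (q y : ℕ → ℕ → ℝ) (u c : ℕ) : Prop :=
  c < n ∧ Same n R β q y u c ∧ ∀ c' < n, c < c' → ¬ Same n R β q y u c'

/-- The cluster represented by `c` is selected. -/
def Selected (n : ℕ) (m : ℝ) (lab : ℕ → ℝ) (c : ℕ) : Prop :=
  (n : ℝ) ≤ m + m ∧ ((c : ℝ) < n * lab 0 ∧ n * lab 0 ≤ c + 1) ∨
    ¬ (n : ℝ) ≤ m + m ∧ (m + m) * lab c ≤ 1

/-! ### The program and its phases -/

/-- Computation of the squared lengths. -/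
def normsProg : Prog :=
  .for 4 0 0 (.seq (.setR 6 (.lit 0) (.var 4) (.ofNat (.lit 0)))
    (.for 6 0 1 (.setR 6 (.lit 0) (.var 4) (.add (.cell 6 (.lit 0) (.var 4))
      (.mul (.cell 0 (.var 4) (.var 6)) (.cell 0 (.var 4) (.var 6)))))))

theorem halts_normsProg {ω : Tape} {s : State} {n d : ℕ} (hn : s.nat 0 0 = n)
    (hd : s.nat 0 1 = d) :
    Halts ω normsProg s (n * ((d * 100 + 100) + 12) + 9) fun s' =>
      ∀ u < n, s'.real 6 0 u = ∑ j ∈ range d, s.real 0 u j * s.real 0 u j := by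
  refine Halts.for (I := fun i s' => ∀ u < i, s'.real 6 0 u =
    ∑ j ∈ range d, s.real 0 u j * s.real 0 u j) (by simp) (by simp [Prog.writesN, Prog.for])
    (by simp [Prog.writesN, Prog.for]) hn (fun _ _ _ h => h) (by simp) ?_
  intro i s₁ hi hc hf hI
  have hX : s₁.real 0 = s.real 0 := hf.real 0 (by simp [Prog.writesR, Prog.for])
  have hd₁ : s₁.nat 0 1 = d := by rw [hf.nat 0 (by simp [Prog.writesN, Prog.for]), hd]
  refine (Halts.seq (Halts.setR (Q := fun s' => s'.nat = s₁.nat ∧ s'.real 0 = s.real 0 ∧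
    s'.real 6 0 i = 0 ∧ ∀ u < i, s'.real 6 0 u =
    ∑ j ∈ range d, s.real 0 u j * s.real 0 u j) ?_) (T₂ := d * (88 + 12) + 9) ?_).mono ?_
    fun _ h => h
  · simp only [NExpr.eval, RExpr.eval, hc]
    refine ⟨rfl, by rw [State.writeR_real_of_ne (by simp), hX], by simp, fun u hu => ?_⟩
    rw [← hI u hu]
    simp [State.writeR, hu.ne]
  · rintro s₂ - ⟨hnat, hX₂, h0, hI₂⟩
    refine (Halts.for (I := fun j s' => s'.real 6 0 i = ∑ j ∈ range j, s.real 0 i j * s.real 0 i j ∧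
      ∀ u < i, s'.real 6 0 u = ∑ j ∈ range d, s.real 0 u j * s.real 0 u j) (by simp)
      (by simp [Prog.writesN]) (by simp [Prog.writesN]) (hnat ▸ hd₁) (fun _ _ _ h => h)
      (by simpa using ⟨h0, hI₂⟩) ?_).mono le_rfl ?_
    · rintro j s₃ hj hc₃ hf₃ ⟨h1, h2⟩
      have hX₃ : s₃.real 0 = s.real 0 := by rw [hf₃.real 0 (by simp [Prog.writesR]), hX₂]
      have hi₃ : s₃.nat 4 0 = i := by rw [hf₃.nat 4 (by simp [Prog.writesN]), hnat, hc]
      refine (Halts.setR ?_).mono (by simp [NExpr.cost, RExpr.cost]) fun _ h => h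
      simp only [NExpr.eval, RExpr.eval, hc₃, hi₃, hX₃, h1]
      refine ⟨by rw [State.writeR_real_self, sum_range_succ], fun u hu => ?_⟩
      rw [← h2 u hu]
      simp [State.writeR, hu.ne]
    · rintro s' ⟨h1, h2⟩ u hu
      rcases Nat.lt_succ_iff_lt_or_eq.1 hu with h | rfl
      exacts [h2 u h, h1]
  · simp only [NExpr.cost, RExpr.cost]
    omega

/-! ### Computing an array entry by entry -/

/-- The states agree on the real array `a`, except possibly at the entry `(i, j)`. -/
def OnlyAt (a i j : ℕ) (s s' : State) : Prop :=
  ∀ i' j', ¬ (i' = i ∧ j' = j) → s'.real a i' j' = s.real a i' j'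

theorem OnlyAt.trans {a i j : ℕ} {s s' s'' : State} (h : OnlyAt a i j s s')
    (h' : OnlyAt a i j s' s'') : OnlyAt a i j s s'' :=
  fun i' j' hij => (h' i' j' hij).trans (h i' j' hij)

theorem onlyAt_writeR (a i j : ℕ) (s : State) (v : ℝ) : OnlyAt a i j s (s.writeR a i j v) := by
  intro i' j' h
  simp [State.writeR, h]

/-- A loop that computes the entry `(k, u)` of an array, for all rounds `k` and vertices `u`. -/
def Prog.forEntries (p : Prog) : Prog := .for 3 2 0 (.for 4 0 0 p)

theorem Halts.forEntries {ω : Tape} {p : Prog} {a R n T : ℕ} {F : ℕ → ℕ → ℝ} {s : State}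
    (hR : s.nat 2 0 = R) (hn : s.nat 0 0 = n) (h0 : 0 ∉ p.writesN) (h2 : 2 ∉ p.writesN)
    (h3 : 3 ∉ p.writesN) (h4 : 4 ∉ p.writesN)
    (h : ∀ k u s', k < R → u < n → s'.nat 3 0 = k → s'.nat 4 0 = u →
      Frame (3 :: 4 :: p.writesN) p.writesR s s' →
      Halts ω p s' T fun s'' => OnlyAt a k u s' s'' ∧ s''.real a k u = F k u) :
    Halts ω p.forEntries s (R * ((n * (T + 12) + 9) + 12) + 9)
      fun s' => ∀ k < R, ∀ u < n, s'.real a k u = F k u := by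
  refine Halts.for (I := fun k s' => ∀ k' < k, ∀ u < n, s'.real a k' u = F k' u) (by simp)
    (by simpa [Prog.writesN, Prog.for] using h3) (by simpa [Prog.writesN, Prog.for] using h2) hR
    (fun _ _ _ h => h) (by simp) ?_
  intro k s₁ hk hc₁ hf₁ hI₁
  have hn₁ : s₁.nat 0 0 = n := by
    rw [hf₁.nat 0 (by simpa [Prog.writesN, Prog.for] using h0), hn]
  refine (Halts.for (I := fun u s' => (∀ k' < k, ∀ u < n, s'.real a k' u = F k' u) ∧
    ∀ u' < u, s'.real a k u' = F k u') (by simp) h4 h0 hn₁ (fun _ _ _ h => h)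
    (by simpa using hI₁) ?_).mono le_rfl ?_
  · rintro u s₂ hu hc₂ hf₂ ⟨hI₂, hI₂'⟩
    refine (h k u s₂ hk hu (by rw [hf₂.nat 3 (by simpa using h3), hc₁]) hc₂
      ((hf₁.mono ?_ ?_).trans (hf₂.mono ?_ ?_))).mono le_rfl ?_
    · simp [Prog.writesN, Prog.for]
    · simp [Prog.writesR, Prog.for]
    · simp
    · simp
    · rintro s' ⟨ho, hv⟩
      refine ⟨fun k' hk' u' hu' => ?_, fun u' hu' => ?_⟩
      · rw [ho k' u' (by omega), hI₂ k' hk' u' hu']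
      · rcases Nat.lt_succ_iff_lt_or_eq.1 hu' with h' | rfl
        · rw [ho k u' (by omega), hI₂' u' h']
        · exact hv
  · rintro s' ⟨h1, h2⟩ k' hk' u hu
    rcases Nat.lt_succ_iff_lt_or_eq.1 hk' with h' | rfl
    exacts [h1 k' h' u hu, h2 u hu]

/-- Initialization of the entry `(k, u)` of the array `a`, followed by a loop. -/
def Prog.accum (a : ℕ) (x : ℕ) (c b j : ℕ) (p : Prog) : Prog :=
  .seq (.setR a (.var 3) (.var 4) (.ofNat (.lit x))) (.for c b j p)

theorem Halts.accum {ω : Tape} {p : Prog} {a x c b j k u N T : ℕ} {A : ℕ → ℝ} {s : State}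
    (hk : s.nat 3 0 = k) (hu : s.nat 4 0 = u) (hN : s.nat b j = N) (hcb : c ≠ b)
    (hc : c ∉ p.writesN) (hb : b ∉ p.writesN) (hA : A 0 = x)
    (h : ∀ i s', i < N → s'.nat c 0 = i → Frame (c :: p.writesN) (a :: p.writesR) s s' →
      s'.real a k u = A i →
      Halts ω p s' T fun s'' => OnlyAt a k u s' s'' ∧ s''.real a k u = A (i + 1)) :
    Halts ω (Prog.accum a x c b j p) s (N * (T + 12) + 16) fun s' =>
      OnlyAt a k u s s' ∧ s'.real a k u = A N := by
  refine (Halts.seq (Halts.setR (Q := fun s' => s' = s.writeR a k u x) ?_)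
    (T₂ := N * (T + 12) + 9) ?_).mono ?_ fun _ h => h
  · simp [NExpr.eval, RExpr.eval, hk, hu]
  · rintro _ - rfl
    refine Halts.for (I := fun i s' => OnlyAt a k u s s' ∧ s'.real a k u = A i) hcb hc hb hN
      (fun _ _ _ h => h) ⟨onlyAt_writeR _ _ _ _ _, by simp [hA]⟩ ?_
    rintro i s₁ hi hc₁ hf ⟨h1, h2⟩
    refine (h i s₁ hi hc₁ ⟨fun b hb => hf.nat b hb, fun b hb => ?_⟩ h2).mono le_rfl
      fun s' hs => ⟨h1.trans hs.1, hs.2⟩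
    simp only [List.mem_cons, not_or] at hb
    rw [hf.real b hb.2, State.writeR_real_of_ne hb.1]
  · simp only [NExpr.cost, RExpr.cost]
    omega

/-- Computation of the projections. -/
def projProg : Prog :=
  .forEntries (.seq (.accum 7 0 6 0 1 (.setR 7 (.var 3) (.var 4) (.add (.cell 7 (.var 3) (.var 4))
      (.mul (.cell 4 (.var 3) (.var 6)) (.cell 0 (.var 4) (.var 6))))))
    (.setR 7 (.var 3) (.var 4) (.div (.cell 7 (.var 3) (.var 4))
      (.sqrt (.cell 6 (.lit 0) (.var 4))))))

theorem halts_projProg {ω : Tape} {s : State} {n d R : ℕ} {X G : ℕ → ℕ → ℝ} (hn : s.nat 0 0 = n)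
    (hd : s.nat 0 1 = d) (hR : s.nat 2 0 = R) (hX : s.real 0 = X)
    (hnorm : ∀ u < n, s.real 6 0 u = ∑ j ∈ range d, X u j * X u j)
    (hG : ∀ k < R, ∀ j < d, s.real 4 k j = G k j) :
    Halts ω projProg s (R * ((n * ((d * 100 + 100) + 12) + 9) + 12) + 9) fun s' =>
      ∀ k < R, ∀ u < n, s'.real 7 k u = proj d X (G k) u := by
  refine Halts.forEntries hR hn (by simp [Prog.writesN, Prog.for, Prog.accum])
    (by simp [Prog.writesN, Prog.for, Prog.accum]) (by simp [Prog.writesN, Prog.for, Prog.accum])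
    (by simp [Prog.writesN, Prog.for, Prog.accum]) ?_
  intro k u s₁ hk hu hck hcu hf
  simp only [Prog.writesN, Prog.writesR, Prog.for, Prog.accum] at hf
  have hd₁ : s₁.nat 0 1 = d := by rw [hf.nat 0 (by simp), hd]
  have hX₁ : s₁.real 0 = X := by rw [hf.real 0 (by simp), hX]
  have h4₁ : s₁.real 4 = s.real 4 := hf.real 4 (by simp)
  have h6₁ : s₁.real 6 = s.real 6 := hf.real 6 (by simp)
  refine (Halts.seq (Halts.accum (T := 88) (A := fun i => ∑ j ∈ range i, G k j * X u j) hck hcu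
    hd₁ (by simp) (by simp [Prog.writesN]) (by simp [Prog.writesN]) (by simp) ?_)
    (T₂ := 50) ?_).mono ?_ fun _ h => h
  · intro j s₂ hj hc₂ hf₂ hv
    simp only [Prog.writesN, Prog.writesR] at hf₂
    have hk₂ : s₂.nat 3 0 = k := by rw [hf₂.nat 3 (by simp), hck]
    have hu₂ : s₂.nat 4 0 = u := by rw [hf₂.nat 4 (by simp), hcu]
    have h0₂ : s₂.real 0 = X := by rw [hf₂.real 0 (by simp), hX₁]
    have h4₂ : s₂.real 4 = s.real 4 := by rw [hf₂.real 4 (by simp), h4₁]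
    refine (Halts.setR ?_).mono (by simp [NExpr.cost, RExpr.cost]) fun _ h => h
    simp only [NExpr.eval, RExpr.eval, hc₂, hk₂, hu₂, h0₂, h4₂, hv, hG k hk j hj]
    exact ⟨onlyAt_writeR _ _ _ _ _, by rw [State.writeR_real_self, sum_range_succ]⟩
  · rintro s₂ hf₂ ⟨ho, hv⟩
    simp only [Prog.writesN, Prog.writesR, Prog.for, Prog.accum] at hf₂
    have hk₂ : s₂.nat 3 0 = k := by rw [hf₂.nat 3 (by simp), hck]
    have hu₂ : s₂.nat 4 0 = u := by rw [hf₂.nat 4 (by simp), hcu]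
    have h6₂ : s₂.real 6 = s.real 6 := by rw [hf₂.real 6 (by simp), h6₁]
    refine (Halts.setR ?_).mono (by simp [NExpr.cost, RExpr.cost]) fun _ h => h
    simp only [NExpr.eval, RExpr.eval, hk₂, hu₂, h6₂, hv, hnorm u hu]
    exact ⟨ho.trans (onlyAt_writeR _ _ _ _ _), by rw [State.writeR_real_self, proj]⟩
  · omega

/-- The test that compares two points in the order `LexLt`. -/
def lexTest (w v : NExpr) : Test :=
  .or (.not (.rle (.cell 7 (.var 3) v) (.cell 7 (.var 3) w)))
    (.and (.rle (.cell 7 (.var 3) w) (.cell 7 (.var 3) v)) (.not (.nle v w)))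

theorem holds_lexTest {s : State} {w v : NExpr} {q : ℕ → ℝ} {k : ℕ} (hk : s.nat 3 0 = k)
    (hv : s.real 7 k (v.eval s) = q (v.eval s)) (hw : s.real 7 k (w.eval s) = q (w.eval s)) :
    (lexTest w v).Holds s ↔ LexLt q (w.eval s) (v.eval s) := by
  rw [lexTest, Test.holds_or]
  simp only [Test.Holds, RExpr.eval, NExpr.eval, hk, hv, hw, LexLt, not_le]

/-- Computation of the flags. -/
def flagProg : Prog :=
  .forEntries (.accum 8 1 5 0 0 (.ite (.and (lexTest (.var 4) (.var 5))
    (.not (.rle (.exp (.div (.sub (.cell 7 (.var 3) (.var 4)) (.cell 7 (.var 3) (.var 5)))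
      (.sqrt (.cell 1 (.lit 0) (.lit 1))))) (.cell 5 (.var 3) (.var 4)))))
    (.setR 8 (.var 3) (.var 4) (.ofNat (.lit 0))) .skip))

open Classical in
theorem halts_flagProg {ω : Tape} {s : State} {n R : ℕ} {β : ℝ} {q y : ℕ → ℕ → ℝ}
    (hn : s.nat 0 0 = n) (hR : s.nat 2 0 = R) (hβ : s.real 1 0 1 = β)
    (hq : ∀ k < R, ∀ u < n, s.real 7 k u = q k u) (hy : ∀ k < R, ∀ u < n, s.real 5 k u = y k u) :
    Halts ω flagProg s (R * ((n * ((n * 100 + 100) + 12) + 9) + 12) + 9) fun s' =>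
      ∀ k < R, ∀ u < n, s'.real 8 k u = if Flagged n β (q k) (y k) u then 1 else 0 := by
  refine Halts.forEntries hR hn (by simp [Prog.writesN, Prog.for, Prog.accum])
    (by simp [Prog.writesN, Prog.for, Prog.accum]) (by simp [Prog.writesN, Prog.for, Prog.accum])
    (by simp [Prog.writesN, Prog.for, Prog.accum]) ?_
  intro k u s₁ hk hu hck hcu hf
  simp only [Prog.writesN, Prog.writesR, Prog.for, Prog.accum] at hf
  -- The running value is the indicator that no vertex scanned so far violates the condition. It
  -- starts at 1 because the condition is vacuous on the empty range.
  refine (Halts.accum (T := 88) (A := fun i => if ∀ v < i, LexLt (q k) u v →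
      Real.exp ((q k u - q k v) / √β) ≤ y k u then 1 else 0) hck hcu
    (by rw [hf.nat 0 (by simp), hn]) (by simp) (by simp [Prog.writesN]) (by simp [Prog.writesN])
    (by simp) ?_).mono (by omega) fun s' h => ⟨h.1, by rw [h.2]; unfold Flagged; congr⟩
  intro v s₂ hv hc₂ hf₂ hval
  simp only [Prog.writesN, Prog.writesR] at hf₂
  have hk₂ : s₂.nat 3 0 = k := by rw [hf₂.nat 3 (by simp), hck]
  have hu₂ : s₂.nat 4 0 = u := by rw [hf₂.nat 4 (by simp), hcu]
  have h1₂ : s₂.real 1 = s.real 1 := by rw [hf₂.real 1 (by simp), hf.real 1 (by simp)]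
  have h5₂ : s₂.real 5 = s.real 5 := by rw [hf₂.real 5 (by simp), hf.real 5 (by simp)]
  have h7₂ : s₂.real 7 = s.real 7 := by rw [hf₂.real 7 (by simp), hf.real 7 (by simp)]
  have hlex : (lexTest (.var 4) (.var 5)).Holds s₂ ↔ LexLt (q k) u v := by
    rw [holds_lexTest (q := q k) hk₂]
    · simp [NExpr.eval, hu₂, hc₂]
    · simp [NExpr.eval, hc₂, h7₂, hq k hk v hv]
    · simp [NExpr.eval, hu₂, h7₂, hq k hk u hu]
  have htest : (Test.and (lexTest (.var 4) (.var 5))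
    (.not (.rle (.exp (.div (.sub (.cell 7 (.var 3) (.var 4)) (.cell 7 (.var 3) (.var 5)))
      (.sqrt (.cell 1 (.lit 0) (.lit 1))))) (.cell 5 (.var 3) (.var 4))))).Holds s₂ ↔
      ¬ (LexLt (q k) u v → Real.exp ((q k u - q k v) / √β) ≤ y k u) := by
    rw [Test.Holds, hlex]
    simp [Test.Holds, RExpr.eval, NExpr.eval, hk₂, hu₂, hc₂, h1₂, h5₂, h7₂, hq k hk u hu,
      hq k hk v hv, hy k hk u hu, hβ]
  refine (Halts.ite_skip (T := 20) ?_ ?_).mono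
    (by simp [Test.or, lexTest, NExpr.cost, RExpr.cost, Test.cost]) fun _ h => h
  · intro hb
    rw [htest] at hb
    refine (Halts.setR ?_).mono (by simp [NExpr.cost, RExpr.cost]) fun _ h => h
    simp only [NExpr.eval, RExpr.eval, hk₂, hu₂]
    refine ⟨onlyAt_writeR _ _ _ _ _, ?_⟩
    rw [State.writeR_real_self, if_neg fun h => hb (h v (by omega)), Nat.cast_zero]
  · intro hb
    rw [htest, not_not] at hb
    refine ⟨fun _ _ _ => rfl, ?_⟩
    rw [hval]
    congr 1
    refine propext ⟨fun h w hw => ?_, fun h w hw => h w (by omega)⟩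
    rcases Nat.lt_succ_iff_lt_or_eq.1 hw with h' | rfl
    exacts [h w h', hb]

/-- Computation of the cells. -/
def cellProg : Prog :=
  .forEntries (.accum 9 0 5 0 0 (.ite (lexTest (.var 5) (.var 4))
    (.setR 9 (.var 3) (.var 4) (.add (.cell 9 (.var 3) (.var 4)) (.cell 8 (.var 3) (.var 5))))
    .skip))

open Classical in
theorem halts_cellProg {ω : Tape} {s : State} {n R : ℕ} {β : ℝ} {q y : ℕ → ℕ → ℝ}
    (hn : s.nat 0 0 = n) (hR : s.nat 2 0 = R)
    (hq : ∀ k < R, ∀ u < n, s.real 7 k u = q k u)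
    (hflag : ∀ k < R, ∀ u < n, s.real 8 k u = if Flagged n β (q k) (y k) u then 1 else 0) :
    Halts ω cellProg s (R * ((n * ((n * 100 + 100) + 12) + 9) + 12) + 9) fun s' =>
      ∀ k < R, ∀ u < n, s'.real 9 k u = cell n β (q k) (y k) u := by
  refine Halts.forEntries hR hn (by simp [Prog.writesN, Prog.for, Prog.accum])
    (by simp [Prog.writesN, Prog.for, Prog.accum]) (by simp [Prog.writesN, Prog.for, Prog.accum])
    (by simp [Prog.writesN, Prog.for, Prog.accum]) ?_
  intro k u s₁ hk hu hck hcu hf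
  simp only [Prog.writesN, Prog.writesR, Prog.for, Prog.accum] at hf
  refine (Halts.accum (T := 88) (A := fun i => ∑ w ∈ range i,
      if LexLt (q k) w u ∧ Flagged n β (q k) (y k) w then 1 else 0) hck hcu
    (by rw [hf.nat 0 (by simp), hn]) (by simp) (by simp [Prog.writesN]) (by simp [Prog.writesN])
    (by simp) ?_).mono (by omega) fun s' h => ⟨h.1, by rw [h.2, cell, card_filter]; simp⟩
  intro w s₂ hw hc₂ hf₂ hval
  simp only [Prog.writesN, Prog.writesR] at hf₂
  have hk₂ : s₂.nat 3 0 = k := by rw [hf₂.nat 3 (by simp), hck]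
  have hu₂ : s₂.nat 4 0 = u := by rw [hf₂.nat 4 (by simp), hcu]
  have h7₂ : s₂.real 7 = s.real 7 := by rw [hf₂.real 7 (by simp), hf.real 7 (by simp)]
  have h8₂ : s₂.real 8 = s.real 8 := by rw [hf₂.real 8 (by simp), hf.real 8 (by simp)]
  have hlex : (lexTest (.var 5) (.var 4)).Holds s₂ ↔ LexLt (q k) w u := by
    rw [holds_lexTest (q := q k) hk₂]
    · simp [NExpr.eval, hu₂, hc₂]
    · simp [NExpr.eval, hu₂, h7₂, hq k hk u hu]
    · simp [NExpr.eval, hc₂, h7₂, hq k hk w hw]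
  refine (Halts.ite_skip (T := 20) ?_ ?_).mono
    (by simp [Test.or, lexTest, NExpr.cost, RExpr.cost, Test.cost]) fun _ h => h
  · intro hb
    rw [hlex] at hb
    refine (Halts.setR ?_).mono (by simp [NExpr.cost, RExpr.cost]) fun _ h => h
    simp only [NExpr.eval, RExpr.eval, hk₂, hu₂, hc₂, hval, h8₂, hflag k hk w hw]
    exact ⟨onlyAt_writeR _ _ _ _ _, by rw [State.writeR_real_self, sum_range_succ]; simp [hb]⟩
  · intro hb
    rw [hlex] at hb
    exact ⟨fun _ _ _ => rfl, by rw [hval, sum_range_succ]; simp [hb]⟩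

end RealRAM

/-! ### Number of rounds, sampling, and output of the set -/

namespace RealRAM

open Finset

/-- Computation of the number of rounds. -/
def roundsProg (K : ℕ) : Prog :=
  .seq (.setR 10 (.lit 0) (.lit 0) (.ofNat (.lit 1)))
    (.while (.not (.rle (.cell 1 (.lit 0) (.lit 0)) (.cell 10 (.lit 0) (.lit 0))))
      (.seq (.setR 10 (.lit 0) (.lit 0)
          (.add (.cell 10 (.lit 0) (.lit 0)) (.cell 10 (.lit 0) (.lit 0))))
        (.setN 2 (.lit 0) (.add (.var 2) (.lit K)))))

/-- Doubling 1 until it reaches `m` takes `⌈Real.logb 2 m⌉₊` iterations. Adding `K` each time yields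
the number of rounds as a natural number without logarithms or rounding. -/
theorem halts_roundsProg {ω : Tape} {s : State} {m : ℝ} (K : ℕ) (hm : 0 < m)
    (h : s.nat 2 0 = 0) (hsm : s.real 1 0 0 = m) :
    Halts ω (roundsProg K) s (⌈Real.logb 2 m⌉₊ * 50 + 50) fun s' =>
      s'.nat 2 0 = K * ⌈Real.logb 2 m⌉₊ ∧ s'.usedU = s.usedU ∧ s'.usedG = s.usedG := by
  refine (Halts.seq (Halts.setR (Q := fun s' => s' = s.writeR 10 0 0 1) ?_)
    (T₂ := ⌈Real.logb 2 m⌉₊ * 50 + 40) ?_).mono ?_ fun _ h => h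
  · simp [NExpr.eval, RExpr.eval]
  · rintro _ - rfl
    refine (Halts.while (N := ⌈Real.logb 2 m⌉₊) (T := 20) (i := 0)
      (I := fun i s' => s'.real 10 0 0 = 2 ^ i ∧ s'.nat 2 0 = K * i ∧ s'.real 1 0 0 = m ∧
        s'.usedU = s.usedU ∧ s'.usedG = s.usedG) ?_ ?_ (Nat.zero_le _)).mono ?_ ?_
    · rintro i s₁ ⟨h1, h2, h3, h4, h5⟩ hb
      simp only [Test.Holds, RExpr.eval, NExpr.eval, h1, h3, not_le] at hb
      refine ⟨?_, ?_⟩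
      · rw [Nat.lt_ceil, Real.lt_logb_iff_rpow_lt one_lt_two hm, Real.rpow_natCast]
        exact hb
      · refine (Halts.seq (Halts.setR (Q := fun s' => s' = s₁.writeR 10 0 0 (2 ^ (i + 1))) ?_)
          (T₂ := 6) ?_).mono (by simp [NExpr.cost, RExpr.cost]) fun _ h => h
        · simp only [NExpr.eval, RExpr.eval, h1]
          congr 1
          ring
        · rintro _ - rfl
          refine (Halts.setN ?_).mono (by simp [NExpr.cost]) fun _ h => h
          refine ⟨by simp [NExpr.eval], ?_, ?_, h4, h5⟩
          · simp [NExpr.eval, h2, Nat.mul_succ]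
          · simp [NExpr.eval, State.writeR_real_of_ne, h3]
    · refine ⟨by simp, by simpa using h, ?_, rfl, rfl⟩
      rw [State.writeR_real_of_ne (by simp), hsm]
    · simp only [Test.cost, RExpr.cost, NExpr.cost]
      omega
    · rintro s' ⟨i, hi, ⟨h1, h2, h3, h4, h5⟩, hb⟩
      simp only [Test.Holds, RExpr.eval, NExpr.eval, h1, h3, not_le, not_lt] at hb
      refine ⟨?_, h4, h5⟩
      rw [h2]
      congr 1
      refine le_antisymm hi (Nat.ceil_le.2 ?_)
      rw [Real.logb_le_iff_le_rpow one_lt_two hm, Real.rpow_natCast]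
      exact hb
  · simp only [NExpr.cost, RExpr.cost]
    omega

theorem Halts.uniform {ω : Tape} {s : State} {a : ℕ} {i j : NExpr} {Q : State → Prop}
    (h : Q { s.writeR a (i.eval s) (j.eval s) (ω.1 s.usedU : ℝ) with usedU := s.usedU + 1 }) :
    Halts ω (.uniform a i j) s (i.cost + j.cost + 1) Q :=
  ⟨_, _, .uniform s a i j, le_rfl, h⟩

theorem Halts.gaussian {ω : Tape} {s : State} {a : ℕ} {i j : NExpr} {Q : State → Prop}
    (h : Q { s.writeR a (i.eval s) (j.eval s) (ω.2 s.usedG) with usedG := s.usedG + 1 }) :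
    Halts ω (.gaussian a i j) s (i.cost + j.cost + 1) Q :=
  ⟨_, _, .gaussian s a i j, le_rfl, h⟩

/-- Drawing `N` uniform samples into a row of the array `a`. -/
theorem halts_for_uniform {ω : Tape} {s : State} {a c b l N k e : ℕ} {i : NExpr} (hcb : c ≠ b)
    (hN : s.nat b l = N)
    (hi : ∀ s', Frame [c] [a] s s' → i.eval s' = k) (hU : s.usedU = e) :
    Halts ω (.for c b l (.uniform a i (.var c))) s (N * ((i.cost + 3) + 12) + 9) fun s' =>
      s'.usedU = e + N ∧ s'.usedG = s.usedG ∧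
        (∀ k' j, k' ≠ k → s'.real a k' j = s.real a k' j) ∧
        ∀ j < N, s'.real a k j = ω.1 (e + j) := by
  refine Halts.for (I := fun n s' => s'.usedU = e + n ∧ s'.usedG = s.usedG ∧
        (∀ k' j, k' ≠ k → s'.real a k' j = s.real a k' j) ∧
        ∀ j < n, s'.real a k j = ω.1 (e + j)) hcb (by simp [Prog.writesN])
        (by simp [Prog.writesN]) hN (fun _ _ _ h => h) (by simp [hU]) ?_
  rintro n s₁ hn hc hf ⟨h1, h2, h3, h4⟩
  refine (Halts.uniform ?_).mono (by simp [NExpr.cost]) fun _ h => h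
  simp only [hi s₁ hf, NExpr.eval, hc, h1]
  refine ⟨rfl, h2, fun k' j hk => ?_, fun j hj => ?_⟩
  · rw [← h3 k' j hk]
    simp [State.writeR, hk]
  · rcases Nat.lt_succ_iff_lt_or_eq.1 hj with h | rfl
    · rw [← h4 j h]
      simp [State.writeR, h.ne]
    · exact State.writeR_real_self _ _ _ _ _

/-- Drawing `N` Gaussian samples into a row of the array `a`. -/
theorem halts_for_gaussian {ω : Tape} {s : State} {a c b l N k e : ℕ} {i : NExpr} (hcb : c ≠ b)
    (hN : s.nat b l = N)
    (hi : ∀ s', Frame [c] [a] s s' → i.eval s' = k) (hU : s.usedG = e) :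
    Halts ω (.for c b l (.gaussian a i (.var c))) s (N * ((i.cost + 3) + 12) + 9) fun s' =>
      s'.usedG = e + N ∧ s'.usedU = s.usedU ∧
        (∀ k' j, k' ≠ k → s'.real a k' j = s.real a k' j) ∧
        ∀ j < N, s'.real a k j = ω.2 (e + j) := by
  refine Halts.for (I := fun n s' => s'.usedG = e + n ∧ s'.usedU = s.usedU ∧
        (∀ k' j, k' ≠ k → s'.real a k' j = s.real a k' j) ∧
        ∀ j < n, s'.real a k j = ω.2 (e + j)) hcb (by simp [Prog.writesN])
        (by simp [Prog.writesN]) hN (fun _ _ _ h => h) (by simp [hU]) ?_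
  rintro n s₁ hn hc hf ⟨h1, h2, h3, h4⟩
  refine (Halts.gaussian ?_).mono (by simp [NExpr.cost]) fun _ h => h
  simp only [hi s₁ hf, NExpr.eval, hc, h1]
  refine ⟨rfl, h2, fun k' j hk => ?_, fun j hj => ?_⟩
  · rw [← h3 k' j hk]
    simp [State.writeR, hk]
  · rcases Nat.lt_succ_iff_lt_or_eq.1 hj with h | rfl
    · rw [← h4 j h]
      simp [State.writeR, h.ne]
    · exact State.writeR_real_self _ _ _ _ _

/-- Drawing all samples. -/
def sampleProg : Prog :=
  .seq (.uniform 2 (.lit 0) (.lit 0))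
    (.seq (.for 4 0 0 (.uniform 3 (.lit 0) (.var 4)))
      (.for 3 2 0 (.seq (.for 6 0 1 (.gaussian 4 (.var 3) (.var 6)))
        (.for 4 0 0 (.uniform 5 (.var 3) (.var 4))))))

/-- The exact tape positions matter: threshold, labels and cuts occupy the disjoint uniform blocks
`{0}`, `1, …, n` and beyond `n`, and different rounds use disjoint blocks. All later independence
statements rest on this layout. -/
theorem halts_sampleProg {ω : Tape} {s : State} {n d R : ℕ} (hn : s.nat 0 0 = n)
    (hd : s.nat 0 1 = d) (hR : s.nat 2 0 = R) (hU : s.usedU = 0) (hG : s.usedG = 0) :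
    Halts ω sampleProg s (n * 50 + (R * (d * 17 + n * 17 + 30) + 50)) fun s' =>
      s'.real 2 0 0 = ω.1 0 ∧ (∀ c < n, s'.real 3 0 c = ω.1 (1 + c)) ∧
      (∀ k < R, ∀ j < d, s'.real 4 k j = ω.2 (k * d + j)) ∧
      ∀ k < R, ∀ w < n, s'.real 5 k w = ω.1 (1 + n + k * n + w) := by
  refine (Halts.seq (T₁ := 3) (T₂ := (n * 16 + 9) + (R * ((d * 17 + 9 + (n * 17 + 9)) + 12) + 9))
    (Q₁ := fun s' => s'.real 2 0 0 = ω.1 0 ∧ s'.usedU = 1 ∧ s'.usedG = 0)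
    ?_ ?_).mono ?_ fun _ h => h
  · refine (Halts.uniform ?_).mono (by simp [NExpr.cost]) fun _ h => h
    simp [NExpr.eval, hU, hG, State.writeR]
  · rintro s₁ hf₁ ⟨h2, hU₁, hG₁⟩
    simp only [Prog.writesN, Prog.writesR] at hf₁
    refine Halts.seq (halts_for_uniform (k := 0) (N := n) (by simp) (by rw [hf₁.nat 0 (by simp), hn])
      (fun _ _ => rfl) hU₁) ?_
    rintro s₂ hf₂ ⟨hU₂, hG₂, -, h3⟩
    simp only [Prog.writesN, Prog.writesR, Prog.for] at hf₂
    have hn₂ : s₂.nat 0 = s.nat 0 := by rw [hf₂.nat 0 (by simp), hf₁.nat 0 (by simp)]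
    have hr₂ : s₂.real 2 = s₁.real 2 := hf₂.real 2 (by simp)
    refine (Halts.for (I := fun k s' => s'.usedU = 1 + n + k * n ∧ s'.usedG = k * d ∧
      (∀ k' < k, ∀ j < d, s'.real 4 k' j = ω.2 (k' * d + j)) ∧
      ∀ k' < k, ∀ w < n, s'.real 5 k' w = ω.1 (1 + n + k' * n + w)) (by simp)
      (by simp [Prog.writesN, Prog.for]) (by simp [Prog.writesN, Prog.for])
      (by rw [hf₂.nat 2 (by simp), hf₁.nat 2 (by simp), hR]) (fun _ _ _ h => h)
      (by simp [hU₂, hG₂, hG₁]) ?_).with_frame.mono le_rfl ?_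
    · rintro k s₃ hk hc₃ hf₃ ⟨hU₃, hG₃, h4, h5⟩
      simp only [Prog.writesN, Prog.writesR, Prog.for] at hf₃
      have hn₃ : s₃.nat 0 = s.nat 0 := by rw [hf₃.nat 0 (by simp), hn₂]
      refine Halts.seq (halts_for_gaussian (k := k) (N := d) (by simp) (by rw [hn₃, hd])
        (fun s' hf => by simp [NExpr.eval, hf.nat 3 (by simp), hc₃]) hG₃) ?_
      rintro s₄ hf₄ ⟨hG₄, hU₄, h4o, h4n⟩
      simp only [Prog.writesN, Prog.writesR, Prog.for] at hf₄
      refine (halts_for_uniform (k := k) (N := n) (by simp)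
        (by rw [hf₄.nat 0 (by simp), hn₃, hn])
        (fun s' hf => by simp [NExpr.eval, hf.nat 3 (by simp), hf₄.nat 3 (by simp), hc₃])
        (hU₄.trans hU₃)).with_frame.mono le_rfl ?_
      rintro s₅ ⟨hf₅, hU₅, hG₅, h5o, h5n⟩
      simp only [Prog.writesN, Prog.writesR, Prog.for] at hf₅
      refine ⟨by rw [hU₅]; ring, by rw [hG₅, hG₄]; ring, fun k' hk' j hj => ?_,
        fun k' hk' w hw => ?_⟩
      · rw [hf₅.real 4 (by simp)]
        rcases Nat.lt_succ_iff_lt_or_eq.1 hk' with h | rfl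
        · rw [h4o k' j h.ne, h4 k' h j hj]
        · exact h4n j hj
      · rcases Nat.lt_succ_iff_lt_or_eq.1 hk' with h | rfl
        · rw [h5o k' w h.ne, hf₄.real 5 (by simp), h5 k' h w hw]
        · exact h5n w hw
    · rintro s' ⟨hf', -, -, h4, h5⟩
      simp only [Prog.writesN, Prog.writesR, Prog.for] at hf'
      exact ⟨by rw [hf'.real 2 (by simp), hr₂, h2], fun c hc => by
        rw [hf'.real 3 (by simp), h3 c hc], h4, h5⟩
  · have : R * ((d * 17 + 9 + (n * 17 + 9)) + 12) = R * (d * 17 + n * 17 + 30) := by ring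
    omega

/-- The test whether the cluster of representative `v` is selected. -/
def selTest : Test :=
  let nn : RExpr := .ofNat (.var 0)
  let mm : RExpr := .add (.cell 1 (.lit 0) (.lit 0)) (.cell 1 (.lit 0) (.lit 0))
  let y : RExpr := .mul nn (.cell 3 (.lit 0) (.lit 0))
  .or (.and (.rle nn mm) (.and (.not (.rle y (.ofNat (.var 5))))
      (.rle y (.add (.ofNat (.var 5)) (.ofNat (.lit 1))))))
    (.and (.not (.rle nn mm)) (.rle (.mul mm (.cell 3 (.lit 0) (.var 5))) (.ofNat (.lit 1))))

/-- Computation of the random set. -/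
def outProg : Prog :=
  .for 4 0 0 (.seq
    (.seq (.setN 1 (.var 4) (.lit 0))
      (.for 5 0 0 (.seq (.seq (.setN 7 (.lit 0) (.lit 1))
          (.for 3 2 0 (.ite (.not (.and (.rle (.cell 9 (.var 3) (.var 4)) (.cell 9 (.var 3) (.var 5)))
            (.rle (.cell 9 (.var 3) (.var 5)) (.cell 9 (.var 3) (.var 4)))))
            (.setN 7 (.lit 0) (.lit 0)) .skip)))
        (.ite (.nle (.lit 1) (.var 7))
          (.ite selTest (.setN 1 (.var 4) (.lit 1)) (.setN 1 (.var 4) (.lit 0))) .skip))))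
    (.ite (.not (.rle (.cell 2 (.lit 0) (.lit 0)) (.cell 6 (.lit 0) (.var 4))))
      (.setN 1 (.var 4) (.lit 0)) .skip))

/-- While scanning the vertices `v`, every `v` in the cluster of `u` overwrites the entry of `u` by
its own selection status. The last such `v` is the representative, so its status survives; the
threshold test comes afterwards. -/
theorem halts_outProg {ω : Tape} {s : State} {n R : ℕ} {m β r : ℝ} {q y : ℕ → ℕ → ℝ}
    {lab N : ℕ → ℝ}
    (hn : s.nat 0 0 = n) (hR : s.nat 2 0 = R) (hm : s.real 1 0 0 = m) (hr : s.real 2 0 0 = r)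
    (hlab : ∀ c < n, s.real 3 0 c = lab c) (hN : ∀ u < n, s.real 6 0 u = N u)
    (hcell : ∀ k < R, ∀ u < n, s.real 9 k u = cell n β (q k) (y k) u) :
    Halts ω outProg s (n * ((n * ((R * 50 + 150) + 12) + 50) + 12) + 9) fun s' =>
      ∀ u < n, s'.nat 1 u = 1 ↔ r ≤ N u ∧ ∃ c, IsRep n R β q y u c ∧ Selected n m lab c := by
  refine Halts.for (I := fun i s' => ∀ u < i, s'.nat 1 u = 1 ↔
      r ≤ N u ∧ ∃ c, IsRep n R β q y u c ∧ Selected n m lab c) (by simp)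
    (by simp [Prog.writesN, Prog.for]) (by simp [Prog.writesN, Prog.for]) hn ?_ (by simp) ?_
  · intro i s' v h u hu
    rw [← h u hu, State.writeN_nat_of_ne (by simp)]
  intro u s₁ hu hcu hf₁ hI₁
  simp only [Prog.writesN, Prog.writesR, Prog.for] at hf₁
  have hn₁ : s₁.nat 0 = s.nat 0 := hf₁.nat 0 (by simp)
  have hR₁ : s₁.nat 2 = s.nat 2 := hf₁.nat 2 (by simp)
  have hreal₁ : s₁.real = s.real := funext fun a => hf₁.real a (by simp)
  refine (Halts.seq (T₁ := n * ((R * 50 + 150) + 12) + 20) (T₂ := 25) (Q₁ := fun s' =>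
    (∀ u' < u, s'.nat 1 u' = s₁.nat 1 u') ∧ (s'.nat 1 u = 1 ↔
      ∃ c < n, (Same n R β q y u c ∧ ∀ c' < n, c < c' → ¬ Same n R β q y u c') ∧
        Selected n m lab c)) ?_ ?_).mono (by omega) fun _ h => h
  · refine (Halts.seq (T₂ := n * ((R * 50 + 150) + 12) + 9) (Halts.setN
      (Q := fun s' => s' = s₁.writeN 1 u 0) (by simp [NExpr.eval, hcu])) ?_).mono
      (by simp only [NExpr.cost]; omega) fun _ h => h
    rintro s₂ - hs₂
    have hn₂ : s₂.nat 0 = s.nat 0 := by rw [hs₂, State.writeN_nat_of_ne (by simp), hn₁]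
    have hR₂ : s₂.nat 2 = s.nat 2 := by rw [hs₂, State.writeN_nat_of_ne (by simp), hR₁]
    have hu₂ : s₂.nat 4 0 = u := by rw [hs₂, State.writeN_nat_of_ne (by simp), hcu]
    have hreal₂ : s₂.real = s.real := by rw [hs₂, State.writeN_real, hreal₁]
    refine Halts.for (I := fun i s' => (∀ u' < u, s'.nat 1 u' = s₁.nat 1 u') ∧ (s'.nat 1 u = 1 ↔
      ∃ c < i, (Same n R β q y u c ∧ ∀ c' < i, c < c' → ¬ Same n R β q y u c') ∧
        Selected n m lab c)) (by simp)
      (by simp [Prog.writesN, Prog.for]) (by simp [Prog.writesN, Prog.for]) (by rw [hn₂, hn])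
      ?_ ?_ ?_
    · intro i s' v h
      rwa [State.writeN_nat_of_ne (by simp)]
    · subst hs₂
      exact ⟨fun u' hu' => by simp [State.writeN, hu'.ne], by simp⟩
    intro v s₃ hv hcv hf₃ hI₃
    simp only [Prog.writesN, Prog.writesR, Prog.for] at hf₃
    have hn₃ : s₃.nat 0 = s.nat 0 := by rw [hf₃.nat 0 (by simp), hn₂]
    have hR₃ : s₃.nat 2 = s.nat 2 := by rw [hf₃.nat 2 (by simp), hR₂]
    have hu₃ : s₃.nat 4 0 = u := by rw [hf₃.nat 4 (by simp), hu₂]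
    have hreal₃ : s₃.real = s.real := by
      rw [← hreal₂]; exact funext fun a => hf₃.real a (by simp)
    refine (Halts.seq (T₁ := R * (30 + 12) + 20) (T₂ := 100) (Q₁ := fun s' =>
      s'.nat 1 = s₃.nat 1 ∧ s'.nat 7 0 ≤ 1 ∧ (s'.nat 7 0 = 1 ↔ Same n R β q y u v)) ?_ ?_).mono
      (by omega) fun _ h => h
    · refine (Halts.seq (T₂ := R * (30 + 12) + 9) (Halts.setN
        (Q := fun s' => s' = s₃.writeN 7 0 1) (by simp [NExpr.eval])) ?_).mono
        (by simp only [NExpr.cost]; omega) fun _ h => h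
      rintro s₄ - hs₄
      refine Halts.for (I := fun i s' => s'.nat 1 = s₃.nat 1 ∧ s'.nat 7 0 ≤ 1 ∧
        (s'.nat 7 0 = 1 ↔ Same n i β q y u v)) (by simp)
        (by simp [Prog.writesN]) (by simp [Prog.writesN])
        (by rw [hs₄, State.writeN_nat_of_ne (by simp), hR₃, hR]) ?_ ?_ ?_
      · intro i s' w h
        rwa [State.writeN_nat_of_ne (by simp), State.writeN_nat_of_ne (by simp)]
      · subst hs₄
        exact ⟨State.writeN_nat_of_ne (by simp), by simp, by simp [Same]⟩
      rintro k s₅ hk hck hf₅ ⟨h1, h2, h3⟩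
      simp only [Prog.writesN, Prog.writesR] at hf₅
      have hu₅ : s₅.nat 4 0 = u := by
        rw [hf₅.nat 4 (by simp), hs₄, State.writeN_nat_of_ne (by simp), hu₃]
      have hv₅ : s₅.nat 5 0 = v := by
        rw [hf₅.nat 5 (by simp), hs₄, State.writeN_nat_of_ne (by simp), hcv]
      have h9₅ : s₅.real 9 = s.real 9 := by
        rw [hf₅.real 9 (by simp), hs₄, State.writeN_real, hreal₃]
      have htest : (Test.not (.and (.rle (.cell 9 (.var 3) (.var 4)) (.cell 9 (.var 3) (.var 5)))
          (.rle (.cell 9 (.var 3) (.var 5)) (.cell 9 (.var 3) (.var 4))))).Holds s₅ ↔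
          ¬ cell n β (q k) (y k) u = cell n β (q k) (y k) v := by
        simp only [Test.Holds, RExpr.eval, NExpr.eval, hck, hu₅, hv₅, h9₅, hcell k hk u hu,
          hcell k hk v hv, Nat.cast_le, le_antisymm_iff]
      have hsucc : Same n (k + 1) β q y u v ↔ Same n k β q y u v ∧
          cell n β (q k) (y k) u = cell n β (q k) (y k) v := by
        simp only [Same, Nat.lt_succ_iff_lt_or_eq, or_imp, forall_and, forall_eq]
      refine (Halts.ite_skip (T := 3) ?_ ?_).mono (by simp [Test.cost, RExpr.cost, NExpr.cost])
        fun _ h => h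
      · intro hb
        rw [htest] at hb
        refine (Halts.setN ?_).mono (by simp [NExpr.cost]) fun _ h => h
        refine ⟨by rw [State.writeN_nat_of_ne (by simp), h1], by simp [NExpr.eval], ?_⟩
        simp [NExpr.eval, hsucc, hb]
      · intro hb
        rw [htest, not_not] at hb
        exact ⟨h1, h2, by rw [h3, hsucc]; simp [hb]⟩
    · rintro s₄ hf₄ ⟨h1, h2, h3⟩
      simp only [Prog.writesN, Prog.writesR, Prog.for] at hf₄
      have hn₄ : s₄.nat 0 0 = n := by rw [hf₄.nat 0 (by simp), hn₃, hn]
      have hu₄ : s₄.nat 4 0 = u := by rw [hf₄.nat 4 (by simp), hu₃]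
      have hv₄ : s₄.nat 5 0 = v := by rw [hf₄.nat 5 (by simp), hcv]
      have hreal₄ : s₄.real = s.real := by
        rw [← hreal₃]; exact funext fun a => hf₄.real a (by simp)
      have hsel : selTest.Holds s₄ ↔ Selected n m lab v := by
        simp [selTest, Test.holds_or, Test.Holds, RExpr.eval, NExpr.eval, hreal₄, hn₄, hv₄, hm,
          hlab 0 (by omega), hlab v hv, Selected]
      refine (Halts.ite_skip (T := 80) ?_ ?_).mono (by simp [Test.cost, NExpr.cost])
        fun _ h => h
      · intro hb
        have hsame : Same n R β q y u v := by
          rw [← h3]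
          simp only [Test.Holds, NExpr.eval] at hb
          omega
        have hrhs : (∃ c < v + 1, (Same n R β q y u c ∧
            ∀ c' < v + 1, c < c' → ¬ Same n R β q y u c') ∧ Selected n m lab c) ↔
            Selected n m lab v := by
          constructor
          · rintro ⟨c, hc, ⟨-, h5⟩, h6⟩
            rcases Nat.lt_succ_iff_lt_or_eq.1 hc with h | rfl
            -- A candidate before `v` is no longer the last one of the cluster once `v` has joined
            -- it.
            · exact absurd hsame (h5 v (by omega) h)
            · exact h6
          · exact fun h => ⟨v, by omega, ⟨hsame, fun c' hc' h' => by omega⟩, h⟩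
        refine (Halts.ite (T₁ := 4) (T₂ := 4) ?_ ?_).mono
          (by simp [selTest, Test.or, Test.cost, RExpr.cost, NExpr.cost]) fun _ h => h
        all_goals
          intro hs
          rw [hsel] at hs
          refine (Halts.setN ?_).mono (by simp [NExpr.cost]) fun _ h => h
          simp only [NExpr.eval, hu₄, hrhs, State.writeN_nat_self]
          refine ⟨fun u' hu' => ?_, by simp [hs]⟩
          rw [← hI₃.1 u' hu', ← h1]
          simp [State.writeN, hu'.ne]
      · intro hb
        have hsame : ¬ Same n R β q y u v := by
          rw [← h3]
          simp only [Test.Holds, NExpr.eval] at hb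
          omega
        rw [h1]
        refine ⟨hI₃.1, hI₃.2.trans ⟨?_, ?_⟩⟩
        · rintro ⟨c, hc, ⟨h4, h5⟩, h6⟩
          refine ⟨c, by omega, ⟨h4, fun c' hc' h' => ?_⟩, h6⟩
          rcases Nat.lt_succ_iff_lt_or_eq.1 hc' with h | rfl
          exacts [h5 c' h h', hsame]
        · rintro ⟨c, hc, ⟨h4, h5⟩, h6⟩
          refine ⟨c, ?_, ⟨h4, fun c' hc' h' => h5 c' (by omega) h'⟩, h6⟩
          rcases Nat.lt_succ_iff_lt_or_eq.1 hc with h | rfl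
          exacts [h, absurd h4 hsame]
  · rintro s₂ hf₂ ⟨h1, h2⟩
    simp only [Prog.writesN, Prog.writesR, Prog.for] at hf₂
    have hu₂ : s₂.nat 4 0 = u := by rw [hf₂.nat 4 (by simp), hcu]
    have hreal₂ : s₂.real = s.real := by
      rw [← hreal₁]; exact funext fun a => hf₂.real a (by simp)
    have htest : (Test.not (.rle (.cell 2 (.lit 0) (.lit 0)) (.cell 6 (.lit 0) (.var 4)))).Holds s₂ ↔
        ¬ r ≤ N u := by
      simp only [Test.Holds, RExpr.eval, NExpr.eval, hreal₂, hr, hu₂, hN u hu]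
    have hrep : (∃ c < n, (Same n R β q y u c ∧ ∀ c' < n, c < c' → ¬ Same n R β q y u c') ∧
        Selected n m lab c) ↔ ∃ c, IsRep n R β q y u c ∧ Selected n m lab c := by
      simp only [IsRep, and_assoc]
    rw [hrep] at h2
    refine (Halts.ite_skip (T := 4) ?_ ?_).mono (by simp [Test.cost, RExpr.cost, NExpr.cost])
      fun _ h => h
    · intro hb
      rw [htest] at hb
      refine (Halts.setN ?_).mono (by simp [NExpr.cost]) fun _ h => h
      intro u' hu'
      simp only [NExpr.eval, hu₂]
      rcases Nat.lt_succ_iff_lt_or_eq.1 hu' with h | rfl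
      · rw [← hI₁ u' h, ← h1 u' h]
        simp [State.writeN, h.ne]
      · simp [hb]
    · intro hb
      rw [htest, not_not] at hb
      intro u' hu'
      rcases Nat.lt_succ_iff_lt_or_eq.1 hu' with h | rfl
      · rw [← hI₁ u' h, ← h1 u' h]
      · simp [h2, hb]

end RealRAM

/-! ### The complete program and its running time -/

namespace RealRAM

open Finset

/-- The program that samples the orthogonal separator. -/
def separatorProg (K : ℕ) : Prog :=
  .seq (roundsProg K) (.seq sampleProg (.seq normsProg (.seq projProg (.seq flagProg
    (.seq cellProg outProg)))))

/-- The Gaussian vector of round `k`. -/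
def gaussRow (d : ℕ) (g : ℕ → ℝ) (k j : ℕ) : ℝ := g (k * d + j)

/-- The uniform samples that decide about the cuts of round `k`. -/
def cutRow (n : ℕ) (z : ℕ → unitInterval) (k w : ℕ) : ℝ := z (1 + n + k * n + w)

/-- The labels of the clusters. -/
def labels (z : ℕ → unitInterval) (c : ℕ) : ℝ := z (1 + c)

/-- The vertex `u` belongs to the random set. -/
def Member (n d R : ℕ) (m β : ℝ) (X : ℕ → ℕ → ℝ) (ω : Tape) (u : ℕ) : Prop :=
  (ω.1 0 : ℝ) ≤ ∑ j ∈ range d, X u j * X u j ∧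
    ∃ c, IsRep n R β (fun k => proj d X (gaussRow d ω.2 k)) (cutRow n ω.1) u c ∧
      Selected n m (labels ω.1) c

/-- A bound for the number of steps. -/
noncomputable def stepBound (K : ℕ) : Polynomial ℕ :=
  let X : Polynomial ℕ := .X
  (X * 50 + 50) + ((X * 50 + (K * X * (X * 17 + X * 17 + 30) + 50)) +
    ((X * ((X * 100 + 100) + 12) + 9) +
    ((K * X * ((X * ((X * 100 + 100) + 12) + 9) + 12) + 9) +
    ((K * X * ((X * ((X * 100 + 100) + 12) + 9) + 12) + 9) +
    ((K * X * ((X * ((X * 100 + 100) + 12) + 9) + 12) + 9) +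
    (X * ((X * ((K * X * 50 + 150) + 12) + 50) + 12) + 9))))))

theorem halts_separatorProg {n d : ℕ} (x : Fin n → EuclideanSpace ℝ (Fin d)) {m β : ℝ}
    (K : ℕ) (hm : 0 < m) (ω : Tape) :
    Halts ω (separatorProg K) (input x m β) ((stepBound K).eval (n + d + ⌈Real.logb 2 m⌉₊))
      fun s' => ∀ u < n, s'.nat 1 u = 1 ↔
        Member n d (K * ⌈Real.logb 2 m⌉₊) m β ((input x m β).real 0) ω u := by
  set L := ⌈Real.logb 2 m⌉₊
  set s := input x m β with hs
  have hn : s.nat 0 0 = n := by simp [hs, input]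
  have hd : s.nat 0 1 = d := by simp [hs, input]
  have hR : s.nat 2 0 = 0 := by simp [hs, input]
  have hm' : s.real 1 0 0 = m := by simp [hs, input]
  have hβ : s.real 1 0 1 = β := by simp [hs, input]
  set X := s.real 0 with hX
  refine (Halts.seq (halts_roundsProg K hm hR hm') (Q₂ := fun s' => ∀ u < n, s'.nat 1 u = 1 ↔
        Member n d (K * L) m β X ω u)
    (T₂ := (n * 50 + (K * L * (d * 17 + n * 17 + 30) + 50)) +
    ((n * ((d * 100 + 100) + 12) + 9) + ((K * L * ((n * ((d * 100 + 100) + 12) + 9) + 12) + 9) +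
    ((K * L * ((n * ((n * 100 + 100) + 12) + 9) + 12) + 9) +
    ((K * L * ((n * ((n * 100 + 100) + 12) + 9) + 12) + 9) +
    (n * ((n * ((K * L * 50 + 150) + 12) + 50) + 12) + 9)))))) ?_).mono ?_ fun _ h => h
  · rintro s₁ hf₁ ⟨hR₁, hU₁, hG₁⟩
    simp only [Prog.writesN, Prog.writesR, roundsProg] at hf₁
    have n₁ : s₁.nat 0 = s.nat 0 := hf₁.nat 0 (by simp)
    refine Halts.seq (halts_sampleProg (n := n) (d := d) (by rw [n₁, hn])
      (by rw [n₁, hd]) hR₁ hU₁ hG₁) ?_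
    rintro s₂ hf₂ ⟨hr, hlab, hgauss, hcut⟩
    simp only [Prog.writesN, Prog.writesR, sampleProg, Prog.for] at hf₂
    have n₂ : s₂.nat 0 = s.nat 0 := by rw [hf₂.nat 0 (by simp), n₁]
    have R₂ : s₂.nat 2 0 = K * L := by rw [hf₂.nat 2 (by simp), hR₁]
    have x₂ : s₂.real 0 = X := by rw [hf₂.real 0 (by simp), hf₁.real 0 (by simp)]
    have m₂ : s₂.real 1 = s.real 1 := by rw [hf₂.real 1 (by simp), hf₁.real 1 (by simp)]
    refine Halts.seq (halts_normsProg (n := n) (d := d) (by rw [n₂, hn]) (by rw [n₂, hd])) ?_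
    intro s₃ hf₃ hnorm
    simp only [Prog.writesN, Prog.writesR, normsProg, Prog.for] at hf₃
    have n₃ : s₃.nat 0 = s.nat 0 := by rw [hf₃.nat 0 (by simp), n₂]
    have R₃ : s₃.nat 2 0 = K * L := by rw [hf₃.nat 2 (by simp), R₂]
    rw [x₂] at hnorm
    refine Halts.seq (halts_projProg (n := n) (d := d) (X := X) (G := gaussRow d ω.2)
      (by rw [n₃, hn]) (by rw [n₃, hd]) R₃ (by rw [hf₃.real 0 (by simp), x₂]) hnorm
      (by rw [hf₃.real 4 (by simp)]; exact hgauss)) ?_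
    intro s₄ hf₄ hproj
    simp only [Prog.writesN, Prog.writesR, projProg, Prog.forEntries, Prog.accum, Prog.for] at hf₄
    have n₄ : s₄.nat 0 = s.nat 0 := by rw [hf₄.nat 0 (by simp), n₃]
    have R₄ : s₄.nat 2 0 = K * L := by rw [hf₄.nat 2 (by simp), R₃]
    have m₄ : s₄.real 1 = s.real 1 := by rw [hf₄.real 1 (by simp), hf₃.real 1 (by simp), m₂]
    refine Halts.seq (halts_flagProg (n := n) (β := β) (y := cutRow n ω.1)
      (by rw [n₄, hn]) R₄ (by rw [m₄, hβ]) hproj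
      (by rw [hf₄.real 5 (by simp), hf₃.real 5 (by simp)]; exact hcut)) ?_
    intro s₅ hf₅ hflag
    simp only [Prog.writesN, Prog.writesR, flagProg, Prog.forEntries, Prog.accum, Prog.for] at hf₅
    have n₅ : s₅.nat 0 = s.nat 0 := by rw [hf₅.nat 0 (by simp), n₄]
    have R₅ : s₅.nat 2 0 = K * L := by rw [hf₅.nat 2 (by simp), R₄]
    refine Halts.seq (halts_cellProg (n := n) (β := β)
      (by rw [n₅, hn]) R₅ (by rw [hf₅.real 7 (by simp)]; exact hproj) hflag) ?_
    intro s₆ hf₆ hcell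
    simp only [Prog.writesN, Prog.writesR, cellProg, Prog.forEntries, Prog.accum, Prog.for] at hf₆
    refine (halts_outProg (n := n) (R := K * L) (m := m) (r := ω.1 0) (lab := labels ω.1)
      (by rw [hf₆.nat 0 (by simp), n₅, hn]) (by rw [hf₆.nat 2 (by simp), R₅])
      (by rw [hf₆.real 1 (by simp), hf₅.real 1 (by simp), m₄, hm'])
      (by rw [hf₆.real 2 (by simp), hf₅.real 2 (by simp), hf₄.real 2 (by simp),
        hf₃.real 2 (by simp), hr])
      (by rw [hf₆.real 3 (by simp), hf₅.real 3 (by simp), hf₄.real 3 (by simp),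
        hf₃.real 3 (by simp)]; exact hlab)
      (by rw [hf₆.real 6 (by simp), hf₅.real 6 (by simp), hf₄.real 6 (by simp)]; exact hnorm)
      hcell).mono le_rfl fun _ h => h
  -- The exact budget is monotone in `n`, `d` and `L`, so each of them may be replaced by their sum.
  · have h1 : n ≤ n + d + L := by omega
    have h2 : d ≤ n + d + L := by omega
    have h3 : L ≤ n + d + L := by omega
    generalize n + d + L = Y at h1 h2 h3 ⊢
    simp only [stepBound, Polynomial.eval_add, Polynomial.eval_mul, Polynomial.eval_X,
      Polynomial.eval_ofNat, Polynomial.eval_natCast, Nat.cast_id]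
    gcongr

end RealRAM

namespace RealRAM

open Finset MeasureTheory ProbabilityTheory
open scoped NNReal ENNReal

/-! ### Gaussian estimates -/

/-- The law of an infinite sequence of independent standard Gaussian samples. -/
noncomputable def gaussLaw : Measure (ℕ → ℝ) := Measure.infinitePi fun _ : ℕ => gaussianReal 0 1

/-- The law of an infinite sequence of independent uniform samples. -/
noncomputable def unifLaw : Measure (ℕ → unitInterval) :=
  Measure.infinitePi fun _ : ℕ => (volume : Measure unitInterval)

instance : IsProbabilityMeasure gaussLaw := by unfold gaussLaw; infer_instance

instance : IsProbabilityMeasure unifLaw := by unfold unifLaw; infer_instance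

theorem tapeLaw_eq : tapeLaw = unifLaw.prod gaussLaw := rfl

theorem map_sum_gaussian {Ω ι : Type*} [MeasurableSpace Ω] {μ : Measure Ω}
    [IsProbabilityMeasure μ] {X : ι → Ω → ℝ} (hX : ∀ i, Measurable (X i)) (hind : iIndepFun X μ)
    (hlaw : ∀ i, μ.map (X i) = gaussianReal 0 1) (a : ι → ℝ) (S : Finset ι) :
    μ.map (fun ω => ∑ i ∈ S, X i ω * a i) = gaussianReal 0 (∑ i ∈ S, NNReal.mk (a i ^ 2) (sq_nonneg _)) := by
  classical
  induction S using Finset.induction_on with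
  | empty => simp [gaussianReal_zero_var]
  | insert i S hi ih =>
    have h1 : iIndepFun (fun i ω => X i ω * a i) μ :=
      hind.comp (fun i x => x * a i) fun i => by fun_prop
    have h2 := (h1.indepFun_finsetSum_of_notMem (fun i => by fun_prop) hi).symm
    have h3 : μ.map (fun ω => X i ω * a i) = gaussianReal 0 (NNReal.mk (a i ^ 2) (sq_nonneg _)) := by
      have := gaussianReal_map_mul_const (μ := 0) (v := 1) (a i)
      rw [← hlaw i, Measure.map_map (by fun_prop) (hX i)] at this
      simpa [Function.comp_def] using this
    have h4 := gaussianReal_add_gaussianReal_of_indepFun h2 h3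
      (by rw [← ih]; congr 1; funext ω; simp)
    rw [sum_insert hi, ← add_zero (0 : ℝ), ← h4]
    congr 1
    funext ω
    simp [sum_insert hi]

theorem iIndepFun_gaussLaw : iIndepFun (fun (i : ℕ) (g : ℕ → ℝ) => g i) gaussLaw :=
  iIndepFun_infinitePi (X := fun _ x => x) (by fun_prop)

theorem map_eval_gaussLaw (i : ℕ) : gaussLaw.map (fun g => g i) = gaussianReal 0 1 :=
  Measure.infinitePi_map_eval _ i

theorem map_gaussRow (d k : ℕ) (a : ℕ → ℝ) :
    gaussLaw.map (fun g => ∑ j ∈ range d, gaussRow d g k j * a j) =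
      gaussianReal 0 (∑ j ∈ range d, NNReal.mk (a j ^ 2) (sq_nonneg _)) := by
  refine map_sum_gaussian (X := fun j g => gaussRow d g k j)
    (fun j => by unfold gaussRow; fun_prop) ?_ (fun j => map_eval_gaussLaw _) a _
  exact iIndepFun_gaussLaw.precomp (g := fun j => k * d + j) fun i j h => by simpa using h

/-- The blocks `k * d, …, k * d + d - 1` are disjoint, so the Gaussian vectors of different rounds
are independent and the expectation of the product factors. -/
theorem integral_prod_gaussRow (d R : ℕ) (a : ℕ → ℝ) {φ : ℝ → ℝ} (hφ : Measurable φ) :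
    ∫ g, ∏ k ∈ range R, φ (∑ j ∈ range d, gaussRow d g k j * a j) ∂gaussLaw =
      ∏ k ∈ range R, ∫ g, φ (∑ j ∈ range d, gaussRow d g k j * a j) ∂gaussLaw := by
  have hinj : Function.Injective fun p : ℕ × Fin d => p.1 * d + p.2 := by
    rintro ⟨k, j⟩ ⟨k', j'⟩ h
    have hd : 0 < d := j.pos
    have h1 := congrArg (· / d) h
    have h2 := congrArg (· % d) h
    simp only [mul_comm _ d, Nat.mul_add_div hd, Nat.mul_add_mod, Nat.div_eq_of_lt j.2,
      Nat.div_eq_of_lt j'.2, Nat.mod_eq_of_lt j.2, Nat.mod_eq_of_lt j'.2, add_zero] at h1 h2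
    simp [h1, Fin.ext h2]
  have hrows : iIndepFun (fun (k : ℕ) (g : ℕ → ℝ) (j : Fin d) => gaussRow d g k j) gaussLaw := by
    have h1 : gaussLaw.map (fun g (p : ℕ × Fin d) => g (p.1 * d + p.2)) =
        Measure.infinitePi fun _ => gaussianReal 0 1 :=
      Measure.map_infinitePi_infinitePi_of_inj hinj
    have h2 : ∀ k : ℕ, gaussLaw.map (fun g (j : Fin d) => gaussRow d g k j) =
        Measure.infinitePi fun _ => gaussianReal 0 1 := fun k =>
      Measure.map_infinitePi_infinitePi_of_inj (f := fun j : Fin d => k * d + j)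
        fun i j h => Fin.ext (by simpa using h)
    -- Independence of the rows means that their joint law is the product of their laws. It is
    -- obtained by currying the product measure over pairs (round, coordinate).
    rw [iIndepFun_iff_map_fun_eq_infinitePi_map (fun k => by unfold gaussRow; fun_prop)]
    simp only [h2]
    have h3 := Measure.infinitePi_map_curry (ι := ℕ) (κ := Fin d)
      (fun _ _ => gaussianReal 0 1)
    rw [← h3, ← h1, Measure.map_map (by fun_prop) (by fun_prop)]
    rfl
  have h := (hrows.precomp (g := fun k : Fin R => (k : ℕ)) Fin.val_injective).integral_fun_prod_comp
    (f := fun _ (v : Fin d → ℝ) => φ (∑ j : Fin d, v j * a j))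
    (fun k => Measurable.aemeasurable (by unfold gaussRow; fun_prop)) (fun k => by
      refine Measurable.aestronglyMeasurable ?_
      fun_prop)
  simp only [prod_range, sum_range]
  exact h

/-- The maximum of `r` centred Gaussian variables of variance at most `σ ^ 2`. -/
theorem integral_max_gaussian_le {Ω ι : Type*} [MeasurableSpace Ω] {μ : Measure Ω}
    [IsProbabilityMeasure μ] {e : Finset ι} (he : 2 ≤ #e) {X : ι → Ω → ℝ} {v : ι → ℝ≥0} {σ : ℝ}
    (hσ : 0 < σ) (hlaw : ∀ i, μ.map (X i) = gaussianReal 0 (v i)) (hv : ∀ i ∈ e, v i ≤ σ ^ 2)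
    {M : Ω → ℝ} (hM0 : ∀ ω, 0 ≤ M ω) (hM : ∀ ω, ∃ i ∈ e, M ω ≤ |X i ω|) :
    ∫ ω, M ω ∂μ ≤ 3 * σ * √(Real.log #e) := by
  set r : ℝ := (#e : ℝ)
  have hr : (2 : ℝ) ≤ r := by simpa [r] using he
  have hlog : 0 < Real.log r := Real.log_pos (by linarith)
  set l := √(Real.log r) with hl
  have hl0 : 0 < l := Real.sqrt_pos.2 hlog
  have hl2 : l ^ 2 = Real.log r := Real.sq_sqrt hlog.le
  set s := l / σ with hs
  have hs0 : 0 < s := by positivity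
  set E := Real.exp (l ^ 2 / 2) with hE
  -- The parameter `s` normalizes the variance, and `A` bounds the mean of the sum of all `exp (± s
  -- * X i)`.
  set A := 2 * r * E with hA
  have hA0 : 0 < A := by positivity
  have hint : ∀ i, ∀ t : ℝ, Integrable (fun ω => Real.exp (t * X i ω)) μ ∧
      ∫ ω, Real.exp (t * X i ω) ∂μ = Real.exp (v i * t ^ 2 / 2) := by
    intro i t
    have h1 := mgf_gaussianReal (hlaw i) t
    simp only [zero_mul, zero_add] at h1
    refine ⟨?_, h1⟩
    -- The moment generating function of a non-integrable exponential is zero by convention, whereas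
    -- here it equals a positive number.
    by_contra hc
    have := mgf_undef (X := X i) (μ := μ) (t := t) hc
    rw [h1] at this
    exact (Real.exp_pos _).ne' this
  have hexp : ∀ i ∈ e, ∀ t : ℝ, t ^ 2 = s ^ 2 → ∫ ω, Real.exp (t * X i ω) ∂μ ≤ E := by
    intro i hi t ht
    rw [(hint i t).2, hE]
    refine Real.exp_le_exp.2 ?_
    have : (v i : ℝ) * t ^ 2 ≤ σ ^ 2 * s ^ 2 := by
      rw [ht]
      exact mul_le_mul_of_nonneg_right (hv i hi) (sq_nonneg _)
    have h2 : σ ^ 2 * s ^ 2 = l ^ 2 := by rw [hs]; field_simp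
    linarith
  -- In place of Jensen's inequality, the logarithm is bounded by its tangent at `A`; the bound is
  -- pointwise and linear in the exponentials, so no regularity of `M` is needed.
  have hbound : ∀ ω, M ω ≤ (Real.log A - 1) / s +
      (∑ i ∈ e, (Real.exp (s * X i ω) + Real.exp (-s * X i ω))) / (s * A) := by
    intro ω
    obtain ⟨i, hi, hMi⟩ := hM ω
    have h1 : Real.exp (s * M ω) ≤
        ∑ i ∈ e, (Real.exp (s * X i ω) + Real.exp (-s * X i ω)) := by
      refine le_trans ?_ (single_le_sum (f := fun i => Real.exp (s * X i ω) +
        Real.exp (-s * X i ω)) (fun i _ => by positivity) hi)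
      have h2 : s * M ω ≤ s * |X i ω| := mul_le_mul_of_nonneg_left hMi hs0.le
      rcases abs_cases (X i ω) with ⟨h3, -⟩ | ⟨h3, -⟩ <;> rw [h3] at h2
      · exact (Real.exp_le_exp.2 h2).trans (le_add_of_nonneg_right (Real.exp_pos _).le)
      · rw [mul_neg, ← neg_mul] at h2
        exact (Real.exp_le_exp.2 h2).trans (le_add_of_nonneg_left (Real.exp_pos _).le)
    have h3 := Real.log_le_sub_one_of_pos (x := Real.exp (s * M ω) / A) (by positivity)
    rw [Real.log_div (Real.exp_pos _).ne' hA0.ne', Real.log_exp] at h3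
    have h4 : s * M ω ≤ Real.log A - 1 +
        (∑ i ∈ e, (Real.exp (s * X i ω) + Real.exp (-s * X i ω))) / A := by
      have := div_le_div_of_nonneg_right h1 hA0.le
      linarith
    have h5 : M ω ≤ (Real.log A - 1 +
        (∑ i ∈ e, (Real.exp (s * X i ω) + Real.exp (-s * X i ω))) / A) / s := by
      rw [le_div_iff₀ hs0]
      linarith
    refine h5.trans_eq ?_
    field_simp
  have hi1 : ∀ i ∈ e, Integrable (fun ω => Real.exp (s * X i ω) + Real.exp (-s * X i ω)) μ :=
    fun i _ => (hint i s).1.add (hint i (-s)).1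
  have hi2 : Integrable (fun ω => (∑ i ∈ e, (Real.exp (s * X i ω) + Real.exp (-s * X i ω))) /
      (s * A)) μ := (integrable_finsetSum _ hi1).div_const _
  refine (integral_mono_of_nonneg (.of_forall hM0) ((integrable_const _).add hi2)
    (.of_forall hbound)).trans ?_
  have hsum : ∫ ω, (∑ i ∈ e, (Real.exp (s * X i ω) + Real.exp (-s * X i ω))) ∂μ ≤ A := by
    rw [integral_finsetSum _ hi1]
    refine (sum_le_card_nsmul e _ (2 * E) fun i hi => ?_).trans_eq ?_
    · rw [integral_add (hint i s).1 (hint i (-s)).1]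
      linarith [hexp i hi s rfl, hexp i hi (-s) (by ring)]
    · rw [nsmul_eq_mul, hA]
      ring
  have htotal : ∫ ω, ((Real.log A - 1) / s +
      (∑ i ∈ e, (Real.exp (s * X i ω) + Real.exp (-s * X i ω))) / (s * A)) ∂μ ≤
      Real.log A / s := by
    rw [integral_add (integrable_const _) hi2, integral_const, probReal_univ, one_smul, integral_div]
    have h6 := div_le_div_of_nonneg_right hsum (show 0 ≤ s * A by positivity)
    have h7 : A / (s * A) = 1 / s := by field_simp
    rw [h7] at h6
    have h8 : (Real.log A - 1) / s = Real.log A / s - 1 / s := by ring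
    linarith
  refine htotal.trans ?_
  -- Here `2 ≤ #e` enters: it absorbs `log 2` into `log r`, for a total of `5/2 * l ^ 2`.
  have hlogA : Real.log A ≤ 3 * l ^ 2 := by
    have h9 : Real.log A = Real.log 2 + Real.log r + l ^ 2 / 2 := by
      rw [hA, Real.log_mul (by positivity) (Real.exp_pos _).ne', Real.log_mul (by norm_num)
        (by positivity), Real.log_exp]
    have h10 : Real.log 2 ≤ Real.log r := Real.log_le_log (by norm_num) hr
    rw [h9, ← hl2]
    rw [← hl2] at h10
    nlinarith [sq_nonneg l]
  rw [div_le_iff₀ hs0]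
  refine hlogA.trans_eq ?_
  rw [hs]
  field_simp

/-- The mean of `exp (-|Z| / 2)` for a standard Gaussian variable `Z`. -/
noncomputable def gaussDecay : ℝ := ∫ z, Real.exp (-(|z| / 2)) ∂gaussianReal 0 1

theorem integrable_exp_neg_mul_abs {Ω : Type*} [MeasurableSpace Ω] {μ : Measure Ω}
    [IsProbabilityMeasure μ] {f : Ω → ℝ} (hf : Measurable f) (h0 : ∀ ω, 0 ≤ f ω) :
    Integrable (fun ω => Real.exp (-f ω)) μ := by
  refine Integrable.mono' (integrable_const (1 : ℝ)) (by fun_prop) (.of_forall fun ω => ?_)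
  rw [Real.norm_of_nonneg (Real.exp_pos _).le, Real.exp_le_one_iff]
  linarith [h0 ω]

theorem gaussDecay_nonneg : 0 ≤ gaussDecay := integral_nonneg fun _ => (Real.exp_pos _).le

/-- The integrand is below 1 except at the origin, which is a null set for the Gaussian law. -/
theorem gaussDecay_lt_one : gaussDecay < 1 := by
  have hint : Integrable (fun z : ℝ => Real.exp (-(|z| / 2))) (gaussianReal 0 1) :=
    integrable_exp_neg_mul_abs (by fun_prop) fun z => by positivity
  have h0 : ∀ z : ℝ, 0 ≤ 1 - Real.exp (-(|z| / 2)) := fun z => by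
    have : Real.exp (-(|z| / 2)) ≤ 1 := Real.exp_le_one_iff.2 (by linarith [abs_nonneg z])
    linarith
  have h1 : 0 < ∫ z, (1 - Real.exp (-(|z| / 2))) ∂gaussianReal 0 1 := by
    rw [integral_pos_iff_support_of_nonneg h0 ((integrable_const _).sub hint)]
    have h2 : Function.support (fun z : ℝ => 1 - Real.exp (-(|z| / 2))) = {0}ᶜ := by
      ext z
      simp [sub_eq_zero, eq_comm (a := (1 : ℝ))]
    rw [h2, measure_compl (measurableSet_singleton _) (measure_ne_top _ _)]
    have := nullSingletonClass_gaussianReal (μ := 0) (v := 1) one_ne_zero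
    simp
  rw [integral_sub (integrable_const _) hint] at h1
  simpa [gaussDecay] using h1

/-- `X` has the law of `√v * Z` with `Z` standard, so the exponent is at most `-|Z| / 2` by the
hypothesis on `c`. -/
theorem integral_exp_neg_gaussian_le {Ω : Type*} [MeasurableSpace Ω] {μ : Measure Ω}
    [IsProbabilityMeasure μ] {X : Ω → ℝ} (hX : Measurable X) {v : ℝ≥0}
    (hlaw : μ.map X = gaussianReal 0 v) {c : ℝ} (hc : 1 / 2 ≤ √v * c) :
    ∫ ω, Real.exp (-(|X ω| * c)) ∂μ ≤ gaussDecay := by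
  have h1 : gaussianReal 0 v = (gaussianReal 0 1).map (√v * ·) := by
    rw [gaussianReal_map_const_mul]
    congr 1
    · simp
    · ext; simp
  have h2 : ∫ ω, Real.exp (-(|X ω| * c)) ∂μ = ∫ z, Real.exp (-(|√v * z| * c)) ∂gaussianReal 0 1 := by
    rw [← integral_map (φ := (√v * ·)) (f := fun x => Real.exp (-(|x| * c))) (by fun_prop)
      (by fun_prop), ← h1, ← hlaw, integral_map hX.aemeasurable (by fun_prop)]
  rw [h2]
  refine integral_mono_of_nonneg (.of_forall fun _ => (Real.exp_pos _).le)
    (integrable_exp_neg_mul_abs (by fun_prop) fun z => by positivity) (.of_forall fun z => ?_)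
  refine Real.exp_le_exp.2 ?_
  rw [abs_mul, abs_of_nonneg (Real.sqrt_nonneg _)]
  nlinarith [abs_nonneg z]

end RealRAM

namespace RealRAM

open Finset MeasureTheory ProbabilityTheory
open scoped NNReal ENNReal

/-! ### Cells and gaps -/

/-- Identifies the machine's comparison with a lexicographic order, which supplies transitivity and
trichotomy. -/
theorem lexLt_iff {q : ℕ → ℝ} {w v : ℕ} : LexLt q w v ↔ toLex (q w, w) < toLex (q v, v) := by
  rw [LexLt, Prod.Lex.toLex_lt_toLex, not_le]
  constructor
  · rintro (h | ⟨h, h'⟩)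
    · exact Or.inl h
    · rcases h.lt_or_eq with h1 | h1
      exacts [Or.inl h1, Or.inr ⟨h1, h'⟩]
  · rintro (h | ⟨h, h'⟩)
    exacts [Or.inl h, Or.inr ⟨h.le, h'⟩]

theorem LexLt.trans {q : ℕ → ℝ} {u v w : ℕ} (h : LexLt q u v) (h' : LexLt q v w) :
    LexLt q u w := by
  rw [lexLt_iff] at *
  exact h.trans h'

theorem not_lexLt_self (q : ℕ → ℝ) (u : ℕ) : ¬ LexLt q u u := by
  rw [lexLt_iff]
  exact lt_irrefl _

theorem LexLt.not_lexLt {q : ℕ → ℝ} {u v : ℕ} (h : LexLt q u v) : ¬ LexLt q v u :=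
  fun h' => not_lexLt_self q u (h.trans h')

theorem lexLt_trichotomy (q : ℕ → ℝ) (u v : ℕ) : LexLt q u v ∨ u = v ∨ LexLt q v u := by
  simp only [lexLt_iff]
  rcases lt_trichotomy (toLex (q u, u)) (toLex (q v, v)) with h | h | h
  · exact Or.inl h
  · exact Or.inr (Or.inl (congrArg Prod.snd (toLex_inj.1 h)))
  · exact Or.inr (Or.inr h)

theorem LexLt.le {q : ℕ → ℝ} {w v : ℕ} (h : LexLt q w v) : q w ≤ q v := by
  rcases h with h | h
  exacts [(not_le.1 h).le, h.1]

open Classical in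
/-- The vertices from `u` (inclusive) to `v` (exclusive) in the order `LexLt`. -/
noncomputable def between (n : ℕ) (q : ℕ → ℝ) (u v : ℕ) : Finset ℕ :=
  {w ∈ range n | LexLt q w v ∧ ¬ LexLt q w u}

theorem between_subset (n : ℕ) (q : ℕ → ℝ) (u v : ℕ) : between n q u v ⊆ range n := by
  classical
  exact filter_subset _ _

/-- Take for `δ w` the distance to the successor of `w`. Among the conditions defining a flag, that
of the successor is the strongest, so no successor has to be computed by the program. The gaps
between two vertices telescope. -/
theorem exists_gap (n : ℕ) (q : ℕ → ℝ) : ∃ δ : ℕ → ℝ, (∀ w, 0 ≤ δ w) ∧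
    (∀ (β : ℝ) (y : ℕ → ℝ) (w v : ℕ), v < n → LexLt q w v →
      (Flagged n β q y w ↔ Real.exp (-(δ w / √β)) ≤ y w)) ∧
    ∀ u < n, ∀ v < n, ¬ LexLt q v u → ∑ w ∈ between n q u v, δ w = q v - q u := by
  classical
  have hnext : ∀ w, ∃ w', (∃ v < n, LexLt q w v) → w' < n ∧ LexLt q w w' ∧
      ∀ v < n, LexLt q w v → ¬ LexLt q v w' := by
    intro w
    by_cases h : ∃ v < n, LexLt q w v
    · obtain ⟨v, hv, hwv⟩ := h
      obtain ⟨w', hw', hmin⟩ := exists_min_image {v ∈ range n | LexLt q w v}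
        (fun v => toLex (q v, v)) ⟨v, by simp [hv, hwv]⟩
      simp only [mem_filter, mem_range] at hw' hmin
      exact ⟨w', fun _ => ⟨hw'.1, hw'.2, fun v hv h h' =>
        (hmin v ⟨hv, h⟩).not_gt (lexLt_iff.1 h')⟩⟩
    · exact ⟨0, fun h' => absurd h' h⟩
  choose nxt hnxt using hnext
  -- A vertex without successor gets the value 0. Its flag holds vacuously, but it lies below no
  -- vertex and is never counted.
  refine ⟨fun w => if ∃ v < n, LexLt q w v then q (nxt w) - q w else 0, fun w => ?_, ?_, ?_⟩
  · dsimp only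
    split_ifs with h
    · exact sub_nonneg.2 (hnxt w h).2.1.le
    · exact le_rfl
  · intro β y w v hv hwv
    have hex : ∃ v < n, LexLt q w v := ⟨v, hv, hwv⟩
    obtain ⟨h1, h2, h3⟩ := hnxt w hex
    dsimp only
    rw [if_pos hex, ← neg_div, neg_sub]
    refine ⟨fun h => h _ h1 h2, fun h v' hv' hwv' => le_trans ?_ h⟩
    have : q (nxt w) ≤ q v' := by
      rcases lexLt_trichotomy q (nxt w) v' with h4 | h4 | h4
      exacts [h4.le, h4 ▸ le_rfl, absurd h4 (h3 v' hv' hwv')]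
    gcongr
  · intro u hu v hv huv
    -- Replacing `u` by its successor removes exactly `u` from the set of vertices in between.
    induction hk : #(between n q u v) using Nat.strong_induction_on generalizing u with
    | _ k ih =>
      rcases lexLt_trichotomy q u v with h | rfl | h
      · have hex : ∃ v < n, LexLt q u v := ⟨v, hv, h⟩
        obtain ⟨h1, h2, h3⟩ := hnxt u hex
        have hset : between n q u v = insert u (between n q (nxt u) v) := by
          ext w
          simp only [between, mem_filter, mem_range, mem_insert]
          constructor
          · rintro ⟨hw, hwv, hwu⟩
            rcases lexLt_trichotomy q u w with h4 | h4 | h4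
            · exact Or.inr ⟨hw, hwv, h3 w hw h4⟩
            · exact Or.inl h4.symm
            · exact absurd h4 hwu
          · rintro (rfl | ⟨hw, hwv, hwu⟩)
            · exact ⟨hu, h, not_lexLt_self _ _⟩
            · exact ⟨hw, hwv, fun h4 => hwu (h4.trans h2)⟩
        have hnot : u ∉ between n q (nxt u) v := by simp [between, h2]
        rw [hset, sum_insert hnot, if_pos hex, ih _ ?_ _ h1 (h3 v hv h) rfl]
        · ring
        · rw [← hk, hset, card_insert_of_notMem hnot]
          exact Nat.lt_succ_self _
      · have : between n q u u = ∅ := by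
          ext w
          simp [between]
        rw [this, sum_empty, sub_self]
      · exact absurd h huv

theorem cell_le_cell {n : ℕ} {β : ℝ} {q y : ℕ → ℝ} {u v : ℕ} (h : ¬ LexLt q v u) :
    cell n β q y u ≤ cell n β q y v := by
  refine card_le_card fun w hw => ?_
  simp only [mem_filter] at hw ⊢
  refine ⟨hw.1, ?_, hw.2.2⟩
  rcases lexLt_trichotomy q u v with h1 | rfl | h1
  exacts [hw.2.1.trans h1, hw.2.1, absurd h1 h]

/-- The cuts below `u` form a subset of those below `v`, so equal counts force equal sets; the
difference consists of the flagged vertices in between. -/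
theorem cell_eq_cell_iff {n : ℕ} {β : ℝ} {q y : ℕ → ℝ} {u v : ℕ} (h : ¬ LexLt q v u) :
    cell n β q y u = cell n β q y v ↔ ∀ w ∈ between n q u v, ¬ Flagged n β q y w := by
  classical
  have hsub : {w ∈ range n | LexLt q w u ∧ Flagged n β q y w} ⊆
      {w ∈ range n | LexLt q w v ∧ Flagged n β q y w} := by
    intro w hw
    simp only [mem_filter] at hw ⊢
    refine ⟨hw.1, ?_, hw.2.2⟩
    rcases lexLt_trichotomy q u v with h1 | rfl | h1
    exacts [hw.2.1.trans h1, hw.2.1, absurd h1 h]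
  constructor
  · intro hc w hw hf
    have heq := eq_of_subset_of_card_le hsub (by unfold cell at hc; convert hc.ge)
    simp only [between, mem_filter] at hw
    have : w ∈ {w ∈ range n | LexLt q w u ∧ Flagged n β q y w} := by
      rw [heq]
      simp only [mem_filter]
      exact ⟨hw.1, hw.2.1, hf⟩
    simp only [mem_filter] at this
    exact hw.2.2 this.2.1
  · intro hb
    refine le_antisymm (cell_le_cell h) (card_le_card fun w hw => ?_)
    simp only [mem_filter] at hw ⊢
    refine ⟨hw.1, ?_, hw.2.2⟩
    by_contra hwu
    exact hb w (by classical exact mem_filter.2 ⟨hw.1, hw.2.1, hwu⟩) hw.2.2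

/-- Two vertices lie in the same cell if and only if certain samples are small. -/
theorem exists_cell_eq_iff {n : ℕ} (β : ℝ) (q : ℕ → ℝ) {u v : ℕ} (hu : u < n) (hv : v < n) :
    ∃ (B : Finset ℕ) (δ : ℕ → ℝ), B ⊆ range n ∧ (∀ w, 0 ≤ δ w) ∧ ∑ w ∈ B, δ w = |q u - q v| ∧
      ∀ y, cell n β q y u = cell n β q y v ↔ ∀ w ∈ B, y w < Real.exp (-(δ w / √β)) := by
  wlog h : ¬ LexLt q v u generalizing u v
  · obtain ⟨B, δ, h1, h2, h3, h4⟩ := this hv hu (not_not.1 h).not_lexLt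
    exact ⟨B, δ, h1, h2, by rw [h3, abs_sub_comm], fun y => by rw [← h4, eq_comm]⟩
  · obtain ⟨δ, h1, h2, h3⟩ := exists_gap n q
    refine ⟨between n q u v, δ, between_subset _ _ _ _, h1, ?_, fun y => ?_⟩
    · rw [h3 u hu v hv h, abs_sub_comm, abs_of_nonneg]
      rcases lexLt_trichotomy q u v with h4 | rfl | h4
      exacts [sub_nonneg.2 h4.le, (sub_self _).ge, absurd h4 h]
    · rw [cell_eq_cell_iff h]
      refine forall₂_congr fun w hw => ?_
      simp only [between, mem_filter] at hw
      rw [h2 β y w v hv hw.2.1, not_le]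

theorem Same.refl (n R : ℕ) (β : ℝ) (q y : ℕ → ℕ → ℝ) (u : ℕ) : Same n R β q y u u :=
  fun _ _ => rfl

theorem Same.symm {n R : ℕ} {β : ℝ} {q y : ℕ → ℕ → ℝ} {u v : ℕ} (h : Same n R β q y u v) :
    Same n R β q y v u := fun k hk => (h k hk).symm

theorem Same.trans {n R : ℕ} {β : ℝ} {q y : ℕ → ℕ → ℝ} {u v w : ℕ} (h : Same n R β q y u v)
    (h' : Same n R β q y v w) : Same n R β q y u w := fun k hk => (h k hk).trans (h' k hk)

open Classical in
/-- The last vertex in the cluster of `u`. -/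
noncomputable def rep (n R : ℕ) (β : ℝ) (q y : ℕ → ℕ → ℝ) (u : ℕ) : ℕ :=
  {c ∈ range n | Same n R β q y u c}.sup id

theorem isRep_iff {n R : ℕ} {β : ℝ} {q y : ℕ → ℕ → ℝ} {u c : ℕ} (hu : u < n) :
    IsRep n R β q y u c ↔ rep n R β q y u = c := by
  classical
  have hne : ({c ∈ range n | Same n R β q y u c}).Nonempty :=
    ⟨u, by simp [hu, Same.refl]⟩
  have hmem := exists_mem_eq_sup _ hne (id : ℕ → ℕ)
  obtain ⟨c₀, hc₀, hsup⟩ := hmem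
  simp only [mem_filter, mem_range, id] at hc₀ hsup
  have hrep : rep n R β q y u = c₀ := by unfold rep; convert hsup
  have hle : ∀ c' < n, Same n R β q y u c' → c' ≤ c₀ := fun c' hc' hs => by
    rw [← hsup]
    exact le_sup (f := id) (by simp [hc', hs])
  rw [hrep]
  constructor
  · rintro ⟨h1, h2, h3⟩
    refine le_antisymm ?_ (hle c h1 h2)
    by_contra hlt
    exact h3 c₀ hc₀.1 (not_le.1 hlt) hc₀.2
  · rintro rfl
    exact ⟨hc₀.1, hc₀.2, fun c' hc' hlt hs => (hle c' hc' hs).not_gt hlt⟩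

theorem rep_lt {n R : ℕ} {β : ℝ} {q y : ℕ → ℕ → ℝ} {u : ℕ} (hu : u < n) :
    rep n R β q y u < n := ((isRep_iff hu).2 rfl).1

theorem same_rep {n R : ℕ} {β : ℝ} {q y : ℕ → ℕ → ℝ} {u : ℕ} (hu : u < n) :
    Same n R β q y u (rep n R β q y u) := ((isRep_iff hu).2 rfl).2.1

/-- Representatives are a complete invariant of clusters, so a label attached to the representative
is a label of the cluster. -/
theorem rep_eq_rep_iff {n R : ℕ} {β : ℝ} {q y : ℕ → ℕ → ℝ} {u v : ℕ} (hu : u < n) (hv : v < n) :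
    rep n R β q y u = rep n R β q y v ↔ Same n R β q y u v := by
  constructor
  · intro h
    exact (same_rep hu).trans (h ▸ (same_rep hv).symm)
  · intro h
    rw [← isRep_iff hu]
    obtain ⟨h1, h2, h3⟩ := (isRep_iff (R := R) (β := β) (q := q) (y := y) hv).2 rfl
    exact ⟨h1, h.trans h2, fun c' hc' hlt hs => h3 c' hc' hlt (h.symm.trans hs)⟩

/-! ### Measurability -/

theorem measurableSet_lexLt (w v : ℕ) : MeasurableSet {q : ℕ → ℝ | LexLt q w v} := by
  have h : ∀ w v : ℕ, MeasurableSet {q : ℕ → ℝ | q w ≤ q v} := fun w v =>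
    measurableSet_le (measurable_pi_apply w) (measurable_pi_apply v)
  exact (h v w).compl.union ((h w v).inter (MeasurableSet.const _))

theorem measurableSet_flagged (n : ℕ) (β : ℝ) (w : ℕ) :
    MeasurableSet {p : (ℕ → ℝ) × (ℕ → ℝ) | Flagged n β p.1 p.2 w} := by
  have : {p : (ℕ → ℝ) × (ℕ → ℝ) | Flagged n β p.1 p.2 w} =
      ⋂ v, ⋂ (_ : v < n), {p | LexLt p.1 w v}ᶜ ∪
        {p | Real.exp ((p.1 w - p.1 v) / √β) ≤ p.2 w} := by
    ext p
    simp only [Flagged, Set.mem_ofPred_eq, Set.mem_iInter, Set.mem_union, Set.mem_compl_iff]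
    exact forall₂_congr fun v _ => imp_iff_not_or
  rw [this]
  refine .iInter fun v => .iInter fun _ => .union ?_ ?_
  · exact (measurable_fst (measurableSet_lexLt w v)).compl
  · exact measurableSet_le (by fun_prop) (by fun_prop)

theorem measurable_cell (n : ℕ) (β : ℝ) (u : ℕ) :
    Measurable fun p : (ℕ → ℝ) × (ℕ → ℝ) => cell n β p.1 p.2 u := by
  classical
  have : (fun p : (ℕ → ℝ) × (ℕ → ℝ) => cell n β p.1 p.2 u) = fun p =>
      ∑ w ∈ range n, if LexLt p.1 w u ∧ Flagged n β p.1 p.2 w then 1 else 0 := by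
    funext p
    rw [cell, card_filter]
  rw [this]
  refine Finset.measurable_sum _ fun w _ => Measurable.ite ?_ measurable_const measurable_const
  exact (measurable_fst (measurableSet_lexLt w u)).inter (measurableSet_flagged n β w)

theorem measurableSet_same (n R : ℕ) (β : ℝ) (u v : ℕ) :
    MeasurableSet {p : (ℕ → ℕ → ℝ) × (ℕ → ℕ → ℝ) | Same n R β p.1 p.2 u v} := by
  simp only [Same, Set.ofPred_forall]
  refine .iInter fun k => .iInter fun _ => measurableSet_eq_fun ?_ ?_
  · exact (measurable_cell n β u).comp (by fun_prop :
      Measurable fun p : (ℕ → ℕ → ℝ) × (ℕ → ℕ → ℝ) => (p.1 k, p.2 k))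
  · exact (measurable_cell n β v).comp (by fun_prop :
      Measurable fun p : (ℕ → ℕ → ℝ) × (ℕ → ℕ → ℝ) => (p.1 k, p.2 k))

theorem measurableSet_rep_eq (n R : ℕ) (β : ℝ) {u : ℕ} (hu : u < n) (c : ℕ) :
    MeasurableSet {p : (ℕ → ℕ → ℝ) × (ℕ → ℕ → ℝ) | rep n R β p.1 p.2 u = c} := by
  simp only [← isRep_iff hu, IsRep, Set.ofPred_and, Set.ofPred_forall]
  refine (MeasurableSet.const _).inter ((measurableSet_same n R β u c).inter ?_)
  exact .iInter fun c' => .iInter fun _ => .iInter fun _ => (measurableSet_same n R β u c').compl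

end RealRAM

namespace RealRAM

open Finset MeasureTheory ProbabilityTheory
open scoped NNReal ENNReal

/-! ### Uniform samples -/

theorem iIndepFun_unifLaw :
    iIndepFun (fun (i : ℕ) (z : ℕ → unitInterval) => z i) unifLaw :=
  iIndepFun_infinitePi (X := fun _ x => x) (by fun_prop)

theorem measureReal_unif_mem (i : ℕ) {s : Set ℝ} (hs : MeasurableSet s) :
    unifLaw.real {z | (z i : ℝ) ∈ s} = volume.real (s ∩ Set.Icc 0 1) := by
  have h1 : unifLaw.map (fun z => z i) = volume := Measure.infinitePi_map_eval _ i
  have h2 : {z : ℕ → unitInterval | (z i : ℝ) ∈ s} = (fun z => z i) ⁻¹' (Subtype.val ⁻¹' s) := rfl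
  rw [h2, ← map_measureReal_apply (by fun_prop) (measurable_subtype_coe hs), h1, measureReal_def,
    measureReal_def, volume_set_coe_def, Measure.comap_apply _ Subtype.val_injective
    (fun t ht => MeasurableSet.subtype_image measurableSet_Icc ht) _
    (measurable_subtype_coe hs), Subtype.image_preimage_coe, Set.inter_comm]

theorem measureReal_unif_lt (i : ℕ) {a : ℝ} (h0 : 0 ≤ a) (h1 : a ≤ 1) :
    unifLaw.real {z | (z i : ℝ) < a} = a := by
  have := measureReal_unif_mem i (measurableSet_Iio (a := a))
  simp only [Set.mem_Iio] at this
  rw [this]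
  have h2 : Set.Iio a ∩ Set.Icc 0 1 = Set.Ico 0 a := by
    ext x
    simp only [Set.mem_inter_iff, Set.mem_Iio, Set.mem_Icc, Set.mem_Ico]
    constructor
    · rintro ⟨h, h', -⟩; exact ⟨h', h⟩
    · rintro ⟨h, h'⟩; exact ⟨h', h, by linarith⟩
  rw [h2, Real.volume_real_Ico_of_le h0, sub_zero]

theorem measureReal_unif_Ioc (i : ℕ) {a b : ℝ} (h0 : 0 ≤ a) (hab : a ≤ b) (h1 : b ≤ 1) :
    unifLaw.real {z | a < (z i : ℝ) ∧ (z i : ℝ) ≤ b} = b - a := by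
  have := measureReal_unif_mem i (measurableSet_Ioc (a := a) (b := b))
  simp only [Set.mem_Ioc] at this
  rw [this]
  have h2 : Set.Ioc a b ∩ Set.Icc 0 1 = Set.Ioc a b :=
    Set.inter_eq_left.2 fun x hx => ⟨by linarith [hx.1], by linarith [hx.2]⟩
  rw [h2, Real.volume_real_Ioc_of_le hab]

theorem measureReal_unif_le (i : ℕ) {a : ℝ} (h0 : 0 ≤ a) (h1 : a ≤ 1) :
    unifLaw.real {z | (z i : ℝ) ≤ a} = a := by
  have := measureReal_unif_mem i (measurableSet_Iic (a := a))
  simp only [Set.mem_Iic] at this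
  rw [this]
  have h2 : Set.Iic a ∩ Set.Icc 0 1 = Set.Icc 0 a := by
    ext x
    simp only [Set.mem_inter_iff, Set.mem_Iic, Set.mem_Icc]
    constructor
    · rintro ⟨h, h', -⟩; exact ⟨h', h⟩
    · rintro ⟨h, h'⟩; exact ⟨h', h, by linarith⟩
  rw [h2, Real.volume_real_Icc_of_le h0, sub_zero]

/-- The probability that pairs of vertices lie in the same cells, for fixed projections. -/
theorem measureReal_cells_eq (n : ℕ) (β : ℝ) (q : ℕ → ℕ → ℝ) {u v : ℕ → ℕ} (hu : ∀ k, u k < n)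
    (hv : ∀ k, v k < n) (s : Finset ℕ) :
    unifLaw.real {z | ∀ k ∈ s, cell n β (q k) (cutRow n z k) (u k) =
        cell n β (q k) (cutRow n z k) (v k)} =
      ∏ k ∈ s, Real.exp (-(|q k (u k) - q k (v k)| / √β)) := by
  classical
  choose B δ hB hδ hsum hcell using fun k => exists_cell_eq_iff β (q k) (hu k) (hv k)
  -- Each pair of a round and a vertex has its own uniform sample, hence the samples are
  -- independent.
  have hinj : Function.Injective fun p : ℕ × Fin n => 1 + n + p.1 * n + p.2 := by
    rintro ⟨k, j⟩ ⟨k', j'⟩ h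
    have hn : 0 < n := j.pos
    have h0 : n * k + j = n * k' + j' := by
      simp only at h
      rw [mul_comm n k, mul_comm n k']
      omega
    have h1 := congrArg (· / n) h0
    have h2 := congrArg (· % n) h0
    simp only [Nat.mul_add_div hn, Nat.mul_add_mod, Nat.div_eq_of_lt j.2,
      Nat.div_eq_of_lt j'.2, Nat.mod_eq_of_lt j.2, Nat.mod_eq_of_lt j'.2, add_zero] at h1 h2
    simp [h1, Fin.ext h2]
  have hind := iIndepFun_unifLaw.precomp hinj
  -- Samples outside `B` are unconstrained: their event is the whole interval and contributes a
  -- factor 1.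
  set A : ℕ × Fin n → Set unitInterval := fun p =>
    {t | (p.2 : ℕ) ∈ B p.1 → (t : ℝ) < Real.exp (-(δ p.1 p.2 / √β))} with hA
  have hAm : ∀ p, MeasurableSet (A p) := fun p => by
    by_cases h : (p.2 : ℕ) ∈ B p.1
    · simp only [hA, h, true_imp_iff]
      exact measurableSet_lt (by fun_prop) (by fun_prop)
    · simp [hA, h]
  have h1 := hind.measure_inter_preimage_eq_mul (s ×ˢ univ) (sets := A) fun p _ => hAm p
  have h2 : {z : ℕ → unitInterval | ∀ k ∈ s, cell n β (q k) (cutRow n z k) (u k) =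
        cell n β (q k) (cutRow n z k) (v k)} =
      ⋂ p ∈ s ×ˢ (univ : Finset (Fin n)), (fun z => z (1 + n + p.1 * n + p.2)) ⁻¹' A p := by
    ext z
    simp only [hcell, Set.mem_ofPred_eq, Set.mem_iInter, mem_product, mem_univ, and_true, hA,
      Set.mem_preimage, Prod.forall, cutRow]
    refine forall_congr' fun k => ⟨fun h w hk hw => h hk w hw, fun h hk w hw => ?_⟩
    exact h ⟨w, mem_range.1 (hB k hw)⟩ hk hw
  rw [measureReal_def, h2]
  erw [h1]
  rw [ENNReal.toReal_prod, prod_product]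
  refine prod_congr rfl fun k _ => ?_
  have h3 : ∀ w : Fin n, (unifLaw ((fun z => z (1 + n + k * n + w)) ⁻¹' A (k, w))).toReal =
      if (w : ℕ) ∈ B k then Real.exp (-(δ k w / √β)) else 1 := by
    intro w
    split_ifs with h
    · rw [← measureReal_unif_lt (1 + n + k * n + w) (Real.exp_pos (-(δ k w / √β))).le
        (Real.exp_le_one_iff.2 (neg_nonpos.2 (div_nonneg (hδ k w) (Real.sqrt_nonneg _)))),
        measureReal_def]
      congr 2
      ext z
      simp [hA, h]
    · have : (fun z : ℕ → unitInterval => z (1 + n + k * n + w)) ⁻¹' A (k, w) = Set.univ := by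
        ext z
        simp [hA, h]
      rw [this, measure_univ, ENNReal.toReal_one]
  refine (prod_congr rfl fun w _ => h3 w).trans ?_
  -- The exponentials multiply and the gaps add up to the distance of the two projections, as for a
  -- Poisson process on the line.
  rw [← prod_range (fun w => if w ∈ B k then Real.exp (-(δ k w / √β)) else 1), prod_ite_mem,
    inter_eq_right.2 (hB k), ← Real.exp_sum, ← hsum k, sum_neg_distrib, sum_div]

end RealRAM

namespace RealRAM

open Finset MeasureTheory ProbabilityTheory
open scoped NNReal ENNReal

/-! ### Independence of the samples for different purposes -/

/-- The events that depend only on the uniform samples with index in `T`. -/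
abbrev coordAlgebra (T : Set ℕ) : MeasurableSpace (ℕ → unitInterval) :=
  ⨆ i ∈ T, MeasurableSpace.comap (fun z => z i) inferInstance

theorem coordAlgebra_le (T : Set ℕ) : coordAlgebra T ≤ MeasurableSpace.pi :=
  iSup₂_le fun i _ => (measurable_pi_apply i).comap_le

theorem coordAlgebra_mono {S T : Set ℕ} (h : S ⊆ T) : coordAlgebra S ≤ coordAlgebra T :=
  biSup_mono fun _ hi => h hi

theorem measurable_coordAlgebra {T : Set ℕ} {i : ℕ} (hi : i ∈ T) :
    Measurable[coordAlgebra T] fun z : ℕ → unitInterval => z i :=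
  Measurable.of_comap_le (le_iSup₂_of_le i hi le_rfl)

theorem indep_coordAlgebra {S T : Set ℕ} (h : Disjoint S T) :
    Indep (coordAlgebra S) (coordAlgebra T) unifLaw :=
  indep_iSup_of_disjoint (fun i => (measurable_pi_apply i).comap_le)
    iIndepFun_unifLaw.iIndep h

theorem measureReal_inter_of_indep {Ω : Type*} {m₁ m₂ mΩ : MeasurableSpace Ω} {μ : Measure Ω}
    (h : Indep m₁ m₂ μ) {A B : Set Ω} (hA : MeasurableSet[m₁] A) (hB : MeasurableSet[m₂] B) :
    μ.real (A ∩ B) = μ.real A * μ.real B := by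
  rw [measureReal_def, (Indep_iff _ _ _).1 h A B hA hB, ENNReal.toReal_mul]
  rfl

/-- A random choice that is independent of the event `A` and of the random index `ρ`. -/
theorem measureReal_select {Ω κ : Type*} {m₁ m₂ mΩ : MeasurableSpace Ω} {μ : Measure Ω}
    [IsProbabilityMeasure μ] (h₁ : m₁ ≤ mΩ) (h₂ : m₂ ≤ mΩ) (h : Indep m₁ m₂ μ) {ρ : Ω → κ}
    {F : Finset κ} (hF : ∀ z, ρ z ∈ F) (hρ : ∀ c ∈ F, MeasurableSet[m₁] {z | ρ z = c})
    {Sel : κ → Set Ω} (hSel : ∀ c ∈ F, MeasurableSet[m₂] (Sel c)) {A : Set Ω}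
    (hA : MeasurableSet[m₁] A) :
    μ.real {z | z ∈ A ∧ z ∈ Sel (ρ z)} =
      ∑ c ∈ F, μ.real (A ∩ {z | ρ z = c}) * μ.real (Sel c) := by
  have h3 : {z | z ∈ A ∧ z ∈ Sel (ρ z)} = ⋃ c ∈ F, (A ∩ {z | ρ z = c}) ∩ Sel c := by
    ext z
    simp only [Set.mem_ofPred_eq, Set.mem_iUnion, Set.mem_inter_iff, exists_prop]
    constructor
    · rintro ⟨h4, h5⟩
      exact ⟨ρ z, hF z, ⟨h4, rfl⟩, h5⟩
    · rintro ⟨c, hc, ⟨h4, rfl⟩, h5⟩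
      exact ⟨h4, h5⟩
  have hm : ∀ c ∈ F, MeasurableSet[m₁] (A ∩ {z | ρ z = c}) := fun c hc => hA.inter (hρ c hc)
  rw [h3, measureReal_biUnion_finset]
  · exact sum_congr rfl fun c hc => measureReal_inter_of_indep h (hm c hc) (hSel c hc)
  · intro c _ c' _ hne
    refine Set.disjoint_left.2 fun z hz hz' => hne ?_
    exact hz.1.2.symm.trans hz'.1.2
  · exact fun c hc => (h₁ _ (hm c hc)).inter (h₂ _ (hSel c hc))

theorem measureReal_select_le {Ω κ : Type*} {m₁ m₂ mΩ : MeasurableSpace Ω} {μ : Measure Ω}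
    [IsProbabilityMeasure μ] (h₁ : m₁ ≤ mΩ) (h₂ : m₂ ≤ mΩ) (h : Indep m₁ m₂ μ) {ρ : Ω → κ}
    {F : Finset κ} (hF : ∀ z, ρ z ∈ F) (hρ : ∀ c ∈ F, MeasurableSet[m₁] {z | ρ z = c})
    {Sel : κ → Set Ω} (hSel : ∀ c ∈ F, MeasurableSet[m₂] (Sel c)) {A : Set Ω}
    (hA : MeasurableSet[m₁] A) {α : ℝ} (hα : ∀ z ∈ A, μ.real (Sel (ρ z)) ≤ α) :
    μ.real {z | z ∈ A ∧ z ∈ Sel (ρ z)} ≤ μ.real A * α := by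
  -- With a selection that always succeeds, the same identity decomposes the measure of `A` over the
  -- values of `ρ`.
  have h4 := measureReal_select h₁ h₂ h hF hρ (Sel := fun _ => Set.univ)
    (fun _ _ => MeasurableSet.univ) hA
  simp only [Set.mem_univ, and_true, Set.ofPred_mem_eq, probReal_univ, mul_one] at h4
  rw [measureReal_select h₁ h₂ h hF hρ hSel hA, h4, sum_mul]
  refine sum_le_sum fun c _ => ?_
  -- The bound on the selection is available only at values that `ρ` attains on `A`; other values
  -- contribute nothing.
  rcases (A ∩ {z | ρ z = c}).eq_empty_or_nonempty with h5 | ⟨z, hz, rfl⟩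
  · simp [h5]
  · exact mul_le_mul_of_nonneg_left (hα z hz) measureReal_nonneg

theorem measureReal_select_eq {Ω κ : Type*} {m₁ m₂ mΩ : MeasurableSpace Ω} {μ : Measure Ω}
    [IsProbabilityMeasure μ] (h₁ : m₁ ≤ mΩ) (h₂ : m₂ ≤ mΩ) (h : Indep m₁ m₂ μ) {ρ : Ω → κ}
    {F : Finset κ} (hF : ∀ z, ρ z ∈ F) (hρ : ∀ c ∈ F, MeasurableSet[m₁] {z | ρ z = c})
    {Sel : κ → Set Ω} (hSel : ∀ c ∈ F, MeasurableSet[m₂] (Sel c)) {α : ℝ}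
    (hα : ∀ c ∈ F, μ.real (Sel c) = α) :
    μ.real {z | z ∈ Sel (ρ z)} = α := by
  have h4 := measureReal_select h₁ h₂ h hF hρ (Sel := fun _ => Set.univ)
    (fun _ _ => MeasurableSet.univ) MeasurableSet.univ
  have h5 := measureReal_select h₁ h₂ h hF hρ hSel MeasurableSet.univ
  simp only [Set.mem_univ, and_true, Set.ofPred_true, probReal_univ, mul_one, true_and] at h4 h5
  rw [h5, sum_congr rfl fun c hc => by rw [hα c hc], ← sum_mul, ← h4, one_mul]

/-! ### Selection of clusters -/

/-- The probability scale. -/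
noncomputable def scale (n : ℕ) (m : ℝ) : ℝ := max (1 / n) (1 / (m + m))

theorem scale_of_le {n : ℕ} {m : ℝ} (hn : 0 < n) (h : (n : ℝ) ≤ m + m) : scale n m = 1 / n :=
  max_eq_left (one_div_le_one_div_of_le (by exact_mod_cast hn) h)

theorem scale_of_not_le {n : ℕ} {m : ℝ} (hm : 0 < m) (h : ¬ (n : ℝ) ≤ m + m) :
    scale n m = 1 / (m + m) :=
  max_eq_right (one_div_le_one_div_of_le (by linarith) (not_le.1 h).le)

theorem scale_pos {n : ℕ} {m : ℝ} (hm : 0 < m) : 0 < scale n m :=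
  lt_max_of_lt_right (by positivity)

theorem one_le_scale_mul {n : ℕ} {m : ℝ} (hm : 0 < m) : 1 ≤ scale n m * (m + m) := by
  have : 1 / (m + m) ≤ scale n m := le_max_right _ _
  rwa [div_le_iff₀ (by linarith)] at this

theorem selected_iff_of_le {n : ℕ} {m : ℝ} (hn : 0 < n) (h : (n : ℝ) ≤ m + m) {lab : ℕ → ℝ}
    {c : ℕ} : Selected n m lab c ↔ (c : ℝ) / n < lab 0 ∧ lab 0 ≤ (c + 1) / n := by
  have hn' : (0 : ℝ) < n := by exact_mod_cast hn
  rw [Selected, div_lt_iff₀ hn', le_div_iff₀ hn', mul_comm (lab 0)]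
  simp [h]

theorem selected_iff_of_not_le {n : ℕ} {m : ℝ} (hm : 0 < m) (h : ¬ (n : ℝ) ≤ m + m) {lab : ℕ → ℝ}
    {c : ℕ} : Selected n m lab c ↔ lab c ≤ 1 / (m + m) := by
  rw [Selected, le_div_iff₀ (by linarith), mul_comm (lab c)]
  simp [h]

theorem measurableSet_selected (n : ℕ) (m : ℝ) {c : ℕ} (hc : c < n) :
    MeasurableSet[coordAlgebra (Set.Icc 1 n)] {z | Selected n m (labels z) c} := by
  have h0 : Measurable[coordAlgebra (Set.Icc 1 n)] fun z => labels z 0 :=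
    measurable_subtype_coe.comp (measurable_coordAlgebra (by simp; omega))
  have h1 : Measurable[coordAlgebra (Set.Icc 1 n)] fun z => labels z c :=
    measurable_subtype_coe.comp (measurable_coordAlgebra (by simp; omega))
  have h2 : MeasurableSet {p : ℝ × ℝ | (n : ℝ) ≤ m + m ∧ ((c : ℝ) < n * p.1 ∧ n * p.1 ≤ c + 1) ∨
    ¬ (n : ℝ) ≤ m + m ∧ (m + m) * p.2 ≤ 1} := by
    simp only [Set.ofPred_or, Set.ofPred_and]
    exact ((MeasurableSet.const _).inter ((measurableSet_lt (by fun_prop) (by fun_prop)).inter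
      (measurableSet_le (by fun_prop) (by fun_prop)))).union
      ((MeasurableSet.const _).inter (measurableSet_le (by fun_prop) (by fun_prop)))
  exact (h0.prodMk h1) h2

theorem measureReal_selected {n : ℕ} {m : ℝ} (hm : 2 ≤ m) {c : ℕ} (hc : c < n) :
    unifLaw.real {z | Selected n m (labels z) c} = scale n m := by
  have hn : 0 < n := by omega
  have hn' : (0 : ℝ) < n := by exact_mod_cast hn
  by_cases h : (n : ℝ) ≤ m + m
  · simp only [selected_iff_of_le hn h, labels]
    rw [measureReal_unif_Ioc, scale_of_le hn h]
    · ring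
    · positivity
    · gcongr
      linarith
    · rw [div_le_one hn']
      exact_mod_cast hc
  · simp only [selected_iff_of_not_le (by linarith : 0 < m) h, labels]
    rw [measureReal_unif_le, scale_of_not_le (by linarith) h]
    · have : 0 < m + m := by linarith
      positivity
    · rw [div_le_one (by linarith)]
      linarith

/-- For `n ≤ 2m` the intervals belonging to different labels are disjoint, so the event is empty.
Otherwise the two selections read different samples and are independent. -/
theorem measureReal_selected_inter_le {n : ℕ} {m : ℝ} (hm : 2 ≤ m) {c c' : ℕ} (hc : c < n)
    (hc' : c' < n) (hne : c ≠ c') :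
    unifLaw.real ({z | Selected n m (labels z) c} ∩ {z | Selected n m (labels z) c'}) ≤
      scale n m * (1 / (m + m)) := by
  have hn : 0 < n := by omega
  have hn' : (0 : ℝ) < n := by exact_mod_cast hn
  by_cases h : (n : ℝ) ≤ m + m
  · have hempty : {z | Selected n m (labels z) c} ∩ {z | Selected n m (labels z) c'} = ∅ := by
      ext z
      simp only [Set.mem_inter_iff, Set.mem_ofPred_eq, selected_iff_of_le hn h,
        Set.mem_empty_iff_false, iff_false]
      rintro ⟨⟨h1, h2⟩, h3, h4⟩
      have h5 := h1.trans_le h4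
      have h6 := h3.trans_le h2
      rw [div_lt_div_iff_of_pos_right hn'] at h5 h6
      norm_cast at h5 h6
      omega
    rw [hempty, measureReal_empty]
    exact mul_nonneg (scale_pos (by linarith)).le (div_nonneg zero_le_one (by linarith))
  · have hS : ∀ c, MeasurableSet[coordAlgebra {1 + c}] {z | labels z c ≤ 1 / (m + m)} := fun c =>
      (measurable_subtype_coe.comp (measurable_coordAlgebra (Set.mem_singleton (1 + c))))
        measurableSet_Iic
    have hind : Indep (coordAlgebra {1 + c}) (coordAlgebra {1 + c'}) unifLaw :=
      indep_coordAlgebra (Set.disjoint_singleton.2 (by omega))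
    have h1 := measureReal_selected hm hc
    have h2 := measureReal_selected hm hc'
    simp only [selected_iff_of_not_le (by linarith : 0 < m) h] at h1 h2 ⊢
    rw [measureReal_inter_of_indep hind (hS c) (hS c'), h1, h2, scale_of_not_le (by linarith) h]

end RealRAM

namespace RealRAM

open Finset MeasureTheory ProbabilityTheory
open scoped NNReal ENNReal

/-! ### The random set for fixed projections -/

theorem measurableSet_select {Ω κ : Type*} {m : MeasurableSpace Ω} {ρ : Ω → κ}
    {F : Finset κ} (hF : ∀ z, ρ z ∈ F) (hρ : ∀ c ∈ F, MeasurableSet {z | ρ z = c})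
    {Sel : κ → Set Ω} (hSel : ∀ c ∈ F, MeasurableSet (Sel c)) :
    MeasurableSet {z | z ∈ Sel (ρ z)} := by
  have h : {z | z ∈ Sel (ρ z)} = ⋃ c ∈ F, {z | ρ z = c} ∩ Sel c := by
    ext z
    simp only [Set.mem_ofPred_eq, Set.mem_iUnion, Set.mem_inter_iff, exists_prop]
    constructor
    · exact fun h => ⟨ρ z, hF z, rfl, h⟩
    · rintro ⟨c, hc, rfl, h⟩
      exact h
  rw [h]
  exact F.measurableSet_biUnion fun c hc => (hρ c hc).inter (hSel c hc)

theorem measurable_cutRow (n : ℕ) :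
    Measurable[coordAlgebra (Set.Ioi n)] fun z : ℕ → unitInterval => cutRow n z := by
  refine @measurable_pi_lambda _ _ _ (coordAlgebra (Set.Ioi n)) _ _ fun k =>
    @measurable_pi_lambda _ _ _ (coordAlgebra (Set.Ioi n)) _ _ fun w => ?_
  exact measurable_subtype_coe.comp (measurable_coordAlgebra (by simp; omega))

section

variable {n R : ℕ} {m β : ℝ} {q : ℕ → ℕ → ℝ}

theorem measurableSet_same_cutRow (u v : ℕ) :
    MeasurableSet[coordAlgebra (Set.Ioi n)] {z | Same n R β q (cutRow n z) u v} :=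
  (measurable_const.prodMk (measurable_cutRow n)) (measurableSet_same n R β u v)

theorem measurableSet_rep_cutRow {u : ℕ} (hu : u < n) (c : ℕ) :
    MeasurableSet[coordAlgebra (Set.Ioi n)] {z | rep n R β q (cutRow n z) u = c} :=
  (measurable_const.prodMk (measurable_cutRow n)) (measurableSet_rep_eq n R β hu c)

theorem indep_cuts_labels :
    Indep (coordAlgebra (Set.Ioi n)) (coordAlgebra (Set.Icc 1 n)) unifLaw :=
  indep_coordAlgebra (Set.disjoint_left.2 fun _ h h' => h'.2.not_gt h)

/-- The cluster of `u` is selected. -/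
def SelectedRep (n R : ℕ) (m β : ℝ) (q : ℕ → ℕ → ℝ) (u : ℕ) (z : ℕ → unitInterval) : Prop :=
  Selected n m (labels z) (rep n R β q (cutRow n z) u)

theorem measurableSet_selectedRep {u : ℕ} (hu : u < n) :
    MeasurableSet[coordAlgebra (Set.Ici 1)] {z | SelectedRep n R m β q u z} := by
  refine measurableSet_select (m := coordAlgebra (Set.Ici 1))
    (ρ := fun z => rep n R β q (cutRow n z) u) (F := range n)
    (Sel := fun c => {z | Selected n m (labels z) c}) (fun z => mem_range.2 (rep_lt hu))
    (fun c _ => ?_) (fun c hc => ?_)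
  · refine coordAlgebra_mono ?_ _ (measurableSet_rep_cutRow hu c)
    exact fun i hi => Nat.one_le_of_lt hi
  · refine coordAlgebra_mono ?_ _ (measurableSet_selected n m (mem_range.1 hc))
    exact fun i hi => hi.1

theorem measurableSet_unif_le (a : ℝ) :
    MeasurableSet[coordAlgebra {0}] {z : ℕ → unitInterval | (z 0 : ℝ) ≤ a} :=
  (measurable_subtype_coe.comp (measurable_coordAlgebra (Set.mem_singleton 0))) measurableSet_Iic

theorem measurableSet_unif_Ioc (a b : ℝ) :
    MeasurableSet[coordAlgebra {0}] {z : ℕ → unitInterval | a < (z 0 : ℝ) ∧ (z 0 : ℝ) ≤ b} :=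
  (measurable_subtype_coe.comp (measurable_coordAlgebra (Set.mem_singleton 0))) measurableSet_Ioc

theorem indep_threshold : Indep (coordAlgebra {0}) (coordAlgebra (Set.Ici 1)) unifLaw :=
  indep_coordAlgebra (by simp)

theorem measureReal_selectedRep (hm : 2 ≤ m) {u : ℕ} (hu : u < n) :
    unifLaw.real {z | SelectedRep n R m β q u z} = scale n m :=
  measureReal_select_eq (coordAlgebra_le _) (coordAlgebra_le _) indep_cuts_labels
    (ρ := fun z => rep n R β q (cutRow n z) u) (F := range n)
    (Sel := fun c => {z | Selected n m (labels z) c}) (fun _ => mem_range.2 (rep_lt hu))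
    (fun c _ => measurableSet_rep_cutRow hu c)
    (fun _ hc => measurableSet_selected n m (mem_range.1 hc))
    fun _ hc => measureReal_selected hm (mem_range.1 hc)

theorem measureReal_mem (hm : 2 ≤ m) {u : ℕ} (hu : u < n) {a : ℝ} (h0 : 0 ≤ a) (h1 : a ≤ 1) :
    unifLaw.real {z | (z 0 : ℝ) ≤ a ∧ SelectedRep n R m β q u z} = a * scale n m := by
  have h := measureReal_inter_of_indep indep_threshold (measurableSet_unif_le a)
    (measurableSet_selectedRep (R := R) (m := m) (β := β) (q := q) hu)
  rw [measureReal_selectedRep hm hu, measureReal_unif_le 0 h0 h1] at h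
  exact h

/-- Split according to whether `u` and `v` share a cluster. If they do, a single selection costs the
scale; if not, two distinct labels are selected, which costs another factor `1 / (2m)`. -/
theorem measureReal_selectedRep_inter_le (hm : 2 ≤ m) {u v : ℕ} (hu : u < n) (hv : v < n) :
    unifLaw.real {z | SelectedRep n R m β q u z ∧ SelectedRep n R m β q v z} ≤
      scale n m * (unifLaw.real {z | Same n R β q (cutRow n z) u v} + 1 / (m + m)) := by
  have hA := measurableSet_same_cutRow (n := n) (R := R) (β := β) (q := q) u v
  set A := {z | Same n R β q (cutRow n z) u v}
  set ρ : (ℕ → unitInterval) → ℕ × ℕ := fun z =>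
    (rep n R β q (cutRow n z) u, rep n R β q (cutRow n z) v)
  set Sel : ℕ × ℕ → Set (ℕ → unitInterval) := fun p =>
    {z | Selected n m (labels z) p.1} ∩ {z | Selected n m (labels z) p.2}
  have hF : ∀ z, ρ z ∈ range n ×ˢ range n := fun z =>
    mem_product.2 ⟨mem_range.2 (rep_lt hu), mem_range.2 (rep_lt hv)⟩
  have hρ : ∀ c ∈ range n ×ˢ range n,
      MeasurableSet[coordAlgebra (Set.Ioi n)] {z | ρ z = c} := fun c _ => by
    simp only [ρ, Prod.ext_iff, Set.ofPred_and]
    exact (measurableSet_rep_cutRow hu c.1).inter (measurableSet_rep_cutRow hv c.2)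
  have hSel : ∀ c ∈ range n ×ˢ range n,
      MeasurableSet[coordAlgebra (Set.Icc 1 n)] (Sel c) := fun c hc =>
    (measurableSet_selected n m (mem_range.1 (mem_product.1 hc).1)).inter
      (measurableSet_selected n m (mem_range.1 (mem_product.1 hc).2))
  have h1 := measureReal_select_le (coordAlgebra_le _) (coordAlgebra_le _) indep_cuts_labels hF hρ
    hSel hA (α := scale n m) fun z _ => by
      rw [← measureReal_selected hm (rep_lt (R := R) (β := β) (q := q) (y := cutRow n z) hu)]
      exact measureReal_mono Set.inter_subset_left
  have h2 := measureReal_select_le (coordAlgebra_le _) (coordAlgebra_le _) indep_cuts_labels hF hρ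
    hSel hA.compl (α := scale n m * (1 / (m + m))) fun z hz =>
      measureReal_selected_inter_le hm (rep_lt hu) (rep_lt hv) fun h =>
        hz ((rep_eq_rep_iff hu hv).1 h)
  have h3 : {z | SelectedRep n R m β q u z ∧ SelectedRep n R m β q v z} ⊆
      {z | z ∈ A ∧ z ∈ Sel (ρ z)} ∪ {z | z ∈ Aᶜ ∧ z ∈ Sel (ρ z)} := by
    intro z hz
    by_cases hzA : z ∈ A
    exacts [Or.inl ⟨hzA, hz⟩, Or.inr ⟨hzA, hz⟩]
  have h4 : unifLaw.real Aᶜ * (scale n m * (1 / (m + m))) ≤ scale n m * (1 / (m + m)) :=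
    mul_le_of_le_one_left (mul_nonneg (scale_pos (by linarith)).le
      (div_nonneg zero_le_one (by linarith))) measureReal_le_one
  have h5 := (measureReal_mono h3 (measure_ne_top unifLaw _)).trans (measureReal_union_le _ _)
  linarith

/-- Both vertices use the same threshold, so the two threshold conditions combine to the minimum
rather than to the product. -/
theorem measureReal_mem_mem_le (hm : 2 ≤ m) {u v : ℕ} (hu : u < n) (hv : v < n) {a b : ℝ}
    (h0 : 0 ≤ min a b) (h1 : min a b ≤ 1) :
    unifLaw.real {z | ((z 0 : ℝ) ≤ a ∧ SelectedRep n R m β q u z) ∧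
        (z 0 : ℝ) ≤ b ∧ SelectedRep n R m β q v z} ≤ min a b * (scale n m *
      (unifLaw.real {z | Same n R β q (cutRow n z) u v} + 1 / (m + m))) := by
  have h2 : {z : ℕ → unitInterval | ((z 0 : ℝ) ≤ a ∧ SelectedRep n R m β q u z) ∧
        (z 0 : ℝ) ≤ b ∧ SelectedRep n R m β q v z} = {z | (z 0 : ℝ) ≤ min a b} ∩
        ({z | SelectedRep n R m β q u z} ∩ {z | SelectedRep n R m β q v z}) := by
    ext z
    simp only [Set.mem_ofPred_eq, Set.mem_inter_iff, le_min_iff]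
    tauto
  rw [h2, measureReal_inter_of_indep indep_threshold (measurableSet_unif_le _)
    ((measurableSet_selectedRep hu).inter (measurableSet_selectedRep hv)),
    measureReal_unif_le 0 h0 h1]
  exact mul_le_mul_of_nonneg_left (measureReal_selectedRep_inter_le hm hu hv) h0

/-- An edge inside one cluster is selected as a whole, so only a threshold between `a` and `b` can
cut it, and the cluster of `u₀` must be selected. An edge that meets several clusters can be cut
only if the threshold is at most `b`. -/
theorem measureReal_cut_le (hm : 2 ≤ m) {e : Finset ℕ} (hen : ∀ u ∈ e, u < n) {u₀ : ℕ}
    (hu₀ : u₀ ∈ e) {N : ℕ → ℝ} {a b : ℝ} (ha : ∀ u ∈ e, a ≤ N u) (hb : ∀ u ∈ e, N u ≤ b)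
    (h0 : 0 ≤ a) (h1 : b ≤ 1) :
    unifLaw.real {z | (∃ u ∈ e, (z 0 : ℝ) ≤ N u ∧ SelectedRep n R m β q u z) ∧
        ∃ v ∈ e, ¬ ((z 0 : ℝ) ≤ N v ∧ SelectedRep n R m β q v z)} ≤
      (b - a) * scale n m +
        b * unifLaw.real {z | ∃ u ∈ e, ¬ Same n R β q (cutRow n z) u u₀} := by
  have hab : a ≤ b := (ha u₀ hu₀).trans (hb u₀ hu₀)
  have hsep : MeasurableSet[coordAlgebra (Set.Ici 1)]
      {z | ∃ u ∈ e, ¬ Same n R β q (cutRow n z) u u₀} := by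
    have : {z | ∃ u ∈ e, ¬ Same n R β q (cutRow n z) u u₀} =
        ⋃ u ∈ e, {z | Same n R β q (cutRow n z) u u₀}ᶜ := by
      ext z
      simp
    rw [this]
    refine coordAlgebra_mono (S := Set.Ioi n) (fun i hi => Nat.one_le_of_lt hi) _ ?_
    exact e.measurableSet_biUnion fun u _ => (measurableSet_same_cutRow u u₀).compl
  have h2 : {z | (∃ u ∈ e, (z 0 : ℝ) ≤ N u ∧ SelectedRep n R m β q u z) ∧
        ∃ v ∈ e, ¬ ((z 0 : ℝ) ≤ N v ∧ SelectedRep n R m β q v z)} ⊆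
      ({z | a < (z 0 : ℝ) ∧ (z 0 : ℝ) ≤ b} ∩ {z | SelectedRep n R m β q u₀ z}) ∪
      ({z | (z 0 : ℝ) ≤ b} ∩ {z | ∃ u ∈ e, ¬ Same n R β q (cutRow n z) u u₀}) := by
    rintro z ⟨⟨u, hu, hzu, hsu⟩, v, hv, hzv⟩
    have hzb : (z 0 : ℝ) ≤ b := hzu.trans (hb u hu)
    by_cases hs : ∃ u ∈ e, ¬ Same n R β q (cutRow n z) u u₀
    · exact Or.inr ⟨hzb, hs⟩
    · push Not at hs
      have hrep : ∀ w ∈ e, SelectedRep n R m β q w z ↔ SelectedRep n R m β q u₀ z := fun w hw => by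
        rw [SelectedRep, SelectedRep, (rep_eq_rep_iff (hen w hw) (hen u₀ hu₀)).2 (hs w hw)]
      refine Or.inl ⟨⟨?_, hzb⟩, (hrep u hu).1 hsu⟩
      by_contra hza
      exact hzv ⟨(not_lt.1 hza).trans (ha v hv), (hrep v hv).2 ((hrep u hu).1 hsu)⟩
  refine ((measureReal_mono h2 (measure_ne_top unifLaw _)).trans (measureReal_union_le _ _)).trans_eq ?_
  rw [measureReal_inter_of_indep indep_threshold (measurableSet_unif_Ioc a b)
    (measurableSet_selectedRep (hen u₀ hu₀)), measureReal_selectedRep hm (hen u₀ hu₀),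
    measureReal_inter_of_indep indep_threshold (measurableSet_unif_le b) hsep,
    measureReal_unif_le 0 (h0.trans hab) h1, measureReal_unif_Ioc 0 h0 hab h1]

theorem measureReal_same {u v : ℕ} (hu : u < n) (hv : v < n) :
    unifLaw.real {z | Same n R β q (cutRow n z) u v} =
      ∏ k ∈ range R, Real.exp (-(|q k u - q k v| / √β)) := by
  rw [← measureReal_cells_eq n β q (u := fun _ => u) (v := fun _ => v) (fun _ => hu) (fun _ => hv)]
  simp only [Same, mem_range]

/-- A set of points on the line is separated in a round exactly when its two extreme points are, so
there is no union bound over `e`. The extremes are at distance at most `2 * M k`, and `1 - exp (-t)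
≤ t`. -/
theorem measureReal_separated_le {e : Finset ℕ} (hen : ∀ u ∈ e, u < n) {u₀ : ℕ}
    (hu₀ : u₀ ∈ e) {M : ℕ → ℝ} (hM : ∀ k, ∀ u ∈ e, |q k u - q k u₀| ≤ M k) :
    unifLaw.real {z | ∃ u ∈ e, ¬ Same n R β q (cutRow n z) u u₀} ≤
      ∑ k ∈ range R, 2 * M k / √β := by
  choose lo hlo hlo' using fun k =>
    exists_min_image e (fun v => toLex (q k v, v)) ⟨u₀, hu₀⟩
  choose hi hhi hhi' using fun k =>
    exists_max_image e (fun v => toLex (q k v, v)) ⟨u₀, hu₀⟩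
  have hround : ∀ k, unifLaw.real {z | ¬ cell n β (q k) (cutRow n z k) (lo k) =
      cell n β (q k) (cutRow n z k) (hi k)} ≤ 2 * M k / √β := by
    intro k
    have h1 := measureReal_cells_eq n β q (fun k => hen _ (hlo k)) (fun k => hen _ (hhi k)) {k}
    simp only [mem_singleton, forall_eq, prod_singleton] at h1
    have hmeas : MeasurableSet {z | cell n β (q k) (cutRow n z k) (lo k) =
        cell n β (q k) (cutRow n z k) (hi k)} := by
      have hc : Measurable fun z : ℕ → unitInterval => (q k, cutRow n z k) := by
        unfold cutRow
        fun_prop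
      exact measurableSet_eq_fun ((measurable_cell n β (lo k)).comp hc)
        ((measurable_cell n β (hi k)).comp hc)
    have h2 := probReal_compl_eq_one_sub (μ := unifLaw) hmeas
    rw [h1] at h2
    refine h2.trans_le ?_
    have h3 := Real.add_one_le_exp (-(|q k (lo k) - q k (hi k)| / √β))
    have h4 : |q k (lo k) - q k (hi k)| ≤ 2 * M k := by
      have := abs_sub_le (q k (lo k)) (q k u₀) (q k (hi k))
      rw [abs_sub_comm (q k u₀)] at this
      linarith [hM k _ (hlo k), hM k _ (hhi k)]
    have h5 := div_le_div_of_nonneg_right h4 (Real.sqrt_nonneg β)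
    linarith
  have hsub : {z | ∃ u ∈ e, ¬ Same n R β q (cutRow n z) u u₀} ⊆
      ⋃ k ∈ range R, {z | ¬ cell n β (q k) (cutRow n z k) (lo k) =
        cell n β (q k) (cutRow n z k) (hi k)} := by
    rintro z ⟨u, hu, hsep⟩
    simp only [Same, not_forall] at hsep
    obtain ⟨k, hk, hne⟩ := hsep
    refine Set.mem_biUnion (mem_range.2 hk) fun heq => hne ?_
    have hmid : ∀ w ∈ e, cell n β (q k) (cutRow n z k) w =
        cell n β (q k) (cutRow n z k) (lo k) := fun w hw => by
      refine le_antisymm ((cell_le_cell ?_).trans_eq heq.symm) (cell_le_cell ?_)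
      · exact fun h => (hhi' k w hw).not_gt (lexLt_iff.1 h)
      · exact fun h => (hlo' k w hw).not_gt (lexLt_iff.1 h)
    rw [hmid u hu, hmid u₀ hu₀]
  exact (measureReal_mono hsub (measure_ne_top unifLaw _)).trans ((measureReal_biUnion_finset_le _ _).trans
    (sum_le_sum fun k _ => hround k))

end

end RealRAM

namespace RealRAM

open Finset MeasureTheory ProbabilityTheory
open scoped NNReal ENNReal

/-! ### Projections of the given vectors -/

/-- The coordinates of the vectors. -/
noncomputable def coords {n d : ℕ} (x : Fin n → EuclideanSpace ℝ (Fin d)) (i j : ℕ) : ℝ :=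
  if h : i < n ∧ j < d then x ⟨i, h.1⟩ ⟨j, h.2⟩ else 0

theorem input_real_zero {n d : ℕ} (x : Fin n → EuclideanSpace ℝ (Fin d)) (m β : ℝ) :
    (input x m β).real 0 = coords x := by
  funext i j
  simp [input, coords]

/-- The projections of the normalized vectors. -/
noncomputable def projections {n d : ℕ} (x : Fin n → EuclideanSpace ℝ (Fin d)) (g : ℕ → ℝ)
    (k u : ℕ) : ℝ := proj d (coords x) (gaussRow d g k) u

section

variable {n d : ℕ} {x : Fin n → EuclideanSpace ℝ (Fin d)}

theorem sum_coords_mul_self (u : Fin n) :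
    ∑ j ∈ range d, coords x u j * coords x u j = ‖x u‖ ^ 2 := by
  rw [EuclideanSpace.real_norm_sq_eq, sum_range]
  refine sum_congr rfl fun j _ => ?_
  simp [coords, sq]

/-- The normalized vectors. -/
noncomputable def normalized (x : Fin n → EuclideanSpace ℝ (Fin d)) (u : Fin n) :
    EuclideanSpace ℝ (Fin d) := ‖x u‖⁻¹ • x u

theorem projections_sub (g : ℕ → ℝ) (k : ℕ) (u v : Fin n) :
    projections x g k u - projections x g k v = ∑ j ∈ range d, gaussRow d g k j *
      (coords x u j / ‖x u‖ - coords x v j / ‖x v‖) := by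
  simp only [projections, proj, sum_coords_mul_self, Real.sqrt_sq (norm_nonneg _), sum_div,
    ← sum_sub_distrib]
  exact sum_congr rfl fun j _ => by ring

/-- The variance of a difference of projections. -/
noncomputable def projVar (x : Fin n → EuclideanSpace ℝ (Fin d)) (u v : Fin n) : ℝ≥0 :=
  ∑ j ∈ range d, NNReal.mk ((coords x u j / ‖x u‖ - coords x v j / ‖x v‖) ^ 2) (sq_nonneg _)

theorem coe_projVar (u v : Fin n) :
    (projVar x u v : ℝ) = ‖normalized x u - normalized x v‖ ^ 2 := by
  rw [EuclideanSpace.real_norm_sq_eq, projVar, NNReal.coe_sum, sum_range]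
  refine sum_congr rfl fun j _ => ?_
  simp [coords, normalized, div_eq_inv_mul]

theorem map_projections_sub (k : ℕ) (u v : Fin n) :
    gaussLaw.map (fun g => projections x g k u - projections x g k v) =
      gaussianReal 0 (projVar x u v) := by
  simp only [projections_sub]
  exact map_gaussRow d k fun j => coords x u j / ‖x u‖ - coords x v j / ‖x v‖

@[fun_prop]
theorem measurable_projections (x : Fin n → EuclideanSpace ℝ (Fin d)) :
    Measurable (projections x) := by
  refine measurable_pi_lambda _ fun k => measurable_pi_lambda _ fun u => ?_
  unfold projections proj gaussRow
  fun_prop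

theorem measurable_projections_apply (k u : ℕ) : Measurable fun g => projections x g k u :=
  (measurable_pi_apply u).comp ((measurable_pi_apply k).comp (measurable_projections x))

/-! ### Geometry of the normalized vectors -/

/-- The difference splits into a rescaled `x u - x v` and a change of length; each has norm at most
`D / a`. -/
theorem norm_normalized_sub_le {u v : Fin n} {a D : ℝ} (ha : 0 < a) (hu : a ≤ ‖x u‖)
    (hv : a ≤ ‖x v‖) (hD : ‖x u - x v‖ ≤ D) :
    ‖normalized x u - normalized x v‖ ≤ 2 * D / a := by
  have hu0 : 0 < ‖x u‖ := ha.trans_le hu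
  have hv0 : 0 < ‖x v‖ := ha.trans_le hv
  have h1 : normalized x u - normalized x v =
      ‖x u‖⁻¹ • (x u - x v) + (‖x u‖⁻¹ - ‖x v‖⁻¹) • x v := by
    simp only [normalized]
    module
  have h2 : |‖x u‖⁻¹ - ‖x v‖⁻¹| * ‖x v‖ = |‖x v‖ - ‖x u‖| / ‖x u‖ := by
    have h3 : ‖x u‖⁻¹ - ‖x v‖⁻¹ = (‖x v‖ - ‖x u‖) / (‖x u‖ * ‖x v‖) := by field_simp
    rw [h3, abs_div, abs_of_pos (mul_pos hu0 hv0)]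
    field_simp
  rw [h1]
  refine (norm_add_le _ _).trans ?_
  rw [norm_smul, norm_smul, norm_inv, norm_norm, Real.norm_eq_abs, h2]
  have h3 : |‖x v‖ - ‖x u‖| ≤ D := (abs_norm_sub_norm_le _ _).trans (by rwa [norm_sub_rev])
  have hD0 : 0 ≤ D := (norm_nonneg _).trans hD
  calc ‖x u‖⁻¹ * ‖x u - x v‖ + |‖x v‖ - ‖x u‖| / ‖x u‖
      ≤ ‖x u‖⁻¹ * D + D / ‖x u‖ := by gcongr
    _ = 2 * D / ‖x u‖ := by ring
    _ ≤ 2 * D / a := by gcongr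

/-- This is the squared triangle inequality through the origin, which `inner_le` encodes. It makes
squared lengths vary by at most the squared diameter on an edge. -/
theorem sq_norm_le_add (hx : SatisfiesL22Triangle x) (u v : Fin n) :
    ‖x u‖ ^ 2 ≤ ‖x v‖ ^ 2 + ‖x u - x v‖ ^ 2 := by
  have h1 := hx.inner_le v u
  rw [norm_sub_sq_real, real_inner_comm]
  linarith

/-- Normalization could destroy separation only for vectors that differ mainly in length. Then `⟪x
u, x v⟫ ≤ ‖x u‖ ^ 2` with `x u` the shorter vector still bounds the cosine away from 1. -/
theorem norm_normalized_sub_ge (hx : SatisfiesL22Triangle x) {β : ℝ} (hβ : 0 < β) (hβ1 : β < 1)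
    {u v : Fin n} (hu : 0 < ‖x u‖) (hv : 0 < ‖x v‖)
    (h : β * min (‖x u‖ ^ 2) (‖x v‖ ^ 2) ≤ ‖x u - x v‖ ^ 2) :
    √β / 2 ≤ ‖normalized x u - normalized x v‖ := by
  wlog huv : ‖x u‖ ≤ ‖x v‖ generalizing u v
  · rw [norm_sub_rev]
    exact this hv hu (by rwa [min_comm, norm_sub_rev]) (le_of_not_ge huv)
  rw [min_eq_left (by gcongr), norm_sub_sq_real] at h
  have h1 := hx.inner_le u v
  have h2 : ‖normalized x u - normalized x v‖ ^ 2 =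
      2 - 2 * (inner ℝ (x u) (x v) / (‖x u‖ * ‖x v‖)) := by
    have hn : ∀ w, 0 < ‖x w‖ → ‖normalized x w‖ = 1 := fun w hw => by
      rw [normalized, norm_smul, norm_inv, norm_norm, inv_mul_cancel₀ hw.ne']
    rw [norm_sub_sq_real, hn u hu, hn v hv, normalized, normalized, real_inner_smul_left,
      real_inner_smul_right]
    field_simp
    ring
  set a := ‖x u‖
  set b := ‖x v‖
  set c := inner ℝ (x u) (x v)
  have h3 : c / (a * b) ≤ 1 - β / 8 := by
    rw [div_le_iff₀ (mul_pos hu hv)]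
    -- If the lengths differ clearly, the cosine is at most `a / b ≤ 1 - β / 8`. If they are
    -- comparable, the distance hypothesis gives `c ≤ (1 - β / 4) * a ^ 2`.
    rcases le_or_gt (a ^ 2 * (1 + β / 2)) (b ^ 2) with h4 | h4
    · have h5 : a ≤ (1 - β / 8) * b := by
        refine (sq_le_sq₀ hu.le (mul_nonneg (by linarith) hv.le)).1 ?_
        have h6 : (1 - β / 8) ^ 2 * (a ^ 2 * (1 + β / 2)) ≤ (1 - β / 8) ^ 2 * b ^ 2 := by gcongr
        have h7 : 1 ≤ (1 - β / 8) ^ 2 * (1 + β / 2) := by nlinarith [sq_nonneg β]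
        nlinarith [sq_nonneg a]
      nlinarith
    · have h5 : c ≤ (1 - β / 4) * a ^ 2 := by nlinarith
      have h6 : a ^ 2 ≤ a * b := by nlinarith
      nlinarith
  refine (sq_le_sq₀ (by positivity) (norm_nonneg _)).1 ?_
  rw [h2, div_pow, Real.sq_sqrt hβ.le]
  linarith

end

end RealRAM

namespace RealRAM

open Finset MeasureTheory ProbabilityTheory
open scoped NNReal ENNReal

/-! ### The random set -/

/-- Fubini: the uniform samples are integrated first, for fixed Gaussian samples. -/
theorem tapeLaw_real_eq {s : Set Tape} (hs : MeasurableSet s) :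
    tapeLaw.real s = ∫ g, unifLaw.real {z | (z, g) ∈ s} ∂gaussLaw := by
  rw [measureReal_def, tapeLaw_eq, Measure.prod_apply_symm hs]
  exact (integral_toReal (measurable_measure_prodMk_right hs).aemeasurable
    (.of_forall fun g => measure_lt_top _ _)).symm

section

variable {n d : ℕ} (x : Fin n → EuclideanSpace ℝ (Fin d)) (R : ℕ) (m β : ℝ)

/-- The vertex `u` belongs to the random set. -/
def InSet (ω : Tape) (u : Fin n) : Prop :=
  (ω.1 0 : ℝ) ≤ ‖x u‖ ^ 2 ∧ SelectedRep n R m β (projections x ω.2) u ω.1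

theorem member_iff (ω : Tape) (u : Fin n) :
    Member n d R m β ((input x m β).real 0) ω u ↔ InSet x R m β ω u := by
  rw [input_real_zero, Member, InSet, sum_coords_mul_self, SelectedRep]
  refine and_congr_right fun _ => ?_
  simp only [isRep_iff u.2]
  exact ⟨fun ⟨c, hc, hs⟩ => hc ▸ hs, fun h => ⟨_, rfl, h⟩⟩

theorem measurableSet_inSet (u : Fin n) : MeasurableSet {ω | InSet x R m β ω u} := by
  have h1 : Measurable fun ω : Tape => (projections x ω.2, cutRow n ω.1) := by
    refine ((measurable_projections x).comp measurable_snd).prodMk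
      (measurable_pi_lambda _ fun k => measurable_pi_lambda _ fun w => ?_)
    unfold cutRow
    fun_prop
  have h2 : MeasurableSet {ω : Tape | SelectedRep n R m β (projections x ω.2) u ω.1} := by
    refine measurableSet_select (ρ := fun ω : Tape => rep n R β (projections x ω.2) (cutRow n ω.1) u)
      (F := range n) (Sel := fun c => {ω | Selected n m (labels ω.1) c})
      (fun _ => mem_range.2 (rep_lt u.2)) (fun c _ => h1 (measurableSet_rep_eq n R β u.2 c))
      fun c hc => ?_
    exact measurable_fst (coordAlgebra_le _ _ (measurableSet_selected n m (mem_range.1 hc)))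
  refine MeasurableSet.inter (s₁ := {ω : Tape | (ω.1 0 : ℝ) ≤ ‖x u‖ ^ 2}) ?_ h2
  exact measurableSet_le (by fun_prop) (by fun_prop)

open Classical in
/-- The random set. -/
noncomputable def separator (ω : Tape) : Finset (Fin n) := univ.filter fun u => InSet x R m β ω u

variable {x R m β}

theorem mem_separator {ω : Tape} {u : Fin n} : u ∈ separator x R m β ω ↔ InSet x R m β ω u := by
  simp [separator]

theorem prob_mem_separator (hx1 : ∀ u, ‖x u‖ ≤ 1) (hm : 2 ≤ m) (u : Fin n) :
    tapeLaw.real {ω | u ∈ separator x R m β ω} = scale n m * ‖x u‖ ^ 2 := by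
  simp only [mem_separator]
  rw [tapeLaw_real_eq (measurableSet_inSet x R m β u)]
  have h : ∀ g, unifLaw.real {z | (z, g) ∈ {ω | InSet x R m β ω u}} = ‖x u‖ ^ 2 * scale n m :=
    fun g => by
      simp only [Set.mem_ofPred_eq, InSet]
      exact measureReal_mem hm u.2 (sq_nonneg _) (pow_le_one₀ (norm_nonneg _) (hx1 u))
  simp only [h, integral_const, probReal_univ, one_smul]
  ring

/-- The rounds are independent, and the separation `√β / 2` cancels the rate `1 / √β`, so each
factor is at most a constant independent of `β`. -/
theorem integral_same_le (hx : SatisfiesL22Triangle x) (hβ : 0 < β) (hβ1 : β < 1) {u v : Fin n}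
    (hu : 0 < ‖x u‖) (hv : 0 < ‖x v‖)
    (h : β * min (‖x u‖ ^ 2) (‖x v‖ ^ 2) ≤ ‖x u - x v‖ ^ 2) :
    ∫ g, ∏ k ∈ range R, Real.exp (-(|projections x g k u - projections x g k v| / √β)) ∂gaussLaw
      ≤ gaussDecay ^ R := by
  have h1 := integral_prod_gaussRow d R (fun j => coords x u j / ‖x u‖ - coords x v j / ‖x v‖)
    (φ := fun t => Real.exp (-(|t| / √β))) (by fun_prop)
  simp only [← projections_sub] at h1
  rw [h1]
  refine (prod_le_prod (fun k _ => integral_nonneg fun _ => (Real.exp_pos _).le) fun k _ =>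
    (?_ : _ ≤ gaussDecay)).trans_eq (by simp)
  simp only [div_eq_mul_inv]
  refine integral_exp_neg_gaussian_le ((measurable_projections_apply k u).sub
    (measurable_projections_apply k v)) (map_projections_sub k u v) ?_
  rw [coe_projVar, Real.sqrt_sq (norm_nonneg _), ← div_eq_mul_inv,
    le_div_iff₀ (Real.sqrt_pos.2 hβ)]
  linarith [norm_normalized_sub_ge hx hβ hβ1 hu hv h]

theorem prob_mem_mem_separator (hx1 : ∀ u, ‖x u‖ ≤ 1) (hx : SatisfiesL22Triangle x) (hm : 2 ≤ m)
    (hβ : 0 < β) (hβ1 : β < 1) (hR : gaussDecay ^ R ≤ 1 / (m + m)) (u v : Fin n)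
    (h : β * min (‖x u‖ ^ 2) (‖x v‖ ^ 2) ≤ ‖x u - x v‖ ^ 2) :
    tapeLaw.real {ω | u ∈ separator x R m β ω ∧ v ∈ separator x R m β ω} ≤
      scale n m * (min (‖x u‖ ^ 2) (‖x v‖ ^ 2) / m) := by
  simp only [mem_separator]
  have hmeas := (measurableSet_inSet x R m β u).inter (measurableSet_inSet x R m β v)
  have hα := scale_pos (n := n) (m := m) (by linarith)
  refine (tapeLaw_real_eq hmeas).trans_le ?_
  set μ := min (‖x u‖ ^ 2) (‖x v‖ ^ 2)
  have hμ0 : 0 ≤ μ := le_min (sq_nonneg _) (sq_nonneg _)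
  have hμ1 : μ ≤ 1 := (min_le_left _ _).trans (pow_le_one₀ (norm_nonneg _) (hx1 u))
  set P : (ℕ → ℝ) → ℝ := fun g =>
    ∏ k ∈ range R, Real.exp (-(|projections x g k u - projections x g k v| / √β)) with hP
  have hbound : ∀ g, unifLaw.real {z | (z, g) ∈ {ω | InSet x R m β ω u} ∩ {ω | InSet x R m β ω v}} ≤
      μ * (scale n m * (P g + 1 / (m + m))) := fun g => by
    simp only [hP, Set.mem_inter_iff, Set.mem_ofPred_eq, InSet]
    rw [← measureReal_same u.2 v.2]
    exact measureReal_mem_mem_le hm u.2 v.2 hμ0 hμ1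
  have hPint : Integrable P gaussLaw := by
    simp only [hP, ← Real.exp_sum, sum_neg_distrib]
    refine integrable_exp_neg_mul_abs (Finset.measurable_sum _ fun k _ => ?_)
      fun g => sum_nonneg fun k _ => by positivity
    exact (((measurable_projections_apply k u).sub (measurable_projections_apply k v)).abs).div_const _
  have hint : Integrable (fun g => P g + 1 / (m + m)) gaussLaw := hPint.add (integrable_const _)
  refine (integral_mono_of_nonneg (.of_forall fun _ => measureReal_nonneg)
    ((hint.const_mul _).const_mul _) (.of_forall hbound)).trans ?_
  rw [integral_const_mul, integral_const_mul, integral_add hPint (integrable_const _),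
    integral_const, probReal_univ, one_smul]
  -- If one of the vectors vanishes, both sides are zero; otherwise both can be normalized and the
  -- angle bound applies.
  rcases hμ0.eq_or_lt with h0 | h0
  · simp [← h0]
  · have hu : 0 < ‖x u‖ := by
      have := h0.trans_le (min_le_left _ _)
      exact (norm_nonneg _).lt_of_ne' fun h' => by simp [h'] at this
    have hv : 0 < ‖x v‖ := by
      have := h0.trans_le (min_le_right _ _)
      exact (norm_nonneg _).lt_of_ne' fun h' => by simp [h'] at this
    have h1 := (integral_same_le (R := R) hx hβ hβ1 hu hv h).trans hR
    have h2 : 1 / (m + m) + 1 / (m + m) = 1 / m := by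
      have : m ≠ 0 := by linarith
      rw [← two_mul m]
      field_simp
      norm_num
    calc μ * (scale n m * (∫ g, P g ∂gaussLaw + 1 / (m + m)))
        ≤ μ * (scale n m * (1 / m)) := by gcongr; linarith
      _ = scale n m * (μ / m) := by ring

end

/-! ### Probability that a hyperedge is cut -/

/-- The maximum of Gaussian variables of variance at most `σ ^ 2`, where `σ` may vanish. -/
theorem integral_max_gaussian_le_of_nonneg {Ω ι : Type*} [MeasurableSpace Ω] {μ : Measure Ω}
    [IsProbabilityMeasure μ] {e : Finset ι} (he : 2 ≤ #e) {X : ι → Ω → ℝ} {v : ι → ℝ≥0} {σ : ℝ}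
    (hσ : 0 ≤ σ) (hlaw : ∀ i, μ.map (X i) = gaussianReal 0 (v i)) (hv : ∀ i ∈ e, v i ≤ σ ^ 2)
    {M : Ω → ℝ} (hM0 : ∀ ω, 0 ≤ M ω) (hM : ∀ ω, ∃ i ∈ e, M ω ≤ |X i ω|) :
    ∫ ω, M ω ∂μ ≤ 3 * σ * √(Real.log #e) := by
  set l := √(Real.log #e)
  have hl : 0 < l := Real.sqrt_pos.2 (Real.log_pos (by exact_mod_cast he))
  refine le_of_forall_pos_le_add fun ε hε => ?_
  have h1 : σ ≤ σ + ε / (3 * l) := le_add_of_nonneg_right (by positivity)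
  refine (integral_max_gaussian_le he (σ := σ + ε / (3 * l)) (by positivity) hlaw
    (fun i hi => (hv i hi).trans (by gcongr)) hM0 hM).trans_eq ?_
  change 3 * (σ + ε / (3 * l)) * l = 3 * σ * l + ε
  field_simp

theorem integrable_of_gaussian {Ω : Type*} [MeasurableSpace Ω] {μ : Measure Ω} {X : Ω → ℝ}
    (hX : Measurable X) {v : ℝ≥0} (hlaw : μ.map X = gaussianReal 0 v) : Integrable X μ := by
  have h1 : Integrable id (gaussianReal 0 v) := memLp_one_iff_integrable.1 (memLp_id_gaussianReal 1)
  rw [← hlaw, integrable_map_measure (by fun_prop) hX.aemeasurable] at h1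
  exact h1

section

variable {n d : ℕ} {x : Fin n → EuclideanSpace ℝ (Fin d)} {R : ℕ} {m β : ℝ}

/-- The largest distance of a projection of a vertex of `e` from that of `u₀`. -/
noncomputable def spread (x : Fin n → EuclideanSpace ℝ (Fin d)) (e : Finset (Fin n))
    (he : e.Nonempty) (u₀ : Fin n) (k : ℕ) (g : ℕ → ℝ) : ℝ :=
  e.sup' he fun u => |projections x g k u - projections x g k u₀|

variable {e : Finset (Fin n)} (he : e.Nonempty)

theorem integrable_spread (u₀ : Fin n) (k : ℕ) :
    Integrable (spread x e he u₀ k) gaussLaw := by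
  have h1 : spread x e he u₀ k =
      e.sup' he fun u g => |projections x g k u - projections x g k u₀| := by
    funext g
    rw [spread, Finset.sup'_apply]
  rw [h1]
  refine Finset.sup'_induction he _ (p := fun f => Integrable f gaussLaw)
    (fun f hf g hg => hf.sup hg) fun u _ => ?_
  exact (integrable_of_gaussian ((measurable_projections_apply k u).sub
    (measurable_projections_apply k u₀)) (map_projections_sub k u u₀)).abs

theorem spread_nonneg (u₀ : Fin n) (k : ℕ) (g : ℕ → ℝ) : 0 ≤ spread x e he u₀ k g := by
  obtain ⟨u, hu⟩ := he
  exact (abs_nonneg _).trans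
    (le_sup' (fun u : Fin n => |projections x g k u - projections x g k u₀|) hu)

theorem norm_sub_le_edgeDiam {u v : Fin n} (hu : u ∈ e) (hv : v ∈ e) :
    ‖x u - x v‖ ≤ edgeDiam x e he := by
  have h : (u, v) ∈ e ×ˢ e := mem_product.2 ⟨hu, hv⟩
  exact le_sup' (f := fun p : Fin n × Fin n => ‖x p.1 - x p.2‖) (b := (u, v)) h

theorem edgeDiam_nonneg : 0 ≤ edgeDiam x e he := by
  obtain ⟨u, hu⟩ := he
  exact (norm_nonneg _).trans (norm_sub_le_edgeDiam ⟨u, hu⟩ hu hu)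

theorem edgeMinNorm_le {u : Fin n} (hu : u ∈ e) : edgeMinNorm x e he ≤ ‖x u‖ :=
  inf'_le (fun w => ‖x w‖) hu

theorem edgeMinNorm_nonneg : 0 ≤ edgeMinNorm x e he :=
  le_inf' _ _ fun _ _ => norm_nonneg _

/-- The factor `edgeMinNorm` cancels the denominator of the standard deviation `2D / a`, and it also
covers edges that contain a zero vector. -/
theorem edgeMinNorm_mul_integral_spread_le {u₀ : Fin n} (hu₀ : u₀ ∈ e) (k : ℕ) :
    edgeMinNorm x e he * ∫ g, spread x e he u₀ k g ∂gaussLaw ≤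
      6 * edgeDiam x e he * √(Real.log #e) := by
  have hD := edgeDiam_nonneg (x := x) he
  set a := edgeMinNorm x e he with ha
  set D := edgeDiam x e he
  have hrhs : 0 ≤ 6 * D * √(Real.log #e) := by positivity
  rcases (edgeMinNorm_nonneg (x := x) he).eq_or_lt with h0 | h0
  · rw [ha, ← h0, zero_mul]
    exact hrhs
  by_cases hcard : 2 ≤ #e
  · have h1 := integral_max_gaussian_le_of_nonneg (μ := gaussLaw) hcard
      (X := fun u g => projections x g k u - projections x g k u₀) (v := fun u => projVar x u u₀)
      (σ := 2 * D / a) (by positivity) (fun u => map_projections_sub k u u₀)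
      (fun u hu => by
        rw [coe_projVar]
        gcongr
        exact norm_normalized_sub_le h0 (edgeMinNorm_le he hu) (edgeMinNorm_le he hu₀)
          (norm_sub_le_edgeDiam he hu hu₀))
      (M := spread x e he u₀ k) (spread_nonneg he u₀ k) fun g => by
        obtain ⟨u, hu, heq⟩ := exists_mem_eq_sup' he
          fun u : Fin n => |projections x g k u - projections x g k u₀|
        exact ⟨u, hu, heq.le⟩
    have ha' : a ≠ 0 := h0.ne'
    calc a * ∫ g, spread x e he u₀ k g ∂gaussLaw
        ≤ a * (3 * (2 * D / a) * √(Real.log #e)) := by gcongr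
      _ = 6 * D * √(Real.log #e) := by field_simp; ring
  -- For a single vertex the spread is zero, in accordance with `log 1 = 0`.
  · have hone : ∀ u ∈ e, u = u₀ := fun u hu =>
      card_le_one.1 (by omega) u hu u₀ hu₀
    have hz : ∀ g, spread x e he u₀ k g = 0 := fun g => by
      refine le_antisymm (sup'_le _ _ fun u hu => ?_) (spread_nonneg he u₀ k g)
      rw [hone u hu, sub_self, abs_zero]
    simpa [hz] using hrhs

theorem measurableSet_isCutBy :
    MeasurableSet {ω | IsCutBy e (separator x R m β ω)} := by
  simp only [IsCutBy, mem_separator, Set.ofPred_and]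
  refine MeasurableSet.inter ?_ ?_
  · have : {ω | ∃ u ∈ e, InSet x R m β ω u} = ⋃ u ∈ e, {ω | InSet x R m β ω u} := by
      ext; simp
    rw [this]
    exact e.measurableSet_biUnion fun u _ => measurableSet_inSet x R m β u
  · have : {ω | ∃ u ∈ e, ¬ InSet x R m β ω u} = ⋃ u ∈ e, {ω | InSet x R m β ω u}ᶜ := by
      ext; simp
    rw [this]
    exact e.measurableSet_biUnion fun u _ => (measurableSet_inSet x R m β u).compl

/-- `measureReal_cut_le` is applied with the extreme squared lengths `a ^ 2` and `b ^ 2`, where `b ^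
2 ≤ a ^ 2 + D ^ 2`. -/
theorem measureReal_isCutBy_le (hx1 : ∀ u, ‖x u‖ ≤ 1) (hx : SatisfiesL22Triangle x) (hm : 2 ≤ m)
    {u₀ : Fin n} (hu₀ : u₀ ∈ e) (g : ℕ → ℝ) :
    unifLaw.real {z | (z, g) ∈ {ω | IsCutBy e (separator x R m β ω)}} ≤
      (scale n m + 1) * edgeDiam x e he ^ 2 + edgeMinNorm x e he ^ 2 *
        ∑ k ∈ range R, 2 * spread x e he u₀ k g / √β := by
  set D := edgeDiam x e he
  set a := edgeMinNorm x e he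
  have hα := scale_pos (n := n) (m := m) (by linarith)
  obtain ⟨u₁, hu₁, hmax⟩ := exists_max_image e (fun u => ‖x u‖) he
  obtain ⟨u₂, hu₂, hmin⟩ := exists_mem_eq_inf' he fun u => ‖x u‖
  set b := ‖x u₁‖
  have ha0 : 0 ≤ a := edgeMinNorm_nonneg he
  have hba : b ^ 2 ≤ a ^ 2 + D ^ 2 := by
    have h1 := sq_norm_le_add hx u₁ u₂
    have h2 : ‖x u₁ - x u₂‖ ^ 2 ≤ D ^ 2 := by
      gcongr
      exact norm_sub_le_edgeDiam he hu₁ hu₂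
    have h3 : ‖x u₂‖ = a := hmin.symm
    rw [h3] at h1
    linarith
  set N : ℕ → ℝ := fun i => if h : i < n then ‖x ⟨i, h⟩‖ ^ 2 else 0
  have hN : ∀ u : Fin n, N u = ‖x u‖ ^ 2 := fun u => by simp [N]
  have h1 := measureReal_cut_le (R := R) (β := β) (q := projections x g) hm
    (e := e.map Fin.valEmbedding) (n := n) (u₀ := u₀) (by simp) (mem_map_of_mem Fin.valEmbedding hu₀) (N := N) (a := a ^ 2)
    (b := b ^ 2) (by
      simp only [mem_map, Fin.valEmbedding_apply, forall_exists_index, and_imp,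
        forall_apply_eq_imp_iff₂, hN]
      intro u hu
      gcongr
      exact edgeMinNorm_le he hu) (by
      simp only [mem_map, Fin.valEmbedding_apply, forall_exists_index, and_imp,
        forall_apply_eq_imp_iff₂, hN]
      intro u hu
      gcongr
      exact hmax u hu) (sq_nonneg _) (pow_le_one₀ (norm_nonneg _) (hx1 u₁))
  have h2 := measureReal_separated_le (n := n) (R := R) (β := β) (q := projections x g)
    (e := e.map Fin.valEmbedding) (u₀ := u₀) (by simp) (mem_map_of_mem Fin.valEmbedding hu₀)
    (M := fun k => spread x e he u₀ k g) (by
      simp only [mem_map, Fin.valEmbedding_apply, forall_exists_index, and_imp,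
        forall_apply_eq_imp_iff₂]
      exact fun k u hu => le_sup'
        (fun u : Fin n => |projections x g k u - projections x g k u₀|) hu)
  set p := unifLaw.real {z | ∃ u ∈ e.map Fin.valEmbedding,
    ¬ Same n R β (projections x g) (cutRow n z) u u₀}
  have hp1 : p ≤ 1 := measureReal_le_one
  have hp0 : 0 ≤ p := measureReal_nonneg
  have hset : {z | (z, g) ∈ {ω | IsCutBy e (separator x R m β ω)}} =
      {z | (∃ u ∈ e.map Fin.valEmbedding, (z 0 : ℝ) ≤ N u ∧
        SelectedRep n R m β (projections x g) u z) ∧ ∃ v ∈ e.map Fin.valEmbedding,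
        ¬ ((z 0 : ℝ) ≤ N v ∧ SelectedRep n R m β (projections x g) v z)} := by
    ext z
    simp only [IsCutBy, mem_separator, Set.mem_ofPred_eq, InSet, mem_map, Fin.valEmbedding_apply,
      exists_exists_and_eq_and, hN]
  rw [hset]
  -- The excess of `b ^ 2` over `a ^ 2` is charged to `D ^ 2` with the trivial bound `p ≤ 1`, so
  -- only the least length multiplies the separation probability.
  have h3 : b ^ 2 * p ≤ D ^ 2 + a ^ 2 * p := by
    have h4 : b ^ 2 * p ≤ (a ^ 2 + D ^ 2) * p := by gcongr
    have h5 : D ^ 2 * p ≤ D ^ 2 := mul_le_of_le_one_right (sq_nonneg _) hp1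
    linarith
  have h6 : (b ^ 2 - a ^ 2) * scale n m ≤ D ^ 2 * scale n m := by
    gcongr
    linarith
  have h7 : a ^ 2 * p ≤ a ^ 2 * ∑ k ∈ range R, 2 * spread x e he u₀ k g / √β := by gcongr
  linarith

theorem prob_isCutBy_le (hx1 : ∀ u, ‖x u‖ ≤ 1) (hx : SatisfiesL22Triangle x) (hm : 2 ≤ m) :
    tapeLaw.real {ω | IsCutBy e (separator x R m β ω)} ≤
      (scale n m + 1) * edgeDiam x e he ^ 2 +
        R * (12 * edgeDiam x e he * √(Real.log #e) / √β) * edgeMinNorm x e he := by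
  obtain ⟨u₀, hu₀⟩ := id he
  rw [tapeLaw_real_eq measurableSet_isCutBy]
  have hi : ∀ k ∈ range R, Integrable (fun g => 2 * spread x e he u₀ k g / √β) gaussLaw :=
    fun k _ => ((integrable_spread he u₀ k).const_mul _).div_const _
  have hi' := integrable_finsetSum _ hi
  refine (integral_mono_of_nonneg (.of_forall fun _ => measureReal_nonneg)
    ((integrable_const _).add (hi'.const_mul _))
    (.of_forall (measureReal_isCutBy_le he hx1 hx hm hu₀))).trans ?_
  simp only [Pi.add_apply]
  rw [integral_add (integrable_const _) (hi'.const_mul _), integral_const, probReal_univ, one_smul,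
    integral_const_mul, integral_finsetSum _ hi]
  refine add_le_add le_rfl ?_
  have ha0 : 0 ≤ edgeMinNorm x e he := edgeMinNorm_nonneg he
  rw [mul_sum]
  refine (sum_le_card_nsmul _ _
    (12 * edgeDiam x e he * √(Real.log #e) / √β * edgeMinNorm x e he) fun k _ => ?_).trans_eq ?_
  · rw [integral_div, integral_const_mul]
    have h1 := edgeMinNorm_mul_integral_spread_le he hu₀ k (x := x)
    calc edgeMinNorm x e he ^ 2 * (2 * (∫ g, spread x e he u₀ k g ∂gaussLaw) / √β)
        = 2 * (edgeMinNorm x e he * ∫ g, spread x e he u₀ k g ∂gaussLaw) / √β *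
          edgeMinNorm x e he := by ring
      _ ≤ 2 * (6 * edgeDiam x e he * √(Real.log #e)) / √β * edgeMinNorm x e he := by gcongr
      _ = 12 * edgeDiam x e he * √(Real.log #e) / √β * edgeMinNorm x e he := by ring
  · rw [card_range, nsmul_eq_mul]
    ring

end

end RealRAM

/-! ### Choice of the constants and conclusion -/

namespace RealRAM

open Finset MeasureTheory ProbabilityTheory
open scoped NNReal ENNReal

theorem le_two_pow_ceil_logb {m : ℝ} (hm : 0 < m) : m ≤ 2 ^ ⌈Real.logb 2 m⌉₊ := by
  rw [← Real.rpow_natCast, ← Real.logb_le_iff_le_rpow one_lt_two hm]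
  exact Nat.le_ceil _

theorem ceil_logb_le {m : ℝ} (hm : 2 ≤ m) : (⌈Real.logb 2 m⌉₊ : ℝ) ≤ 3 * Real.log m := by
  have h0 : 0 ≤ Real.logb 2 m := Real.logb_nonneg one_lt_two (by linarith)
  have h1 := (Nat.ceil_lt_add_one h0).le
  have h2 := Real.log_two_gt_d9
  have h3 : Real.log 2 ≤ Real.log m := Real.log_le_log two_pos hm
  have h4 : Real.logb 2 m * Real.log 2 = Real.log m :=
    div_mul_cancel₀ _ (by linarith)
  nlinarith

/-- A block of `K` rounds gains a factor 4, so the total is at most `(2 ^ L) ^ (-2) ≤ m ^ (-2)`, and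
`2 ≤ m` turns this into `1 / (2m)`. -/
theorem pow_mul_ceil_logb_le {m c : ℝ} {K : ℕ} (hm : 2 ≤ m) (hc : 0 ≤ c) (hK : c ^ K ≤ 1 / 4) :
    c ^ (K * ⌈Real.logb 2 m⌉₊) ≤ 1 / (m + m) := by
  set L := ⌈Real.logb 2 m⌉₊
  have h1 : m ≤ 2 ^ L := le_two_pow_ceil_logb (by linarith)
  calc c ^ (K * L) = (c ^ K) ^ L := pow_mul _ _ _
    _ ≤ (1 / 4) ^ L := by gcongr
    _ = 1 / (2 ^ L * 2 ^ L) := by rw [← mul_pow, div_pow, one_pow]; norm_num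
    _ ≤ 1 / (m + m) := by
      refine one_div_le_one_div_of_le (by linarith) ?_
      nlinarith

theorem isL2L22OrthogonalSeparator_separator {n d : ℕ} {x : Fin n → EuclideanSpace ℝ (Fin d)}
    {m β : ℝ} {K : ℕ} (hK : gaussDecay ^ K ≤ 1 / 4) (hx1 : ∀ u, ‖x u‖ ≤ 1)
    (hx : SatisfiesL22Triangle x) (hm : 2 ≤ m) (hβ : 0 < β) (hβ1 : β < 1) :
    IsL2L22OrthogonalSeparator tapeLaw x (separator x (K * ⌈Real.logb 2 m⌉₊) m β) m
      (fun r => (72 * K + 3) * (β ^ (-(1 / 2) : ℝ) * √(Real.log r) *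
        (m * Real.log m * max 1 (Real.log (Real.log m))))) ((72 * K + 3) * m) (scale n m) β where
  measurableSet_mem u := by
    simp only [mem_separator]
    exact measurableSet_inSet _ _ _ _ u
  scale_pos := scale_pos (by linarith)
  threshold_pos := hβ
  threshold_lt_one := hβ1
  prob_mem := prob_mem_separator hx1 hm
  prob_mem_mem := prob_mem_mem_separator hx1 hx hm hβ hβ1
    (pow_mul_ceil_logb_le hm gaussDecay_nonneg hK)
  prob_cut e he := by
    refine (prob_isCutBy_le he hx1 hx hm).trans ?_
    have hα : 0 < scale n m := scale_pos (by linarith)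
    have h1 : 1 ≤ scale n m * (m + m) := one_le_scale_mul (by linarith)
    have hL := ceil_logb_le hm
    have hD := edgeDiam_nonneg (x := x) he
    have ha := edgeMinNorm_nonneg (x := x) he
    have hlog : 0 ≤ Real.log m := Real.log_nonneg (by linarith)
    have hβ' : β ^ (-(1 / 2) : ℝ) = 1 / √β := by
      rw [Real.rpow_neg hβ.le, ← Real.sqrt_eq_rpow, one_div]
    rw [hβ']
    set D := edgeDiam x e he
    set a := edgeMinNorm x e he
    set l := √(Real.log #e)
    set M := max 1 (Real.log (Real.log m))
    set α := scale n m
    have hM : 1 ≤ M := le_max_left _ _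
    have hl : 0 ≤ l := Real.sqrt_nonneg _
    -- The summand 1 is at most `2 * α * m` and `α` is at most `α * m`, whence the 3.
    have h2 : α + 1 ≤ α * ((72 * K + 3) * m) := by
      have h3 : 0 ≤ α * (72 * K * m) := by positivity
      nlinarith
    refine add_le_add (by gcongr) ?_
    have hK0 : (0 : ℝ) ≤ K := K.cast_nonneg
    calc ((K * ⌈Real.logb 2 m⌉₊ : ℕ) : ℝ) * (12 * D * l / √β) * a
        = K * ⌈Real.logb 2 m⌉₊ * (12 * D * l / √β) * a := by push_cast; ring
      _ ≤ K * (3 * Real.log m) * (12 * D * l / √β) * a := by gcongr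
      _ = 1 * (36 * K * Real.log m * 1 * (1 / √β * l) * a * D) := by ring
      -- The factor `m` in the distortion comes from replacing 1 by `α * (m + m)`. The double
      -- logarithm enters only through `1 ≤ M`; the argument proves the bound without it. The added
      -- `3 / 2` matches the constant of the other term.
      _ ≤ α * (m + m) * ((36 * K + 3 / 2) * Real.log m * M * (1 / √β * l) * a * D) := by
        gcongr
        linarith
      _ = _ := by ring

end RealRAM

theorem mainTheorem7 :
    ∃ (P : RealRAM.Prog) (T : Polynomial ℕ) (C : ℝ), 0 < C ∧
      ∀ (n d : ℕ) (x : Fin n → EuclideanSpace ℝ (Fin d)) (m β : ℝ),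
        (∀ u, ‖x u‖ ≤ 1) → SatisfiesL22Triangle x → 2 ≤ m → 0 < β → β < 1 →
        ∃ S : RealRAM.Tape → Finset (Fin n),
          (∀ ω : RealRAM.Tape, ∃ (t : ℕ) (s : RealRAM.State),
            RealRAM.Exec ω P (RealRAM.input x m β) t s ∧
            t ≤ T.eval (n + d + ⌈Real.logb 2 m⌉₊) ∧
            S ω = RealRAM.output n s) ∧
          ∃ α : ℝ, 1 / (n : ℝ) ≤ α ∧
            IsL2L22OrthogonalSeparator RealRAM.tapeLaw x S m
              (fun r => C * (β ^ (-(1 / 2) : ℝ) * √(Real.log r) *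
                (m * Real.log m * max 1 (Real.log (Real.log m)))))
              (C * m) α β := by
  -- `K` depends only on the absolute constant `gaussDecay`, so it can be hard-wired into one
  -- program for all inputs.
  obtain ⟨K, hK⟩ := exists_pow_lt_of_lt_one (show (0 : ℝ) < 1 / 4 by norm_num)
    RealRAM.gaussDecay_lt_one
  refine ⟨RealRAM.separatorProg K, RealRAM.stepBound K, 72 * K + 3, by positivity, ?_⟩
  intro n d x m β hx1 hx hm hβ hβ1
  refine ⟨RealRAM.separator x (K * ⌈Real.logb 2 m⌉₊) m β, fun ω => ?_, RealRAM.scale n m,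
    le_max_left _ _,
    RealRAM.isL2L22OrthogonalSeparator_separator hK.le hx1 hx hm hβ hβ1⟩
  obtain ⟨t, s, hexec, ht, hs⟩ := RealRAM.halts_separatorProg x K (m := m) (β := β) (by linarith) ω
  refine ⟨t, s, hexec, ht, Finset.ext fun u => ?_⟩
  rw [RealRAM.mem_separator, ← RealRAM.member_iff, ← hs u u.2]
  simp [RealRAM.output]
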